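/- Let $d\in\{1,2\}$ and let $0\le m<k$ be integers. Let $\mathcal T_h$ be a rectangular partition of a box $\Omega=\prod_{i=1}^d[a_i,b_i]$ into elements $K_\theta=\prod_{i=1}^d I^i_{\theta_i}$, $1\le\theta_i\le N_i$, where $I^i_1,\dots,I^i_{N_i}$ are the consecutive closed intervals of a partition of $[a_i,b_i]$. Write $h^i_K$ for the length of $K$ in direction $i$ and $h$, $\underline h$ for the maximum and the minimum of $h_K^i$ over all $K\in\mathcal T_h$ and $1\le i\le d$. In each direction the one-dimensional stencil is either $S^1(I_j)=\{I_{j-1},I_j,I_{j+1}\}$ for all $j$, with the partition extended periodically beyond $[a_i,b_i]$; or, if $N_i\ge 3$, $S^1(I_1)=\{I_1,I_2,I_3\}$, $S^1(I_{N_i})=\{I_{N_i-2},I_{N_i-1},I_{N_i}\}$ and $S^1(I_j)=\{I_{j-1},I_j,I_{j+1}\}$ for $1<j<N_i$. The stencil $S(K_\theta)$ is the tensor product of the stencils $S^1(I^i_{\theta_i})$; the union of its elements is also denoted by $S(K_\theta)$, and Sobolev spaces on $K$ or $S(K)$ are those on the interior. Let $Q^k(S(K))$ be the polynomials of degree at most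 $k$ in each variable. For an element $K$ with centre $(x_K^1,\dots,x_K^d)$ and $\alpha\in\mathbb N_0^d$, the Legendre moment of $u$ is $$I_K^\alpha u=\Big(\prod_{i=1}^d\frac{2\alpha_i+1}{h_K^i}\Big)\int_K\prod_{i=1}^d\widehat L^{\alpha_i}\Big(\frac{2(x_i-x_K^i)}{h_K^i}\Big)u(x)\,dx,\qquad \widehat L^n(t)=\frac{(-1)^n}{2^n n!}\frac{d^n}{dt^n}(1-t^2)^n .$$ With $A^m=\{0,\dots,m\}^d$, the reconstruction $R_K^ku\in Q^k(S(K))$ is the solution of $$I_{K'}^\alpha R_K^ku=I_{K'}^\alpha u\qquad\text{for all }K'\in S(K),\ \alpha\in A^m. \tag{1}$$ Assume that (1) is unisolvent on $\mathcal T_h$: for every $K\in\mathcal T_h$, if $w\in Q^k(S(K))$ satisfies $I^\alpha_{K'}w=0$ for all $K'\in S(K)$ and $\alpha\in A^m$, then $w=0$ on $S(K)$. Then the following hold for every $K\in\mathcal T_h$. 1. If $k+1=3(m+1)$ (that is, if (1) is a square system), then (1) has exactly one solution for every $u$ integrable on $S(K)$. 2. $R_K^ku=u$ for every $u\in Q^k(S(K))$.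 3. Suppose $h\le\gamma\underline h$ with $\gamma>0$. Then for every $u\in H^{k+1}(S(K))$ for which (1) is solvable (every such $u$ if $k+1=3(m+1)$), one has $u-R_K^ku\in H^1(K)$ and $$\|u-R_K^ku\|_{L^\infty(K)}\le C\,h^{k+1-d/2}\,|u|_{H^{k+1}(S(K))},$$ $$\|u-R_K^ku\|_{L^2(K)}\le C\,h^{k+1}\,|u|_{H^{k+1}(S(K))},$$ $$|u-R_K^ku|_{H^1(K)}\le C\,h^{k}\,|u|_{H^{k+1}(S(K))},$$ where $C>0$ depends only on $d,k,m,\gamma$; in particular it does not depend on $h$, the mesh, $K$ or $u$. -/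

import Mathlib

open MeasureTheory
open scoped ENNReal ContDiff

noncomputable section

/-! ### Sobolev spaces of integer order on an open set -/

/-- Classical partial derivative in the `i`-th coordinate direction. -/
def partialDeriv {d : ℕ} (i : Fin d) (f : (Fin d → ℝ) → ℝ) : (Fin d → ℝ) → ℝ :=
  fun x => fderiv ℝ f x (Pi.single i 1)

/-- Classical mixed partial derivative `∂^α f` for a multi-index `α`. -/
def multiDeriv {d : ℕ} (α : Fin d → ℕ) (f : (Fin d → ℝ) → ℝ) : (Fin d → ℝ) → ℝ :=
  (List.finRange d).foldr (fun i g => (partialDeriv i)^[α i] g) f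

/-- `g` is the weak derivative `∂^α u` on the open set `U`. -/
def HasWeakDeriv {d : ℕ} (U : Set (Fin d → ℝ)) (α : Fin d → ℕ)
    (u g : (Fin d → ℝ) → ℝ) : Prop :=
  LocallyIntegrableOn u U ∧ LocallyIntegrableOn g U ∧
    ∀ φ : (Fin d → ℝ) → ℝ, ContDiff ℝ ∞ φ → HasCompactSupport φ → tsupport φ ⊆ U →
      ∫ x in U, u x * multiDeriv α φ x = (-1) ^ (∑ i, α i) * ∫ x in U, g x * φ x

/-- `u ∈ H^n(U)`: all weak derivatives of order at most `n` exist and lie in `L²(U)`. -/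
def MemSobolev {d : ℕ} (U : Set (Fin d → ℝ)) (n : ℕ) (u : (Fin d → ℝ) → ℝ) : Prop :=
  ∀ α : Fin d → ℕ, ∑ i, α i ≤ n →
    ∃ g, HasWeakDeriv U α u g ∧ MemLp g 2 (volume.restrict U)

open Classical in
/-- A representative of the weak derivative `∂^α u` on `U` (which is unique up to null sets),
and `0` if there is none. -/
def weakDeriv {d : ℕ} (U : Set (Fin d → ℝ)) (α : Fin d → ℕ) (u : (Fin d → ℝ) → ℝ) :
    (Fin d → ℝ) → ℝ :=
  if h : ∃ g, HasWeakDeriv U α u g then h.choose else 0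

/-- The seminorm `|u|_{n,U} = (∑_{|α| = n} ‖∂^α u‖²_{L²(U)})^{1/2}`, meaningful for `u ∈ H^n(U)`. -/
def sobolevSeminorm {d : ℕ} (U : Set (Fin d → ℝ)) (n : ℕ) (u : (Fin d → ℝ) → ℝ) : ℝ≥0∞ :=
  (∑ α ∈ Finset.piAntidiag (Finset.univ : Finset (Fin d)) n,
    eLpNorm (weakDeriv U α u) 2 (volume.restrict U) ^ 2) ^ (1 / 2 : ℝ)

/-! ### Rectangular meshes and stencils -/

/-- Which one-dimensional stencils are used in a coordinate direction: the centred ones on the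
periodic extension of the partition, or the biased ones next to the two end points. -/
inductive BoundaryKind
  | periodic
  | nonperiodic

/-- A rectangular partition of the box `∏ i, [node i 0, node i (N i)]`. -/
structure RectMesh (d : ℕ) where
  /-- number of elements in each direction -/
  N : Fin d → ℕ
  N_pos : ∀ i, 0 < N i
  /-- the end points of the one-dimensional elements -/
  node : ∀ i, Fin (N i + 1) → ℝ
  node_strictMono : ∀ i, StrictMono (node i)
  kind : Fin d → BoundaryKind
  /-- the biased stencil needs three elements -/
  three_le : ∀ i, kind i = BoundaryKind.nonperiodic → 3 ≤ N i

namespace RectMesh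

variable {d : ℕ} (T : RectMesh d)

/-- The nodes in direction `i` indexed by `ℤ`: for `0 ≤ j ≤ N i` this is the `j`-th node of the
partition, for the other `j` it is obtained by periodic extension. -/
def extNode (i : Fin d) (j : ℤ) : ℝ :=
  T.node i ⟨(j % (T.N i : ℤ)).toNat, by
      have hN : (0 : ℤ) < (T.N i : ℤ) := by exact_mod_cast T.N_pos i
      have h1 := Int.emod_nonneg j hN.ne'
      have h2 := Int.emod_lt_of_pos j hN
      omega⟩
    + ((j / (T.N i : ℤ) : ℤ) : ℝ) * (T.node i (Fin.last (T.N i)) - T.node i 0)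

/-- Length of the `j`-th one-dimensional element `[extNode i j, extNode i (j + 1)]`. -/
def width (i : Fin d) (j : ℤ) : ℝ := T.extNode i (j + 1) - T.extNode i j

/-- Midpoint of the `j`-th one-dimensional element. -/
def center (i : Fin d) (j : ℤ) : ℝ := (T.extNode i j + T.extNode i (j + 1)) / 2

/-- The element `K_η`; it belongs to the mesh itself when `0 ≤ η i < N i` for all `i`. -/
def cell (η : Fin d → ℤ) : Set (Fin d → ℝ) :=
  Set.univ.pi fun i => Set.Icc (T.extNode i (η i)) (T.extNode i (η i + 1))

/-- Indices of the elements of the mesh, counted from `0`. -/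
abbrev Index : Type := ∀ i : Fin d, Fin (T.N i)

/-- The multi-index of an element of the mesh, as an integer multi-index. -/
def toInt (θ : T.Index) : Fin d → ℤ := fun i => ((θ i : ℕ) : ℤ)

/-- The maximal mesh size. -/
def maxSize : ℝ := ⨆ p : (Σ i : Fin d, Fin (T.N i)), T.width p.1 ((p.2 : ℕ) : ℤ)

/-- The minimal mesh size. -/
def minSize : ℝ := ⨅ p : (Σ i : Fin d, Fin (T.N i)), T.width p.1 ((p.2 : ℕ) : ℤ)

/-- Mesh regularity with parameter `γ`. -/
def IsRegular (γ : ℝ) : Prop := T.maxSize ≤ γ * T.minSize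

/-- The one-dimensional stencil of the `j`-th element in direction `i`. -/
def stencil1 (i : Fin d) (j : Fin (T.N i)) : Finset ℤ :=
  match T.kind i with
  | BoundaryKind.periodic => {((j : ℕ) : ℤ) - 1, ((j : ℕ) : ℤ), ((j : ℕ) : ℤ) + 1}
  | BoundaryKind.nonperiodic =>
    if (j : ℕ) = 0 then {0, 1, 2}
    else if (j : ℕ) + 1 = T.N i then {(T.N i : ℤ) - 3, (T.N i : ℤ) - 2, (T.N i : ℤ) - 1}
    else {((j : ℕ) : ℤ) - 1, ((j : ℕ) : ℤ), ((j : ℕ) : ℤ) + 1}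

/-- The stencil `S(K_θ)`, the tensor product of the one-dimensional stencils. -/
def stencil (θ : T.Index) : Finset (Fin d → ℤ) :=
  Fintype.piFinset fun i => T.stencil1 i (θ i)

/-- The region covered by the elements of the stencil `S(K_θ)`. -/
def stencilRegion (θ : T.Index) : Set (Fin d → ℝ) := ⋃ η ∈ T.stencil θ, T.cell η

end RectMesh

/-! ### Legendre moments and the reconstruction operator -/

/-- The Legendre polynomial of degree `n`, by Rodrigues' formula. -/
def legendrePoly (n : ℕ) : Polynomial ℝ :=
  Polynomial.C ((-1) ^ n / (2 ^ n * (n.factorial : ℝ))) *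
    (Polynomial.derivative)^[n] ((1 - Polynomial.X ^ 2) ^ n)

/-- `Q^k`: real polynomials in `d` variables of degree at most `k` in each variable. -/
abbrev QPoly (d k : ℕ) : Submodule ℝ (MvPolynomial (Fin d) ℝ) :=
  MvPolynomial.restrictDegree (Fin d) ℝ k

namespace RectMesh

variable {d : ℕ} (T : RectMesh d)

/-- The Legendre basis function `L_{K_η}^α`. -/
def legendreBasis (η : Fin d → ℤ) (α : Fin d → ℕ) (x : Fin d → ℝ) : ℝ :=
  ∏ i, (legendrePoly (α i)).eval (2 * (x i - T.center i (η i)) / T.width i (η i))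

/-- The Legendre moment `I_{K_η}^α u`. -/
def moment (η : Fin d → ℤ) (α : Fin d → ℕ) (u : (Fin d → ℝ) → ℝ) : ℝ :=
  (∏ i, (2 * (α i : ℝ) + 1) / T.width i (η i)) *
    ∫ x in T.cell η, T.legendreBasis η α x * u x

/-- Unisolvence of the moment system: for every element `K` of the mesh, a polynomial in
`Q^k(S(K))` whose moments with index in `{0, …, m}^d` vanish on all elements of `S(K)` vanishes
on `S(K)`. -/
def Unisolvent (m k : ℕ) : Prop :=
  ∀ θ : T.Index, ∀ w ∈ QPoly d k,
    (∀ η ∈ T.stencil θ, ∀ α : Fin d → ℕ, (∀ i, α i ≤ m) →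
      T.moment η α (fun x => MvPolynomial.eval x w) = 0) →
    ∀ x ∈ T.stencilRegion θ, MvPolynomial.eval x w = 0

/-- `p ∈ Q^k(S(K_θ))` solves the moment system for `u` on the stencil of `K_θ`. -/
def IsReconstruction (m k : ℕ) (θ : T.Index) (u : (Fin d → ℝ) → ℝ)
    (p : MvPolynomial (Fin d) ℝ) : Prop :=
  p ∈ QPoly d k ∧
    ∀ η ∈ T.stencil θ, ∀ α : Fin d → ℕ, (∀ i, α i ≤ m) →
      T.moment η α (fun x => MvPolynomial.eval x p) = T.moment η α u

open Classical in
/-- The local reconstruction `R_K^k u` for `K = K_θ`: the solution of the moment system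
(`0` if there is none). -/
def reconstruct (m k : ℕ) (θ : T.Index) (u : (Fin d → ℝ) → ℝ) : MvPolynomial (Fin d) ℝ :=
  if h : ∃ p, T.IsReconstruction m k θ u p then h.choose else 0

end RectMesh

end

noncomputable section

/-! ### Calculus of iterated partial derivatives -/

/-! Existence, uniqueness and exactness are linear algebra. A polynomial that vanishes on the
stencil region is zero because the region has interior points, so unisolvence makes the moment map
on `QPoly d k` injective. In the square case both sides have dimension `(k + 1) ^ d` and the map is
bijective. A polynomial in `QPoly d k` solves its own system, hence is reproduced.

For the error, let `p` be the reconstruction, `q` in `QPoly d k` an approximation of `u`, and split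
`u - p = (u - q) - (p - q)`.

Approximation is the Bramble–Hilbert lemma `MemSobolev.exists_polynomial_approx`. For smooth
functions on a box, `q` is the average of the Taylor polynomials over all base points in the box.
The remainder, an integral along segments, is bounded in the maximum norm by the `L²` norm of the
highest derivatives as soon as `d ≤ 2 * k`; this is where `d ≤ 2` enters. Differentiation commutes
with averaging, which gives the gradient bound. A Sobolev function is mollified on slightly smaller
boxes; the approximating polynomials stay in a finite-dimensional space and converge along a
subsequence.

Stability: `p - q` has the moments of `u - q`, which are small, and
`RectMesh.exists_polynomial_bound` bounds a polynomial and its gradient by its moments, uniformly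
over regular meshes. Unisolvence contributes the dimension count `k + 1 ≤ 3 * (m + 1)`. Under this
inequality the one-dimensional moment map on three adjacent intervals is injective whatever their
lengths (`Polynomial.eq_zero_of_integral_mul_eq_zero`): the `(m + 1)`-fold antiderivative of a
polynomial in the kernel has zeros of order `m + 1` at all four nodes, too many for its degree.
After division by the mesh size the lengths lie in the compact set `[γ⁻¹, 1]^3`, on which a left
inverse of the moment matrix depends continuously on them and so is bounded
(`exists_bounded_moment_weights`). Tensor products carry this to dimension `d`. -/

theorem ContDiff.partialDeriv {d : ℕ} {f : (Fin d → ℝ) → ℝ} (hf : ContDiff ℝ ∞ f) (i : Fin d) :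
    ContDiff ℝ ∞ (partialDeriv i f) :=
  (hf.fderiv_right (m := ∞) (by simp)).clm_apply contDiff_const

theorem partialDeriv_comm {d : ℕ} {f : (Fin d → ℝ) → ℝ} (hf : ContDiff ℝ ∞ f) (i j : Fin d) :
    partialDeriv i (partialDeriv j f) = partialDeriv j (partialDeriv i f) := by
  have hd : Differentiable ℝ (fderiv ℝ f) :=
    (hf.fderiv_right (m := ∞) (by simp)).differentiable (by simp)
  have key : ∀ (a b : Fin d) (x : Fin d → ℝ), partialDeriv a (partialDeriv b f) x =
      fderiv ℝ (fderiv ℝ f) x (Pi.single a 1) (Pi.single b 1) := by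
    intro a b x
    have h := (hd x).hasFDerivAt.clm_apply (hasFDerivAt_const (Pi.single b (1 : ℝ)) x)
    change fderiv ℝ (fun y => fderiv ℝ f y (Pi.single b 1)) x (Pi.single a 1) = _
    rw [h.fderiv]
    simp
  funext x
  rw [key, key]
  have hs : IsSymmSndFDerivAt ℝ f x :=
    (hf.contDiffAt (x := x)).isSymmSndFDerivAt (by
      simp only [minSmoothness_of_isRCLikeNormedField]
      exact WithTop.coe_le_coe.mpr (le_top : (2 : ℕ∞) ≤ ⊤))
  exact hs _ _

theorem partialDeriv_add {d : ℕ} {f g : (Fin d → ℝ) → ℝ} (hf : ContDiff ℝ ∞ f)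
    (hg : ContDiff ℝ ∞ g) (i : Fin d) :
    partialDeriv i (fun x => f x + g x) = fun x => partialDeriv i f x + partialDeriv i g x := by
  funext x
  have h1 := hf.differentiable (by simp) x
  have h2 := hg.differentiable (by simp) x
  simp only [partialDeriv]
  rw [fderiv_fun_add h1 h2]
  rfl

theorem partialDeriv_sum {d : ℕ} {ι : Type*} (s : Finset ι) {f : ι → (Fin d → ℝ) → ℝ}
    (hf : ∀ j, ContDiff ℝ ∞ (f j)) (i : Fin d) :
    partialDeriv i (fun x => ∑ j ∈ s, f j x) = fun x => ∑ j ∈ s, partialDeriv i (f j) x := by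
  funext x
  simp only [partialDeriv]
  rw [fderiv_fun_sum fun j _ => (hf j).differentiable (by simp) x]
  simp

theorem partialDeriv_const_mul {d : ℕ} {f : (Fin d → ℝ) → ℝ} (hf : ContDiff ℝ ∞ f) (c : ℝ)
    (i : Fin d) :
    partialDeriv i (fun x => c * f x) = fun x => c * partialDeriv i f x := by
  funext x
  simp only [partialDeriv]
  rw [fderiv_const_mul (hf.differentiable (by simp) x)]
  rfl

theorem fderiv_eq_sum_partialDeriv {d : ℕ} (f : (Fin d → ℝ) → ℝ) (x e : Fin d → ℝ) :
    fderiv ℝ f x e = ∑ i, e i * partialDeriv i f x := by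
  conv_lhs => rw [pi_eq_sum_univ' e]
  simp only [map_sum, map_smul, smul_eq_mul, partialDeriv]

theorem ContDiff.partialDeriv_iterate {d : ℕ} {f : (Fin d → ℝ) → ℝ} (hf : ContDiff ℝ ∞ f)
    (i : Fin d) (n : ℕ) : ContDiff ℝ ∞ ((_root_.partialDeriv i)^[n] f) := by
  induction n with
  | zero => exact hf
  | succ n ih =>
    rw [Function.iterate_succ_apply']
    exact ih.partialDeriv i

theorem partialDeriv_iterate_comm {d : ℕ} {f : (Fin d → ℝ) → ℝ} (hf : ContDiff ℝ ∞ f)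
    (i j : Fin d) (n : ℕ) :
    (partialDeriv j)^[n] (partialDeriv i f) = partialDeriv i ((partialDeriv j)^[n] f) := by
  induction n with
  | zero => rfl
  | succ n ih =>
    rw [Function.iterate_succ_apply', Function.iterate_succ_apply', ih,
      partialDeriv_comm (hf.partialDeriv_iterate j n)]

theorem ContDiff.foldr_partialDeriv {d : ℕ} {f : (Fin d → ℝ) → ℝ} (hf : ContDiff ℝ ∞ f)
    (α : Fin d → ℕ) (L : List (Fin d)) :
    ContDiff ℝ ∞ (L.foldr (fun i g => (_root_.partialDeriv i)^[α i] g) f) := by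
  induction L with
  | nil => exact hf
  | cons a L ih => exact ih.partialDeriv_iterate a _

theorem ContDiff.multiDeriv {d : ℕ} {f : (Fin d → ℝ) → ℝ} (hf : ContDiff ℝ ∞ f)
    (α : Fin d → ℕ) : ContDiff ℝ ∞ (multiDeriv α f) :=
  hf.foldr_partialDeriv α _

theorem foldr_partialDeriv_comm {d : ℕ} {f : (Fin d → ℝ) → ℝ} (hf : ContDiff ℝ ∞ f)
    (α : Fin d → ℕ) (i : Fin d) (L : List (Fin d)) :
    L.foldr (fun j g => (partialDeriv j)^[α j] g) (partialDeriv i f) =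
      partialDeriv i (L.foldr (fun j g => (partialDeriv j)^[α j] g) f) := by
  induction L with
  | nil => rfl
  | cons a L ih =>
    rw [List.foldr_cons, List.foldr_cons, ih,
      partialDeriv_iterate_comm (hf.foldr_partialDeriv α L)]

/-- `multiDeriv` differentiates in the order of a list, so an extra derivative in direction `i` must
be commuted outwards from its own slot. Without duplicates that slot occurs at most once. -/
theorem foldr_partialDeriv_add_single {d : ℕ} {f : (Fin d → ℝ) → ℝ} (hf : ContDiff ℝ ∞ f)
    (α : Fin d → ℕ) (i : Fin d) (L : List (Fin d)) (hL : L.Nodup) :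
    L.foldr (fun j g => (partialDeriv j)^[(α + Pi.single i 1 : Fin d → ℕ) j] g) f =
      if i ∈ L then partialDeriv i (L.foldr (fun j g => (partialDeriv j)^[α j] g) f)
      else L.foldr (fun j g => (partialDeriv j)^[α j] g) f := by
  induction L with
  | nil => simp
  | cons a L ih =>
    have hn := List.nodup_cons.mp hL
    rw [List.foldr_cons, ih hn.2, List.foldr_cons]
    by_cases hia : i = a
    · subst hia
      simp [hn.1, Function.iterate_succ_apply']
    · have h0 : (α + Pi.single i 1 : Fin d → ℕ) a = α a := by
        simp [Ne.symm hia]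
      rw [h0]
      by_cases hiL : i ∈ L
      · simp [hiL, partialDeriv_iterate_comm (hf.foldr_partialDeriv α L)]
      · simp [hiL, hia]

theorem multiDeriv_add_single {d : ℕ} {f : (Fin d → ℝ) → ℝ} (hf : ContDiff ℝ ∞ f)
    (α : Fin d → ℕ) (i : Fin d) :
    multiDeriv (α + Pi.single i 1) f = partialDeriv i (multiDeriv α f) := by
  unfold multiDeriv
  rw [foldr_partialDeriv_add_single hf α i _ (List.nodup_finRange d)]
  simp

theorem multiDeriv_partialDeriv {d : ℕ} {f : (Fin d → ℝ) → ℝ} (hf : ContDiff ℝ ∞ f)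
    (α : Fin d → ℕ) (i : Fin d) :
    multiDeriv α (partialDeriv i f) = multiDeriv (α + Pi.single i 1) f := by
  rw [multiDeriv_add_single hf]
  exact foldr_partialDeriv_comm hf α i _

theorem multiDeriv_zero {d : ℕ} (f : (Fin d → ℝ) → ℝ) : multiDeriv 0 f = f := by
  unfold multiDeriv
  generalize List.finRange d = L
  induction L with
  | nil => rfl
  | cons a L ih => rw [List.foldr_cons, ih]; rfl

theorem multiDeriv_single {d : ℕ} {f : (Fin d → ℝ) → ℝ} (hf : ContDiff ℝ ∞ f) (i : Fin d) :
    multiDeriv (Pi.single i 1) f = partialDeriv i f := by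
  have h := multiDeriv_add_single hf 0 i
  rwa [zero_add, multiDeriv_zero] at h

/-- A property of multi-indices holds if it holds for `0` and is stable under adding a unit. -/
theorem multiIndex_induction {d : ℕ} {P : (Fin d → ℕ) → Prop} (zero : P 0)
    (add_single : ∀ α i, P α → P (α + Pi.single i 1)) (α : Fin d → ℕ) : P α := by
  induction h : ∑ i, α i generalizing α with
  | zero =>
    have : α = 0 := by
      funext i
      exact (Finset.sum_eq_zero_iff.mp h) i (Finset.mem_univ i)
    rw [this]; exact zero
  | succ n ih =>
    obtain ⟨i, hi⟩ : ∃ i, α i ≠ 0 := by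
      by_contra hcon
      push Not at hcon
      simp [hcon] at h
    have hα : α = (α - Pi.single i 1) + Pi.single i 1 := by
      funext j
      by_cases hj : j = i
      · subst hj; simp; omega
      · simp [hj]
    have hs : ∑ j, (α - Pi.single i 1 : Fin d → ℕ) j = n := by
      have := congrArg (fun β : Fin d → ℕ => ∑ j, β j) hα
      simp only [Pi.add_apply, Finset.sum_add_distrib] at this
      rw [h] at this
      simp at this
      simpa using this.symm
    rw [hα]
    exact add_single _ _ (ih _ hs)

/-! ### Directional derivatives and Taylor's formula -/

/-- The `j`-th derivative of `v` at `z`, evaluated at `j` copies of `e`. -/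
def dirDeriv {d : ℕ} : ℕ → ((Fin d → ℝ) → ℝ) → (Fin d → ℝ) → (Fin d → ℝ) → ℝ
  | 0, v, _, z => v z
  | j + 1, v, e, z => ∑ i, e i * dirDeriv j (partialDeriv i v) e z

theorem contDiff_dirDeriv {d : ℕ} (j : ℕ) {v : (Fin d → ℝ) → ℝ} (hv : ContDiff ℝ ∞ v)
    (e : Fin d → ℝ) : ContDiff ℝ ∞ (dirDeriv j v e) := by
  induction j generalizing v with
  | zero => exact hv
  | succ j ih => exact ContDiff.sum fun i _ => contDiff_const.mul (ih (hv.partialDeriv i))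

/-- Here the direction `x - y` moves together with the base point `y`, so smoothness for a fixed
direction does not suffice. -/
theorem continuous_dirDeriv_sub {d : ℕ} (j : ℕ) {v : (Fin d → ℝ) → ℝ} (hv : ContDiff ℝ ∞ v)
    (x : Fin d → ℝ) : Continuous fun y => dirDeriv j v (x - y) y := by
  induction j generalizing v with
  | zero => exact hv.continuous
  | succ j ih =>
    exact continuous_finsetSum _ fun i _ =>
      ((continuous_apply i).comp (continuous_const.sub continuous_id)).mul (ih (hv.partialDeriv i))

theorem partialDeriv_dirDeriv {d : ℕ} (j : ℕ) {v : (Fin d → ℝ) → ℝ} (hv : ContDiff ℝ ∞ v)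
    (e : Fin d → ℝ) (a : Fin d) :
    partialDeriv a (dirDeriv j v e) = dirDeriv j (partialDeriv a v) e := by
  induction j generalizing v with
  | zero => rfl
  | succ j ih =>
    change partialDeriv a (fun z => ∑ i, e i * dirDeriv j (partialDeriv i v) e z) =
      fun z => ∑ i, e i * dirDeriv j (partialDeriv i (partialDeriv a v)) e z
    rw [partialDeriv_sum _ fun i => contDiff_const.mul (contDiff_dirDeriv j (hv.partialDeriv i) e)]
    funext z
    refine Finset.sum_congr rfl fun i _ => ?_
    rw [partialDeriv_const_mul (contDiff_dirDeriv j (hv.partialDeriv i) e), ih (hv.partialDeriv i),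
      partialDeriv_comm hv]

theorem hasDerivAt_dirDeriv {d : ℕ} (j : ℕ) {v : (Fin d → ℝ) → ℝ} (hv : ContDiff ℝ ∞ v)
    (e x : Fin d → ℝ) (s : ℝ) :
    HasDerivAt (fun s : ℝ => dirDeriv j v e (x - s • e)) (-dirDeriv (j + 1) v e (x - s • e)) s := by
  have h1 : HasDerivAt (fun s : ℝ => x - s • e) (-e) s := by
    simpa using ((hasDerivAt_id s).smul_const e).const_sub x
  have h2 := ((contDiff_dirDeriv j hv e).differentiable (by simp) (x - s • e)).hasFDerivAt
  have h3 := h2.comp_hasDerivAt s h1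
  refine h3.congr_deriv ?_
  rw [map_neg, fderiv_eq_sum_partialDeriv]
  simp only [partialDeriv_dirDeriv j hv]
  rfl

/-- The Taylor polynomial of degree `k` of `v` about `y`, evaluated at `x`. -/
def taylorAt {d : ℕ} (k : ℕ) (v : (Fin d → ℝ) → ℝ) (x y : Fin d → ℝ) : ℝ :=
  ∑ j ∈ Finset.range (k + 1), (j.factorial : ℝ)⁻¹ * dirDeriv j v (x - y) y

theorem continuous_taylorAt {d : ℕ} (k : ℕ) {v : (Fin d → ℝ) → ℝ} (hv : ContDiff ℝ ∞ v)
    (x : Fin d → ℝ) : Continuous (taylorAt k v x) :=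
  continuous_finsetSum _ fun j _ => continuous_const.mul (continuous_dirDeriv_sub j hv x)

/-- The sum telescopes under differentiation and only the top-order term survives. Along `x - s • e`
it runs from `v x` at `s = 0` to the Taylor polynomial about `x - e` at `s = 1`. -/
theorem hasDerivAt_taylorSum {d : ℕ} (k : ℕ) {v : (Fin d → ℝ) → ℝ} (hv : ContDiff ℝ ∞ v)
    (e x : Fin d → ℝ) (s : ℝ) :
    HasDerivAt
      (fun s : ℝ => ∑ j ∈ Finset.range (k + 1),
        (j.factorial : ℝ)⁻¹ * s ^ j * dirDeriv j v e (x - s • e))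
      (-((k.factorial : ℝ)⁻¹ * s ^ k * dirDeriv (k + 1) v e (x - s • e))) s := by
  induction k with
  | zero => simpa using hasDerivAt_dirDeriv 0 hv e x s
  | succ k ih =>
    have h1 := ((hasDerivAt_pow (k + 1) s).const_mul (((k + 1).factorial : ℝ)⁻¹)).mul
      (hasDerivAt_dirDeriv (k + 1) hv e x s)
    have h2 := ih.add h1
    have hfun : (fun s : ℝ => ∑ j ∈ Finset.range (k + 1 + 1),
        (j.factorial : ℝ)⁻¹ * s ^ j * dirDeriv j v e (x - s • e)) =
        (fun s : ℝ => ∑ j ∈ Finset.range (k + 1),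
          (j.factorial : ℝ)⁻¹ * s ^ j * dirDeriv j v e (x - s • e)) +
        (fun s : ℝ => ((k + 1).factorial : ℝ)⁻¹ * s ^ (k + 1)) *
          fun s : ℝ => dirDeriv (k + 1) v e (x - s • e) := by
      funext s
      rw [Finset.sum_range_succ]
      rfl
    rw [hfun]
    refine h2.congr_deriv ?_
    have hk : (k.factorial : ℝ) ≠ 0 := by positivity
    have hk1 : (k : ℝ) + 1 ≠ 0 := by positivity
    rw [Nat.factorial_succ]
    push_cast
    field_simp
    simp

/-- Since `s` is measured from `x`, the weight is `s ^ k` instead of the usual `(1 - s) ^ k`. It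
vanishes where the homothety centred at `x` degenerates, and this later compensates the Jacobian. -/
theorem sub_taylorAt_eq_integral {d : ℕ} (k : ℕ) {v : (Fin d → ℝ) → ℝ} (hv : ContDiff ℝ ∞ v)
    (x y : Fin d → ℝ) :
    v x - taylorAt k v x y = ∫ s in (0 : ℝ)..1,
      (k.factorial : ℝ)⁻¹ * s ^ k * dirDeriv (k + 1) v (x - y) (x - s • (x - y)) := by
  have hc : Continuous fun s : ℝ =>
      (k.factorial : ℝ)⁻¹ * s ^ k * dirDeriv (k + 1) v (x - y) (x - s • (x - y)) :=
    (continuous_const.mul (continuous_pow k)).mul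
      ((contDiff_dirDeriv _ hv _).continuous.comp (by fun_prop))
  have h := intervalIntegral.integral_eq_sub_of_hasDerivAt
    (fun s _ => hasDerivAt_taylorSum k hv (x - y) x s) (hc.neg.intervalIntegrable 0 1)
  rw [intervalIntegral.integral_neg] at h
  have h0 : ∑ j ∈ Finset.range (k + 1), (j.factorial : ℝ)⁻¹ * (0 : ℝ) ^ j *
      dirDeriv j v (x - y) (x - (0 : ℝ) • (x - y)) = v x := by
    rw [Finset.sum_range_succ']
    simp [dirDeriv]
  have h1 : ∑ j ∈ Finset.range (k + 1), (j.factorial : ℝ)⁻¹ * (1 : ℝ) ^ j *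
      dirDeriv j v (x - y) (x - (1 : ℝ) • (x - y)) = taylorAt k v x y := by
    simp [taylorAt]
  rw [h0, h1] at h
  linarith

/-- The sum of the absolute values of all derivatives of order `n`. -/
def derivSum {d : ℕ} (n : ℕ) (v : (Fin d → ℝ) → ℝ) (z : Fin d → ℝ) : ℝ :=
  ∑ α ∈ Finset.piAntidiag (Finset.univ : Finset (Fin d)) n, |multiDeriv α v z|

theorem derivSum_nonneg {d : ℕ} (n : ℕ) (v : (Fin d → ℝ) → ℝ) (z : Fin d → ℝ) :
    0 ≤ derivSum n v z := Finset.sum_nonneg fun _ _ => abs_nonneg _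

theorem continuous_derivSum {d : ℕ} (n : ℕ) {v : (Fin d → ℝ) → ℝ} (hv : ContDiff ℝ ∞ v) :
    Continuous (derivSum n v) :=
  continuous_finsetSum _ fun α _ => (hv.multiDeriv α).continuous.abs

/-- Adding a unit in slot `i` injects the multi-indices of order `n` into those of order `n + 1`. -/
theorem derivSum_partialDeriv_le {d : ℕ} (n : ℕ) {v : (Fin d → ℝ) → ℝ} (hv : ContDiff ℝ ∞ v)
    (i : Fin d) (z : Fin d → ℝ) : derivSum n (partialDeriv i v) z ≤ derivSum (n + 1) v z := by
  unfold derivSum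
  simp only [multiDeriv_partialDeriv hv]
  refine (Finset.sum_image (s := Finset.piAntidiag Finset.univ n)
    (g := fun α : Fin d → ℕ => α + Pi.single i 1) (f := fun α => |multiDeriv α v z|)
    (fun α _ β _ h => by simpa using h)).symm.trans_le ?_
  refine Finset.sum_le_sum_of_subset_of_nonneg ?_ fun _ _ _ => abs_nonneg _
  intro β hβ
  obtain ⟨α, hα, rfl⟩ := Finset.mem_image.mp hβ
  simp only [Finset.mem_piAntidiag, Finset.mem_univ, implies_true, and_true] at hα ⊢
  simp [Finset.sum_add_distrib, hα]

theorem abs_dirDeriv_le {d : ℕ} (j : ℕ) {v : (Fin d → ℝ) → ℝ} (hv : ContDiff ℝ ∞ v)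
    (e z : Fin d → ℝ) {L : ℝ} (he : ∀ i, |e i| ≤ L) :
    |dirDeriv j v e z| ≤ (d * L) ^ j * derivSum j v z := by
  induction j generalizing v with
  | zero =>
    have : derivSum 0 v z = |v z| := by
      simp [derivSum, multiDeriv_zero]
    simp [this, dirDeriv]
  | succ j ih =>
    -- For `d = 0` there is no coordinate from which `0 ≤ L` could be read off, but then the sum is
    -- empty.
    rcases Nat.eq_zero_or_pos d with hd | hd
    · subst hd
      simp [dirDeriv]
    have hL : 0 ≤ L := (abs_nonneg _).trans (he ⟨0, hd⟩)
    calc |dirDeriv (j + 1) v e z| ≤ ∑ i, |e i * dirDeriv j (partialDeriv i v) e z| :=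
          Finset.abs_sum_le_sum_abs _ _
      _ ≤ ∑ _i : Fin d, L * ((d * L) ^ j * derivSum (j + 1) v z) := by
          refine Finset.sum_le_sum fun i _ => ?_
          rw [abs_mul]
          refine mul_le_mul (he i) ((ih (hv.partialDeriv i)).trans ?_) (abs_nonneg _) hL
          exact mul_le_mul_of_nonneg_left (derivSum_partialDeriv_le j hv i z) (by positivity)
      _ = (d * L) ^ (j + 1) * derivSum (j + 1) v z := by
          simp only [Finset.sum_const, Finset.card_univ, Fintype.card_fin, nsmul_eq_mul]
          ring

theorem enorm_sub_taylorAt_le {d : ℕ} (k : ℕ) {v : (Fin d → ℝ) → ℝ} (hv : ContDiff ℝ ∞ v)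
    (x y : Fin d → ℝ) {L : ℝ} (he : ∀ i, |x i - y i| ≤ L) :
    ‖v x - taylorAt k v x y‖ₑ ≤ ∫⁻ s in Set.Ioc (0 : ℝ) 1,
      ENNReal.ofReal (s ^ k) * ENNReal.ofReal ((d * L) ^ (k + 1) *
        derivSum (k + 1) v (x - s • (x - y))) := by
  rw [sub_taylorAt_eq_integral k hv, intervalIntegral.integral_of_le zero_le_one]
  refine (enorm_integral_le_lintegral_enorm _).trans ?_
  refine setLIntegral_mono' measurableSet_Ioc fun s hs => ?_
  rw [Real.enorm_eq_ofReal_abs, ← ENNReal.ofReal_mul (pow_nonneg hs.1.le k)]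
  refine ENNReal.ofReal_le_ofReal ?_
  rw [abs_mul, abs_mul, abs_of_nonneg (pow_nonneg hs.1.le k),
    abs_of_nonneg (show (0 : ℝ) ≤ (k.factorial : ℝ)⁻¹ by positivity)]
  have h1 : (k.factorial : ℝ)⁻¹ ≤ 1 := by
    apply inv_le_one_of_one_le₀
    exact_mod_cast Nat.succ_le_of_lt k.factorial_pos
  have h2 := abs_dirDeriv_le (k + 1) hv (x - y) (x - s • (x - y)) (L := L) he
  refine mul_le_mul ?_ h2 (abs_nonneg _) (pow_nonneg hs.1.le k)
  exact mul_le_of_le_one_left (pow_nonneg hs.1.le k) h1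

end
noncomputable section

/-! ### Averaging over convex sets -/

/-- Cauchy–Schwarz against the constant function 1. -/
theorem sq_lintegral_le {X : Type*} [MeasurableSpace X] (μ : Measure X) {f : X → ℝ≥0∞}
    (hf : AEMeasurable f μ) : (∫⁻ x, f x ∂μ) ^ 2 ≤ μ Set.univ * ∫⁻ x, f x ^ 2 ∂μ := by
  have h := ENNReal.lintegral_mul_le_Lp_mul_Lq μ Real.HolderConjugate.two_two
    (f := fun _ => (1 : ℝ≥0∞)) (g := f) aemeasurable_const hf
  simp only [Pi.mul_def, one_mul, ENNReal.one_rpow, lintegral_one] at h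
  calc (∫⁻ x, f x ∂μ) ^ 2
      ≤ (μ Set.univ ^ (1 / 2 : ℝ) * (∫⁻ x, f x ^ (2 : ℝ) ∂μ) ^ (1 / 2 : ℝ)) ^ 2 := by gcongr
    _ = μ Set.univ * ∫⁻ x, f x ^ 2 ∂μ := by
      rw [mul_pow, ← ENNReal.rpow_natCast, ← ENNReal.rpow_natCast, ← ENNReal.rpow_mul,
        ← ENNReal.rpow_mul]
      norm_num

theorem lintegral_comp_add_smul {d : ℕ} {F : (Fin d → ℝ) → ℝ≥0∞} (hF : Measurable F)
    {s : ℝ} (hs : 0 < s) (c : Fin d → ℝ) :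
    ∫⁻ y, F (c + s • y) = (ENNReal.ofReal (s ^ d))⁻¹ * ∫⁻ y, F y := by
  have h1 : ∫⁻ y, F (c + s • y) = ∫⁻ z, F (c + z) ∂(Measure.map (s • ·) volume) := by
    exact (lintegral_map (f := fun z => F (c + z)) (hF.comp (measurable_const_add c))
      (measurable_const_smul s)).symm
  rw [h1, Measure.map_addHaar_smul volume hs.ne', lintegral_smul_measure,
    lintegral_add_left_eq_self]
  rw [Module.finrank_fin_fun, abs_of_pos (by positivity), ENNReal.ofReal_inv_of_pos (by positivity),
    smul_eq_mul]

/-- The homothety with centre `x` and ratio `s` maps the convex set `B` into itself and scales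
volume by `s ^ d`. -/
theorem setLIntegral_homothety_le {d : ℕ} {F : (Fin d → ℝ) → ℝ≥0∞} (hF : Measurable F)
    {B : Set (Fin d → ℝ)} (hB : MeasurableSet B) (hconv : Convex ℝ B) {x : Fin d → ℝ} (hx : x ∈ B)
    {s : ℝ} (hs : 0 < s) (hs1 : s ≤ 1) :
    ∫⁻ y in B, F (x - s • (x - y)) ≤ (ENNReal.ofReal (s ^ d))⁻¹ * ∫⁻ y in B, F y := by
  rw [← lintegral_indicator hB, ← lintegral_indicator hB,
    ← lintegral_comp_add_smul (hF.indicator hB) hs (x - s • x)]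
  refine lintegral_mono fun y => ?_
  by_cases hy : y ∈ B
  · have hz : x - s • x + s • y = x - s • (x - y) := by rw [smul_sub]; abel
    have hmem : x - s • (x - y) ∈ B := by
      have := hconv hx hy (sub_nonneg.mpr hs1) hs.le (by ring)
      convert this using 1
      rw [sub_smul, one_smul, smul_sub]; abel
    rw [hz, Set.indicator_of_mem hy, Set.indicator_of_mem hmem]
  · rw [Set.indicator_of_notMem hy]; exact zero_le

theorem measurable_comp_segment {d : ℕ} {F : (Fin d → ℝ) → ℝ≥0∞} (hF : Measurable F) :
    Measurable fun p : (Fin d → ℝ) × (Fin d → ℝ) × ℝ => F (p.1 - p.2.2 • (p.1 - p.2.1)) :=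
  hF.comp (by fun_prop : Continuous fun p : (Fin d → ℝ) × (Fin d → ℝ) × ℝ =>
    p.1 - p.2.2 • (p.1 - p.2.1)).measurable

/-- Average over `y ∈ B` of the integral of `s ^ k * F` along the segment from `x` to `y`. -/
def segmentAverage {d : ℕ} (k : ℕ) (B : Set (Fin d → ℝ)) (F : (Fin d → ℝ) → ℝ≥0∞)
    (x : Fin d → ℝ) : ℝ≥0∞ :=
  (volume B)⁻¹ * ∫⁻ y in B, ∫⁻ s in Set.Ioc (0 : ℝ) 1, ENNReal.ofReal (s ^ k) *
    F (x - s • (x - y))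

/-- For fixed `s`, Cauchy–Schwarz over `B` and the homothety produce the factor `s ^ (2 * k) * s⁻ᵈ`,
which is at most 1 exactly because `d ≤ 2 * k`. A second Cauchy–Schwarz handles the integral over
`s`. -/
theorem sq_segmentAverage_le {d k : ℕ} (hdk : d ≤ 2 * k) {F : (Fin d → ℝ) → ℝ≥0∞}
    (hF : Measurable F) {B : Set (Fin d → ℝ)} (hB : MeasurableSet B) (hconv : Convex ℝ B)
    (hB0 : volume B ≠ 0) (hB1 : volume B ≠ ⊤) {x : Fin d → ℝ} (hx : x ∈ B) :
    segmentAverage k B F x ^ 2 ≤ (volume B)⁻¹ * ∫⁻ y in B, F y ^ 2 := by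
  have hm : Measurable fun p : (Fin d → ℝ) × ℝ =>
      ENNReal.ofReal (p.2 ^ k) * F (x - p.2 • (x - p.1)) :=
    (by fun_prop : Measurable fun p : (Fin d → ℝ) × ℝ => ENNReal.ofReal (p.2 ^ k)).mul
      (hF.comp (by fun_prop : Continuous fun p : (Fin d → ℝ) × ℝ =>
        x - p.2 • (x - p.1)).measurable)
  have hslice : ∀ s ∈ Set.Ioc (0 : ℝ) 1,
      (∫⁻ y in B, ENNReal.ofReal (s ^ k) * F (x - s • (x - y))) ^ 2 ≤
        volume B * ∫⁻ y in B, F y ^ 2 := by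
    intro s hs
    refine (sq_lintegral_le _ (hm.comp measurable_prodMk_right).aemeasurable).trans ?_
    rw [Measure.restrict_apply_univ]
    refine mul_le_mul' le_rfl ?_
    simp only [Function.comp_apply, mul_pow]
    rw [lintegral_const_mul' _ _ (ENNReal.pow_ne_top ENNReal.ofReal_ne_top)]
    refine (mul_le_mul' le_rfl (setLIntegral_homothety_le (hF.pow_const 2) hB hconv hx
      hs.1 hs.2)).trans ?_
    rw [← mul_assoc]
    refine mul_le_of_le_one_left' ?_
    rw [← div_eq_mul_inv]
    refine ENNReal.div_le_of_le_mul ?_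
    rw [one_mul, ← ENNReal.ofReal_pow (pow_nonneg hs.1.le k), ← pow_mul]
    exact ENNReal.ofReal_le_ofReal (pow_le_pow_of_le_one hs.1.le hs.2 (by omega))
  unfold segmentAverage
  rw [lintegral_lintegral_swap (by exact hm.aemeasurable), mul_pow]
  have h1 : (∫⁻ s in Set.Ioc (0 : ℝ) 1, ∫⁻ y in B,
      ENNReal.ofReal (s ^ k) * F (x - s • (x - y))) ^ 2 ≤ volume B * ∫⁻ y in B, F y ^ 2 := by
    refine (sq_lintegral_le _ (Measurable.lintegral_prod_left' hm).aemeasurable).trans ?_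
    rw [Measure.restrict_apply_univ, Real.volume_Ioc]
    simp only [sub_zero, ENNReal.ofReal_one, one_mul]
    refine (setLIntegral_mono' measurableSet_Ioc hslice).trans ?_
    simp
  refine (mul_le_mul' le_rfl h1).trans_eq ?_
  rw [← mul_assoc, sq, mul_assoc (volume B)⁻¹, ENNReal.inv_mul_cancel hB0 hB1, mul_one]

/-- Integrating over `x` as well removes any restriction on `d`. The point of the segment is the
image of `y` under a homothety of ratio `s` about `x`, and of `x` under one of ratio `1 - s` about
`y`. One of the two ratios is at least `1 / 2`, so a Jacobian bounded by `2 ^ d` is always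
available. -/
theorem lintegral_sq_segmentAverage_le {d : ℕ} (k : ℕ) {F : (Fin d → ℝ) → ℝ≥0∞}
    (hF : Measurable F) {B : Set (Fin d → ℝ)} (hB : MeasurableSet B) (hconv : Convex ℝ B)
    (hB0 : volume B ≠ 0) (hB1 : volume B ≠ ⊤) :
    ∫⁻ x in B, segmentAverage k B F x ^ 2 ≤ 2 ^ d * ∫⁻ y in B, F y ^ 2 := by
  have hm := measurable_comp_segment hF
  have hm2 := measurable_comp_segment (hF.pow_const 2)
  have hpt : ∀ x, segmentAverage k B F x ^ 2 ≤ (volume B)⁻¹ *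
      ∫⁻ y in B, ∫⁻ s in Set.Ioc (0 : ℝ) 1, F (x - s • (x - y)) ^ 2 := by
    intro x
    have hmx : Measurable fun p : (Fin d → ℝ) × ℝ => F (x - p.2 • (x - p.1)) :=
      hm.comp (measurable_const.prodMk measurable_id)
    have h0 : segmentAverage k B F x ≤ (volume B)⁻¹ *
        ∫⁻ y in B, ∫⁻ s in Set.Ioc (0 : ℝ) 1, F (x - s • (x - y)) := by
      unfold segmentAverage
      refine mul_le_mul' le_rfl (lintegral_mono fun y => ?_)
      refine setLIntegral_mono' measurableSet_Ioc fun s hs => ?_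
      refine mul_le_of_le_one_left' ?_
      rw [← ENNReal.ofReal_one]
      exact ENNReal.ofReal_le_ofReal (pow_le_one₀ hs.1.le hs.2)
    have h1 : (∫⁻ y in B, ∫⁻ s in Set.Ioc (0 : ℝ) 1, F (x - s • (x - y))) ^ 2 ≤
        volume B * ∫⁻ y in B, ∫⁻ s in Set.Ioc (0 : ℝ) 1, F (x - s • (x - y)) ^ 2 := by
      refine (sq_lintegral_le _ (Measurable.lintegral_prod_right' hmx).aemeasurable).trans ?_
      rw [Measure.restrict_apply_univ]
      refine mul_le_mul' le_rfl (lintegral_mono fun y => ?_)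
      refine (sq_lintegral_le _ (hmx.comp measurable_prodMk_left).aemeasurable).trans ?_
      simp
    calc segmentAverage k B F x ^ 2 ≤ _ := pow_le_pow_left' h0 2
      _ ≤ ((volume B)⁻¹) ^ 2 * (volume B *
          ∫⁻ y in B, ∫⁻ s in Set.Ioc (0 : ℝ) 1, F (x - s • (x - y)) ^ 2) := by
        rw [mul_pow]; gcongr
      _ = _ := by
        rw [← mul_assoc, sq, mul_assoc (volume B)⁻¹, ENNReal.inv_mul_cancel hB0 hB1, mul_one]
  have hinv : ∀ r : ℝ, 1 / 2 ≤ r → (ENNReal.ofReal (r ^ d))⁻¹ ≤ 2 ^ d := by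
    intro r hr
    rw [ENNReal.ofReal_pow (by linarith), ENNReal.inv_pow]
    refine pow_le_pow_left' ?_ d
    rw [ENNReal.inv_le_iff_inv_le]
    have : (2 : ℝ≥0∞)⁻¹ = ENNReal.ofReal (1 / 2) := by
      rw [one_div, ENNReal.ofReal_inv_of_pos two_pos]; norm_num
    rw [this]
    exact ENNReal.ofReal_le_ofReal hr
  have hslice : ∀ s ∈ Set.Ioc (0 : ℝ) 1,
      ∫⁻ x in B, ∫⁻ y in B, F (x - s • (x - y)) ^ 2 ≤
        volume B * (2 ^ d * ∫⁻ y in B, F y ^ 2) := by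
    intro s hs
    have hms : Measurable fun p : (Fin d → ℝ) × (Fin d → ℝ) => F (p.1 - s • (p.1 - p.2)) ^ 2 :=
      hm2.comp (measurable_fst.prodMk (measurable_snd.prodMk measurable_const))
    rcases le_total (1 / 2) s with h | h
    · refine (setLIntegral_mono' hB (g := fun _ => 2 ^ d * ∫⁻ y in B, F y ^ 2) fun x hx => ?_).trans ?_
      · exact (setLIntegral_homothety_le (hF.pow_const 2) hB hconv hx hs.1 hs.2).trans
          (mul_le_mul' (hinv s h) le_rfl)
      · simp [mul_comm]
    -- For small `s` the roles of `x` and `y` are exchanged.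
    · rw [lintegral_lintegral_swap (by exact hms.aemeasurable)]
      refine (setLIntegral_mono' hB (g := fun _ => 2 ^ d * ∫⁻ y in B, F y ^ 2) fun y hy => ?_).trans ?_
      · have hrw : ∀ x : Fin d → ℝ, x - s • (x - y) = y - (1 - s) • (y - x) := by
          intro x
          ext i
          simp
          ring
        simp only [hrw]
        exact (setLIntegral_homothety_le (hF.pow_const 2) hB hconv hy (by linarith)
          (by linarith [hs.1])).trans (mul_le_mul' (hinv _ (by linarith)) le_rfl)
      · simp [mul_comm]
  calc ∫⁻ x in B, segmentAverage k B F x ^ 2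
      ≤ ∫⁻ x in B, (volume B)⁻¹ *
          ∫⁻ y in B, ∫⁻ s in Set.Ioc (0 : ℝ) 1, F (x - s • (x - y)) ^ 2 :=
        lintegral_mono hpt
    _ = (volume B)⁻¹ * ∫⁻ x in B, ∫⁻ y in B, ∫⁻ s in Set.Ioc (0 : ℝ) 1,
          F (x - s • (x - y)) ^ 2 := by
        rw [lintegral_const_mul']
        exact ENNReal.inv_ne_top.mpr hB0
    _ = (volume B)⁻¹ * ∫⁻ x in B, ∫⁻ s in Set.Ioc (0 : ℝ) 1, ∫⁻ y in B,
          F (x - s • (x - y)) ^ 2 := by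
        congr 1
        refine lintegral_congr fun x => ?_
        have hmx : Measurable fun p : (Fin d → ℝ) × ℝ => F (x - p.2 • (x - p.1)) ^ 2 :=
          hm2.comp (measurable_const.prodMk measurable_id)
        rw [lintegral_lintegral_swap (by exact hmx.aemeasurable)]
    _ = (volume B)⁻¹ * ∫⁻ s in Set.Ioc (0 : ℝ) 1, ∫⁻ x in B, ∫⁻ y in B,
          F (x - s • (x - y)) ^ 2 := by
        congr 1
        rw [lintegral_lintegral_swap]
        refine Measurable.aemeasurable ?_
        have : Measurable fun q : ((Fin d → ℝ) × ℝ) × (Fin d → ℝ) =>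
            F (q.1.1 - q.1.2 • (q.1.1 - q.2)) ^ 2 :=
          hm2.comp (by fun_prop : Measurable fun q : ((Fin d → ℝ) × ℝ) × (Fin d → ℝ) =>
            (q.1.1, q.2, q.1.2))
        exact Measurable.lintegral_prod_right' this
    _ ≤ (volume B)⁻¹ * (volume B * (2 ^ d * ∫⁻ y in B, F y ^ 2)) := by
        gcongr
        refine (setLIntegral_mono' measurableSet_Ioc hslice).trans ?_
        simp
    _ = 2 ^ d * ∫⁻ y in B, F y ^ 2 := by
        rw [← mul_assoc, ENNReal.inv_mul_cancel hB0 hB1, one_mul]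

/-! ### Averaged Taylor polynomials -/

/-- The average over `y ∈ B` of the Taylor polynomials about `y`. -/
def avgTaylor {d : ℕ} (k : ℕ) (B : Set (Fin d → ℝ)) (v : (Fin d → ℝ) → ℝ) (x : Fin d → ℝ) : ℝ :=
  (volume.real B)⁻¹ * ∫ y in B, taylorAt k v x y

theorem enorm_sub_avgTaylor_le {d : ℕ} (k : ℕ) {v : (Fin d → ℝ) → ℝ} (hv : ContDiff ℝ ∞ v)
    {B : Set (Fin d → ℝ)} (hB : IsCompact B) (hB0 : volume B ≠ 0) {L : ℝ}
    (hL : ∀ x ∈ B, ∀ y ∈ B, ∀ i, |x i - y i| ≤ L) {x : Fin d → ℝ} (hx : x ∈ B) :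
    ‖v x - avgTaylor k B v x‖ₑ ≤ segmentAverage k B
      (fun z => ENNReal.ofReal ((d * L) ^ (k + 1) * derivSum (k + 1) v z)) x := by
  have hB1 : volume B ≠ ⊤ := hB.measure_lt_top.ne
  have hV : 0 < volume.real B := ENNReal.toReal_pos hB0 hB1
  have hint : IntegrableOn (taylorAt k v x) B :=
    (continuous_taylorAt k hv x).continuousOn.integrableOn_compact hB
  have h1 : v x - avgTaylor k B v x =
      (volume.real B)⁻¹ * ∫ y in B, (v x - taylorAt k v x y) := by
    have hconst : IntegrableOn (fun _ => v x) B := integrableOn_const hB1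
    rw [integral_sub hconst hint, setIntegral_const, smul_eq_mul, mul_sub,
      ← mul_assoc, inv_mul_cancel₀ hV.ne', one_mul]
    rfl
  rw [h1, enorm_mul]
  unfold segmentAverage
  have h2 : ‖(volume.real B)⁻¹‖ₑ = (volume B)⁻¹ := by
    rw [Real.enorm_eq_ofReal_abs, abs_of_pos (inv_pos.mpr hV), ENNReal.ofReal_inv_of_pos hV,
      Measure.real, ENNReal.ofReal_toReal hB1]
  rw [h2]
  gcongr
  refine (enorm_integral_le_lintegral_enorm _).trans ?_
  exact setLIntegral_mono' hB.measurableSet fun y hy => enorm_sub_taylorAt_le k hv x y (hL x hx y hy)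

theorem measurable_ofReal_derivSum {d : ℕ} (n : ℕ) {v : (Fin d → ℝ) → ℝ} (hv : ContDiff ℝ ∞ v)
    (c : ℝ) : Measurable fun z => ENNReal.ofReal (c * derivSum n v z) :=
  ENNReal.measurable_ofReal.comp ((continuous_derivSum n hv).measurable.const_mul c)

theorem sq_enorm_sub_avgTaylor_le {d k : ℕ} (hdk : d ≤ 2 * k) {v : (Fin d → ℝ) → ℝ}
    (hv : ContDiff ℝ ∞ v) {B : Set (Fin d → ℝ)} (hB : IsCompact B) (hconv : Convex ℝ B)
    (hB0 : volume B ≠ 0) {L : ℝ}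
    (hL : ∀ x ∈ B, ∀ y ∈ B, ∀ i, |x i - y i| ≤ L) {x : Fin d → ℝ} (hx : x ∈ B) :
    ‖v x - avgTaylor k B v x‖ₑ ^ 2 ≤ (volume B)⁻¹ *
      ∫⁻ z in B, ENNReal.ofReal ((d * L) ^ (k + 1) * derivSum (k + 1) v z) ^ 2 :=
  (pow_le_pow_left' (enorm_sub_avgTaylor_le k hv hB hB0 hL hx) 2).trans
    (sq_segmentAverage_le hdk (measurable_ofReal_derivSum _ hv _) hB.measurableSet hconv hB0
      hB.measure_lt_top.ne hx)

theorem lintegral_sq_enorm_sub_avgTaylor_le {d : ℕ} (k : ℕ) {v : (Fin d → ℝ) → ℝ}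
    (hv : ContDiff ℝ ∞ v) {B : Set (Fin d → ℝ)} (hB : IsCompact B) (hconv : Convex ℝ B)
    (hB0 : volume B ≠ 0) {L : ℝ}
    (hL : ∀ x ∈ B, ∀ y ∈ B, ∀ i, |x i - y i| ≤ L) :
    ∫⁻ x in B, ‖v x - avgTaylor k B v x‖ₑ ^ 2 ≤ 2 ^ d *
      ∫⁻ z in B, ENNReal.ofReal ((d * L) ^ (k + 1) * derivSum (k + 1) v z) ^ 2 :=
  (setLIntegral_mono' hB.measurableSet fun _ hx =>
    pow_le_pow_left' (enorm_sub_avgTaylor_le k hv hB hB0 hL hx) 2).trans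
    (lintegral_sq_segmentAverage_le k (measurable_ofReal_derivSum _ hv _) hB.measurableSet hconv hB0
      hB.measure_lt_top.ne)

/-- Expanding one factor `x i - y i` at a time, `x i` leaves the integral and `y i` is absorbed into
the weight; the induction therefore needs an arbitrary `c`. Differentiating a `j`-homogeneous form
in `x - y` gives `j` times a form of degree `j - 1`. At `j = 0` the factor `j` cancels the truncated
subtraction. -/
theorem exists_mvPolynomial_integral_dirDeriv {d : ℕ} {B : Set (Fin d → ℝ)} (hB : IsCompact B)
    (j : ℕ) {v : (Fin d → ℝ) → ℝ} (hv : ContDiff ℝ ∞ v) {c : (Fin d → ℝ) → ℝ} (hc : Continuous c) :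
    ∃ p ∈ MvPolynomial.restrictTotalDegree (Fin d) ℝ j,
      (∀ x, MvPolynomial.eval x p = ∫ y in B, dirDeriv j v (x - y) y * c y) ∧
      ∀ a x, MvPolynomial.eval x (MvPolynomial.pderiv a p) =
        j * ∫ y in B, dirDeriv (j - 1) (partialDeriv a v) (x - y) y * c y := by
  induction j generalizing v c with
  | zero =>
    refine ⟨MvPolynomial.C (∫ y in B, v y * c y), ?_, ?_, ?_⟩
    · simp [MvPolynomial.mem_restrictTotalDegree]
    · intro x; simp [dirDeriv]
    · intro a x; simp
  | succ j ih =>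
    have hyc : ∀ i : Fin d, Continuous fun y : Fin d → ℝ => y i * c y := fun i =>
      (continuous_apply i).mul hc
    choose p hpd hp hp' using fun i => ih (hv.partialDeriv i) hc
    choose r hrd hr hr' using fun i => ih (hv.partialDeriv i) (hyc i)
    have hint : ∀ (n : ℕ) {w : (Fin d → ℝ) → ℝ} (_ : ContDiff ℝ ∞ w) {e : (Fin d → ℝ) → ℝ}
        (_ : Continuous e) (x : Fin d → ℝ),
        IntegrableOn (fun y => dirDeriv n w (x - y) y * e y) B := fun n w hw e he x =>
      ((continuous_dirDeriv_sub n hw x).mul he).continuousOn.integrableOn_compact hB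
    have hstep : ∀ (n : ℕ) {w : (Fin d → ℝ) → ℝ} (_ : ContDiff ℝ ∞ w) (x : Fin d → ℝ),
        ∑ i, (x i * (∫ y in B, dirDeriv n (partialDeriv i w) (x - y) y * c y) -
          ∫ y in B, dirDeriv n (partialDeriv i w) (x - y) y * (y i * c y)) =
        ∫ y in B, dirDeriv (n + 1) w (x - y) y * c y := by
      intro n w hw x
      have : ∀ y, dirDeriv (n + 1) w (x - y) y * c y = ∑ i,
          (x i * (dirDeriv n (partialDeriv i w) (x - y) y * c y) -
            dirDeriv n (partialDeriv i w) (x - y) y * (y i * c y)) := by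
        intro y
        simp only [dirDeriv, Finset.sum_mul]
        refine Finset.sum_congr rfl fun i _ => ?_
        simp only [Pi.sub_apply]
        ring
      simp only [this]
      rw [integral_finsetSum]
      · refine Finset.sum_congr rfl fun i _ => ?_
        rw [integral_sub ((hint n (hw.partialDeriv i) hc x).const_mul _)
          (hint n (hw.partialDeriv i) (hyc i) x), integral_const_mul]
      · intro i _
        exact ((hint n (hw.partialDeriv i) hc x).const_mul _).sub
          (hint n (hw.partialDeriv i) (hyc i) x)
    refine ⟨∑ i, (MvPolynomial.X i * p i - r i), ?_, ?_, ?_⟩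
    · refine Submodule.sum_mem _ fun i _ => Submodule.sub_mem _ ?_ ?_
      · rw [MvPolynomial.mem_restrictTotalDegree] at *
        refine (MvPolynomial.totalDegree_mul _ _).trans ?_
        have := (MvPolynomial.mem_restrictTotalDegree _ _ _).mp (hpd i)
        rw [MvPolynomial.totalDegree_X]
        omega
      · have := (MvPolynomial.mem_restrictTotalDegree _ _ _).mp (hrd i)
        rw [MvPolynomial.mem_restrictTotalDegree]
        omega
    · intro x
      rw [← hstep j hv x]
      simp [hp, hr]
    · intro a x
      -- By the product rule, `p a` is one copy of the required integral, and the remaining sum will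
      -- provide the other `j` copies.
      have h1 : MvPolynomial.eval x (MvPolynomial.pderiv a (∑ i, (MvPolynomial.X i * p i - r i))) =
          MvPolynomial.eval x (p a) + ∑ i, (x i * MvPolynomial.eval x (MvPolynomial.pderiv a (p i)) -
            MvPolynomial.eval x (MvPolynomial.pderiv a (r i))) := by
        simp only [map_sum, map_sub, Derivation.leibniz, MvPolynomial.pderiv_X, smul_eq_mul,
          map_add, map_mul, MvPolynomial.eval_X]
        rw [← sub_eq_zero]
        simp only [Finset.sum_sub_distrib, Finset.sum_add_distrib, Pi.single_apply]
        simp [apply_ite]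
        ring
      rw [h1, hp]
      simp only [hp', hr', Nat.add_sub_cancel]
      rcases j with _ | j
      · simp
      · have h2 : ∀ i, partialDeriv a (partialDeriv i v) = partialDeriv i (partialDeriv a v) :=
          fun i => partialDeriv_comm hv a i
        simp only [Nat.add_sub_cancel, h2]
        have h3 := hstep j (hv.partialDeriv a) x
        have h4 : ∑ i, (x i * (((j + 1 : ℕ) : ℝ) * ∫ y in B,
            dirDeriv j (partialDeriv i (partialDeriv a v)) (x - y) y * c y) -
            ((j + 1 : ℕ) : ℝ) * ∫ y in B,
              dirDeriv j (partialDeriv i (partialDeriv a v)) (x - y) y * (y i * c y)) =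
            ((j + 1 : ℕ) : ℝ) * ∫ y in B, dirDeriv (j + 1) (partialDeriv a v) (x - y) y * c y := by
          rw [← h3, Finset.mul_sum]
          refine Finset.sum_congr rfl fun i _ => ?_
          ring
        rw [h4]
        push_cast
        ring

/-- The averaged Taylor polynomial is a polynomial, and differentiation commutes with averaging. -/
theorem exists_mvPolynomial_avgTaylor {d : ℕ} {B : Set (Fin d → ℝ)} (hB : IsCompact B)
    (k : ℕ) {v : (Fin d → ℝ) → ℝ} (hv : ContDiff ℝ ∞ v) :
    ∃ q ∈ QPoly d (k + 1), (∀ x, MvPolynomial.eval x q = avgTaylor (k + 1) B v x) ∧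
      ∀ a x, MvPolynomial.eval x (MvPolynomial.pderiv a q) =
        avgTaylor k B (partialDeriv a v) x := by
  choose p hpd hp hp' using fun j => exists_mvPolynomial_integral_dirDeriv hB j hv
    (c := fun _ => (1 : ℝ)) continuous_const
  have hint : ∀ (n : ℕ) {w : (Fin d → ℝ) → ℝ} (_ : ContDiff ℝ ∞ w) (x : Fin d → ℝ),
      IntegrableOn (fun y => (n.factorial : ℝ)⁻¹ * dirDeriv n w (x - y) y) B := fun n w hw x =>
    (continuous_const.mul (continuous_dirDeriv_sub n hw x)).continuousOn.integrableOn_compact hB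
  refine ⟨∑ j ∈ Finset.range (k + 2),
    ((volume.real B)⁻¹ * (j.factorial : ℝ)⁻¹) • p j, ?_, ?_, ?_⟩
  · refine Submodule.sum_mem _ fun j hj => Submodule.smul_mem _ _ ?_
    refine MvPolynomial.restrictTotalDegree_le_restrictDegree (R := ℝ) (Fin d) (k + 1) ?_
    have := (MvPolynomial.mem_restrictTotalDegree _ _ _).mp (hpd j)
    rw [MvPolynomial.mem_restrictTotalDegree]
    have := Finset.mem_range.mp hj
    omega
  · intro x
    unfold avgTaylor taylorAt
    rw [integral_finsetSum _ fun j _ => hint j hv x, Finset.mul_sum]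
    simp only [map_sum, MvPolynomial.smul_eval, hp, mul_one, integral_const_mul, mul_assoc]
  · intro a x
    unfold avgTaylor taylorAt
    rw [integral_finsetSum _ fun j _ => hint j (hv.partialDeriv a) x, Finset.mul_sum]
    simp only [map_sum, Derivation.map_smul, MvPolynomial.smul_eval, hp', mul_one,
      integral_const_mul]
    -- The constant term disappears, and `(j + 1) / (j + 1)! = 1 / j!` turns the shifted sum into
    -- the Taylor sum of one degree less.
    rw [Finset.sum_range_succ']
    simp only [Nat.cast_zero, zero_mul, mul_zero, add_zero, Nat.add_sub_cancel]
    refine Finset.sum_congr rfl fun j _ => ?_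
    rw [Nat.factorial_succ]
    have h1 : (j.factorial : ℝ) ≠ 0 := by positivity
    have h2 : ((j : ℝ) + 1) ≠ 0 := by positivity
    push_cast
    field_simp

end
noncomputable section

/-! ### Weak derivatives -/

theorem tsupport_partialDeriv_subset {d : ℕ} (i : Fin d) (f : (Fin d → ℝ) → ℝ) :
    tsupport (partialDeriv i f) ⊆ tsupport f :=
  tsupport_fderiv_apply_subset ℝ _

theorem tsupport_multiDeriv_subset {d : ℕ} (α : Fin d → ℕ) (f : (Fin d → ℝ) → ℝ) :
    tsupport (multiDeriv α f) ⊆ tsupport f := by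
  unfold multiDeriv
  induction List.finRange d with
  | nil => exact subset_rfl
  | cons a L ih =>
    refine Set.Subset.trans ?_ ih
    rw [List.foldr_cons]
    generalize L.foldr (fun i g => (partialDeriv i)^[α i] g) f = g
    induction α a with
    | zero => exact subset_rfl
    | succ n ihn =>
      rw [Function.iterate_succ_apply']
      exact (tsupport_partialDeriv_subset a _).trans ihn

theorem integrable_mul_of_tsupport_subset {d : ℕ} {U : Set (Fin d → ℝ)} {u φ : (Fin d → ℝ) → ℝ}
    (hu : LocallyIntegrableOn u U) (hφ : Continuous φ) (hc : HasCompactSupport φ)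
    (hs : tsupport φ ⊆ U) : Integrable fun x => u x * φ x := by
  have h1 : IntegrableOn (fun x => u x * φ x) (tsupport φ) :=
    (hu.integrableOn_compact_subset hs hc).mul_continuousOn hφ.continuousOn hc
  refine (integrableOn_iff_integrable_of_support_subset ?_).mp h1
  intro x hx
  exact subset_tsupport _ (right_ne_zero_of_mul hx)

theorem setIntegral_mul_eq_integral {d : ℕ} {U : Set (Fin d → ℝ)} (u : (Fin d → ℝ) → ℝ)
    {φ : (Fin d → ℝ) → ℝ} (hs : tsupport φ ⊆ U) :
    ∫ x in U, u x * φ x = ∫ x, u x * φ x := by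
  refine setIntegral_eq_integral_of_forall_compl_eq_zero fun x hx => ?_
  rw [image_eq_zero_of_notMem_tsupport fun h => hx (hs h), mul_zero]

/-- The fundamental lemma of the calculus of variations, applied to the difference of the two
candidates. -/
theorem HasWeakDeriv.ae_eq {d : ℕ} {U : Set (Fin d → ℝ)} (hU : IsOpen U) {α : Fin d → ℕ}
    {u g g' : (Fin d → ℝ) → ℝ} (h : HasWeakDeriv U α u g) (h' : HasWeakDeriv U α u g') :
    g =ᵐ[volume.restrict U] g' := by
  have h0 : ∀ᵐ x, x ∈ U → (fun x => g x - g' x) x = 0 := by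
    refine hU.ae_eq_zero_of_integral_contDiff_smul_eq_zero (h.2.1.sub h'.2.1) ?_
    intro φ hφ hc hs
    have e1 := h.2.2 φ hφ hc hs
    have e2 := h'.2.2 φ hφ hc hs
    rw [e1] at e2
    have e3 : ∫ x in U, g x * φ x = ∫ x in U, g' x * φ x :=
      mul_left_cancel₀ (pow_ne_zero _ (by norm_num)) e2
    rw [setIntegral_mul_eq_integral g hs, setIntegral_mul_eq_integral g' hs] at e3
    have : ∀ x, φ x • (g x - g' x) = g x * φ x - g' x * φ x := fun x => by
      rw [smul_eq_mul]; ring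
    change ∫ x, φ x • (g x - g' x) = 0
    simp only [this]
    rw [integral_sub (integrable_mul_of_tsupport_subset h.2.1 hφ.continuous hc hs)
      (integrable_mul_of_tsupport_subset h'.2.1 hφ.continuous hc hs), e3, sub_self]
  rw [Filter.EventuallyEq, ae_restrict_iff' hU.measurableSet]
  filter_upwards [h0] with x hx hxU
  exact sub_eq_zero.mp (hx hxU)

theorem hasWeakDeriv_zero {d : ℕ} {U : Set (Fin d → ℝ)} {u : (Fin d → ℝ) → ℝ}
    (hu : LocallyIntegrableOn u U) : HasWeakDeriv U 0 u u :=
  ⟨hu, hu, fun φ _ _ _ => by simp [multiDeriv_zero]⟩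

theorem HasWeakDeriv.mono {d : ℕ} {U V : Set (Fin d → ℝ)} (hVU : V ⊆ U) {α : Fin d → ℕ}
    {u g : (Fin d → ℝ) → ℝ} (h : HasWeakDeriv U α u g) : HasWeakDeriv V α u g := by
  refine ⟨h.1.mono_set hVU, h.2.1.mono_set hVU, fun φ hφ hc hs => ?_⟩
  have h1 := h.2.2 φ hφ hc (hs.trans hVU)
  have hs' := (tsupport_multiDeriv_subset α φ).trans hs
  rwa [setIntegral_mul_eq_integral _ (hs'.trans hVU), setIntegral_mul_eq_integral _ (hs.trans hVU),
    ← setIntegral_mul_eq_integral _ hs', ← setIntegral_mul_eq_integral _ hs] at h1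

theorem HasWeakDeriv.sub {d : ℕ} {U : Set (Fin d → ℝ)} {α : Fin d → ℕ}
    {u g u' g' : (Fin d → ℝ) → ℝ} (h : HasWeakDeriv U α u g) (h' : HasWeakDeriv U α u' g') :
    HasWeakDeriv U α (fun x => u x - u' x) (fun x => g x - g' x) := by
  refine ⟨h.1.sub h'.1, h.2.1.sub h'.2.1, fun φ hφ hc hs => ?_⟩
  have hs' := (tsupport_multiDeriv_subset α φ).trans hs
  have hc' : HasCompactSupport (multiDeriv α φ) :=
    hc.of_isClosed_subset (isClosed_tsupport _) (tsupport_multiDeriv_subset α φ)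
  have hm := (hφ.multiDeriv α).continuous
  simp only [sub_mul]
  rw [integral_sub (integrable_mul_of_tsupport_subset h.1 hm hc' hs').integrableOn
      (integrable_mul_of_tsupport_subset h'.1 hm hc' hs').integrableOn,
    integral_sub (integrable_mul_of_tsupport_subset h.2.1 hφ.continuous hc hs).integrableOn
      (integrable_mul_of_tsupport_subset h'.2.1 hφ.continuous hc hs).integrableOn,
    h.2.2 φ hφ hc hs, h'.2.2 φ hφ hc hs, mul_sub]

theorem hasWeakDeriv_of_contDiff {d : ℕ} {U : Set (Fin d → ℝ)} {f : (Fin d → ℝ) → ℝ}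
    (hf : ContDiff ℝ ∞ f) (i : Fin d) : HasWeakDeriv U (Pi.single i 1) f (partialDeriv i f) := by
  refine ⟨hf.continuous.locallyIntegrable.locallyIntegrableOn U,
    (hf.partialDeriv i).continuous.locallyIntegrable.locallyIntegrableOn U, fun φ hφ hc hs => ?_⟩
  have hs' := (tsupport_partialDeriv_subset i φ).trans hs
  have hc' : HasCompactSupport (partialDeriv i φ) :=
    hc.of_isClosed_subset (isClosed_tsupport _) (tsupport_partialDeriv_subset i φ)
  have hf1 := hf.continuous.locallyIntegrable (μ := volume).locallyIntegrableOn U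
  have hf2 := (hf.partialDeriv i).continuous.locallyIntegrable (μ := volume).locallyIntegrableOn U
  rw [multiDeriv_single hφ, setIntegral_mul_eq_integral _ hs', setIntegral_mul_eq_integral _ hs]
  have := integral_mul_fderiv_eq_neg_fderiv_mul_of_integrable (μ := (volume : Measure (Fin d → ℝ)))
    (f := f) (g := φ) (v := Pi.single i 1)
    (integrable_mul_of_tsupport_subset hf2 hφ.continuous hc hs)
    (integrable_mul_of_tsupport_subset hf1 (hφ.partialDeriv i).continuous hc' hs')
    (integrable_mul_of_tsupport_subset hf1 hφ.continuous hc hs)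
    (fun x _ => hf.differentiable (by simp) x) (fun x _ => hφ.differentiable (by simp) x)
  simpa [partialDeriv] using this

theorem MemSobolev.hasWeakDeriv {d n : ℕ} {U : Set (Fin d → ℝ)} {u : (Fin d → ℝ) → ℝ}
    (h : MemSobolev U n u) {α : Fin d → ℕ} (hα : ∑ i, α i ≤ n) :
    HasWeakDeriv U α u (weakDeriv U α u) := by
  obtain ⟨g, hg, -⟩ := h α hα
  have hex : ∃ g, HasWeakDeriv U α u g := ⟨g, hg⟩
  rw [weakDeriv, dif_pos hex]
  exact hex.choose_spec

/-- `weakDeriv` is chosen among all weak derivatives without regard to integrability; a.e.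
uniqueness transfers square integrability from the given one. -/
theorem MemSobolev.memLp_weakDeriv {d n : ℕ} {U : Set (Fin d → ℝ)} (hU : IsOpen U)
    {u : (Fin d → ℝ) → ℝ} (h : MemSobolev U n u) {α : Fin d → ℕ} (hα : ∑ i, α i ≤ n) :
    MemLp (weakDeriv U α u) 2 (volume.restrict U) := by
  obtain ⟨g, hg, hg2⟩ := h α hα
  exact (memLp_congr_ae (hg.ae_eq hU (h.hasWeakDeriv hα))).mp hg2

theorem MemSobolev.memLp {d n : ℕ} {U : Set (Fin d → ℝ)} (hU : IsOpen U)
    {u : (Fin d → ℝ) → ℝ} (h : MemSobolev U n u) : MemLp u 2 (volume.restrict U) := by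
  obtain ⟨g, hg, hg2⟩ := h 0 (by simp)
  exact (memLp_congr_ae (hg.ae_eq hU (hasWeakDeriv_zero hg.1))).mp hg2

theorem HasWeakDeriv.weakDeriv_ae_eq {d : ℕ} {U : Set (Fin d → ℝ)} (hU : IsOpen U) {α : Fin d → ℕ}
    {u g : (Fin d → ℝ) → ℝ} (h : HasWeakDeriv U α u g) :
    weakDeriv U α u =ᵐ[volume.restrict U] g := by
  have hex : ∃ g, HasWeakDeriv U α u g := ⟨g, h⟩
  rw [weakDeriv, dif_pos hex]
  exact hex.choose_spec.ae_eq hU h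

/-! ### Mollification -/

/-- The convolution of `f` with `ρ`. -/
def mollify {d : ℕ} (ρ f : (Fin d → ℝ) → ℝ) (x : Fin d → ℝ) : ℝ := ∫ t, f t * ρ (x - t)

theorem mollify_eq_convolution {d : ℕ} (ρ f : (Fin d → ℝ) → ℝ) :
    mollify ρ f = convolution f ρ (ContinuousLinearMap.lsmul ℝ ℝ) volume := by
  funext x; rfl

theorem mollify_eq_convolution_swap {d : ℕ} (ρ f : (Fin d → ℝ) → ℝ) :
    mollify ρ f = convolution ρ f (ContinuousLinearMap.lsmul ℝ ℝ) volume := by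
  funext x
  rw [convolution_lsmul_swap]
  exact integral_congr_ae (.of_forall fun t => mul_comm _ _)

theorem contDiff_mollify {d : ℕ} {ρ f : (Fin d → ℝ) → ℝ} (hρ : ContDiff ℝ ∞ ρ)
    (hc : HasCompactSupport ρ) (hf : LocallyIntegrable f) : ContDiff ℝ ∞ (mollify ρ f) := by
  rw [mollify_eq_convolution]
  exact hc.contDiff_convolution_right _ hf hρ

theorem partialDeriv_mollify {d : ℕ} {ρ f : (Fin d → ℝ) → ℝ} (hρ : ContDiff ℝ ∞ ρ)
    (hc : HasCompactSupport ρ) (hf : LocallyIntegrable f) (i : Fin d) :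
    partialDeriv i (mollify ρ f) = mollify (partialDeriv i ρ) f := by
  funext x
  rw [mollify_eq_convolution, mollify_eq_convolution]
  have h := hc.hasFDerivAt_convolution_right (ContinuousLinearMap.lsmul ℝ ℝ) hf
    (hρ.of_le (by simp)) x
  change fderiv ℝ _ x _ = _
  rw [h.fderiv, convolution_precompR_apply _ hf (hc.fderiv ℝ) (hρ.continuous_fderiv (by simp))]
  rfl

theorem multiDeriv_mollify {d : ℕ} {ρ f : (Fin d → ℝ) → ℝ} (hρ : ContDiff ℝ ∞ ρ)
    (hc : HasCompactSupport ρ) (hf : LocallyIntegrable f) (α : Fin d → ℕ) :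
    multiDeriv α (mollify ρ f) = mollify (multiDeriv α ρ) f := by
  induction α using multiIndex_induction with
  | zero => rw [multiDeriv_zero, multiDeriv_zero]
  | add_single α i ih =>
    rw [multiDeriv_add_single (contDiff_mollify hρ hc hf), ih, multiDeriv_add_single hρ,
      partialDeriv_mollify (hρ.multiDeriv α)
        (hc.of_isClosed_subset (isClosed_tsupport _) (tsupport_multiDeriv_subset α ρ)) hf]

theorem partialDeriv_comp_const_sub {d : ℕ} {ρ : (Fin d → ℝ) → ℝ} (hρ : ContDiff ℝ ∞ ρ)
    (x : Fin d → ℝ) (i : Fin d) :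
    partialDeriv i (fun t => ρ (x - t)) = fun t => -partialDeriv i ρ (x - t) := by
  funext t
  have h := (hρ.differentiable (by simp) (x - t)).hasFDerivAt.comp t
    ((hasFDerivAt_id t).const_sub x)
  change fderiv ℝ (ρ ∘ HSub.hSub x) t _ = _
  rw [h.fderiv]
  simp [partialDeriv]

theorem multiDeriv_comp_const_sub {d : ℕ} {ρ : (Fin d → ℝ) → ℝ} (hρ : ContDiff ℝ ∞ ρ)
    (x : Fin d → ℝ) (α : Fin d → ℕ) :
    multiDeriv α (fun t => ρ (x - t)) = fun t => (-1) ^ (∑ i, α i) * multiDeriv α ρ (x - t) := by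
  have hρx : ContDiff ℝ ∞ fun t => ρ (x - t) := hρ.comp (contDiff_const.sub contDiff_id)
  induction α using multiIndex_induction with
  | zero => simp [multiDeriv_zero]
  | add_single α i ih =>
    have hα : ContDiff ℝ ∞ fun t => multiDeriv α ρ (x - t) :=
      (hρ.multiDeriv α).comp (contDiff_const.sub contDiff_id)
    rw [multiDeriv_add_single hρx, ih, multiDeriv_add_single hρ, partialDeriv_const_mul hα,
      partialDeriv_comp_const_sub (hρ.multiDeriv α)]
    funext t
    simp [Finset.sum_add_distrib, pow_succ]

/-- The reflected kernel `t ↦ ρ (x - t)` is an admissible test function as long as its support stays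
inside `U`. The sign from reflecting cancels the sign in the weak derivative. -/
theorem multiDeriv_mollify_indicator {d : ℕ} {U : Set (Fin d → ℝ)} (hU : IsOpen U)
    {α : Fin d → ℕ} {u g : (Fin d → ℝ) → ℝ} (h : HasWeakDeriv U α u g)
    (hu : LocallyIntegrable (U.indicator u)) {ρ : (Fin d → ℝ) → ℝ} (hρ : ContDiff ℝ ∞ ρ)
    (hc : HasCompactSupport ρ) {x : Fin d → ℝ} (hx : ∀ t, x - t ∈ tsupport ρ → t ∈ U) :
    multiDeriv α (mollify ρ (U.indicator u)) x = mollify ρ (U.indicator g) x := by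
  have hsub : tsupport (fun t => ρ (x - t)) ⊆ (fun t => x - t) ⁻¹' tsupport ρ :=
    tsupport_comp_subset_preimage ρ (by fun_prop)
  have hcx : HasCompactSupport fun t => ρ (x - t) := by
    exact hc.comp_homeomorph (Homeomorph.subLeft x)
  have hw := h.2.2 (fun t => ρ (x - t)) (hρ.comp (contDiff_const.sub contDiff_id)) hcx
    (fun t ht => hx t (hsub ht))
  rw [multiDeriv_mollify hρ hc hu]
  unfold mollify
  have hind : ∀ (w φ : (Fin d → ℝ) → ℝ), ∫ t, U.indicator w t * φ t = ∫ t in U, w t * φ t := by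
    intro w φ
    rw [← integral_indicator hU.measurableSet]
    refine integral_congr_ae (.of_forall fun t => ?_)
    simp only [Set.indicator_mul_left]
  rw [hind u, hind g]
  rw [multiDeriv_comp_const_sub hρ] at hw
  have h2 : ∫ t in U, u t * ((-1) ^ (∑ i, α i) * multiDeriv α ρ (x - t)) =
      (-1) ^ (∑ i, α i) * ∫ t in U, u t * multiDeriv α ρ (x - t) := by
    rw [← integral_const_mul]
    refine integral_congr_ae (.of_forall fun t => ?_)
    ring
  rw [h2] at hw
  exact mul_left_cancel₀ (pow_ne_zero _ (by norm_num)) hw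

/-- Young's inequality: with `ρ` as the density of a measure of mass at most 1, apply
Cauchy–Schwarz, then Tonelli and translation invariance. -/
theorem lintegral_sq_mollify_le {d : ℕ} {ρ f : (Fin d → ℝ) → ℝ} (hρ : Continuous ρ)
    (hρ0 : ∀ x, 0 ≤ ρ x) (hρ1 : ∫⁻ x, ENNReal.ofReal (ρ x) ≤ 1)
    (hf : AEStronglyMeasurable f) :
    ∫⁻ x, ‖mollify ρ f x‖ₑ ^ 2 ≤ ∫⁻ x, ‖f x‖ₑ ^ 2 := by
  obtain ⟨f', hf', hff'⟩ := hf
  have hmol : mollify ρ f = mollify ρ f' := by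
    rw [mollify_eq_convolution, mollify_eq_convolution]
    exact convolution_congr _ hff' (ae_eq_refl _)
  have hnorm : ∫⁻ x, ‖f x‖ₑ ^ 2 = ∫⁻ x, ‖f' x‖ₑ ^ 2 :=
    lintegral_congr_ae (hff'.mono fun x hx => by simp only [hx])
  rw [hmol, hnorm]
  have hρm : Measurable fun x => ENNReal.ofReal (ρ x) :=
    ENNReal.measurable_ofReal.comp hρ.measurable
  set ν : Measure (Fin d → ℝ) := volume.withDensity fun x => ENNReal.ofReal (ρ x) with hν
  have hνu : ν Set.univ ≤ 1 := by
    rw [hν, withDensity_apply _ MeasurableSet.univ, Measure.restrict_univ]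
    exact hρ1
  have : IsFiniteMeasure ν := ⟨hνu.trans_lt ENNReal.one_lt_top⟩
  have hm : Measurable fun p : (Fin d → ℝ) × (Fin d → ℝ) => ‖f' (p.1 - p.2)‖ₑ :=
    (hf'.measurable.comp (measurable_fst.sub measurable_snd)).enorm
  have hpt : ∀ x, ‖mollify ρ f' x‖ₑ ^ 2 ≤ ∫⁻ t, ‖f' (x - t)‖ₑ ^ 2 ∂ν := by
    intro x
    have h1 : ‖mollify ρ f' x‖ₑ ≤ ∫⁻ t, ‖f' (x - t)‖ₑ ∂ν := by
      rw [mollify_eq_convolution_swap, convolution_lsmul]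
      refine (enorm_integral_le_lintegral_enorm _).trans_eq ?_
      rw [hν, lintegral_withDensity_eq_lintegral_mul (g := fun t => ‖f' (x - t)‖ₑ) _ hρm
        (hm.comp measurable_prodMk_left)]
      refine lintegral_congr fun t => ?_
      simp only [smul_eq_mul, enorm_mul, Pi.mul_apply]
      rw [Real.enorm_of_nonneg (hρ0 t)]
    refine (pow_le_pow_left' h1 2).trans ?_
    refine (sq_lintegral_le ν (hm.comp measurable_prodMk_left).aemeasurable).trans ?_
    exact mul_le_of_le_one_left' hνu
  calc ∫⁻ x, ‖mollify ρ f' x‖ₑ ^ 2 ≤ ∫⁻ x, ∫⁻ t, ‖f' (x - t)‖ₑ ^ 2 ∂ν := lintegral_mono hpt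
    _ = ∫⁻ t, (∫⁻ x, ‖f' (x - t)‖ₑ ^ 2) ∂ν :=
        lintegral_lintegral_swap (hm.pow_const 2).aemeasurable
    _ = ∫⁻ _t, (∫⁻ x, ‖f' x‖ₑ ^ 2) ∂ν := by
        refine lintegral_congr fun t => ?_
        exact lintegral_sub_right_eq_self (fun x => ‖f' x‖ₑ ^ 2) t
    _ ≤ ∫⁻ x, ‖f' x‖ₑ ^ 2 := by
        rw [lintegral_const]
        exact mul_le_of_le_one_right' hνu

end
noncomputable section

/-! ### Polynomials as functions -/

theorem MvPolynomial.continuous_eval_real {d : ℕ} (p : MvPolynomial (Fin d) ℝ) :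
    Continuous fun x : Fin d → ℝ => MvPolynomial.eval x p :=
  MvPolynomial.continuous_eval p

theorem contDiff_mvPolynomial_eval {d : ℕ} (p : MvPolynomial (Fin d) ℝ) :
    ContDiff ℝ ∞ fun x : Fin d → ℝ => MvPolynomial.eval x p := by
  induction p using MvPolynomial.induction_on with
  | C a => simpa using contDiff_const
  | add p q hp hq => simpa using hp.add hq
  | mul_X p i hp => simpa using hp.mul (contDiff_apply ℝ ℝ i)

theorem partialDeriv_mvPolynomial_eval {d : ℕ} (p : MvPolynomial (Fin d) ℝ) (i : Fin d) :
    partialDeriv i (fun x => MvPolynomial.eval x p) =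
      fun x => MvPolynomial.eval x (MvPolynomial.pderiv i p) := by
  induction p using MvPolynomial.induction_on with
  | C a => funext x; simp [partialDeriv]
  | add p q hp hq =>
    simp only [map_add]
    rw [partialDeriv_add (contDiff_mvPolynomial_eval p) (contDiff_mvPolynomial_eval q), hp, hq]
  | mul_X p j hp =>
    funext x
    have h1 := ((contDiff_mvPolynomial_eval p).differentiable (by simp) x).hasFDerivAt
    have h2 : HasFDerivAt (fun x : Fin d → ℝ => x j) (ContinuousLinearMap.proj (R := ℝ) j) x :=
      (ContinuousLinearMap.proj (R := ℝ) (φ := fun _ : Fin d => ℝ) j).hasFDerivAt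
    have h3 := (h1.mul h2).fderiv
    have h4 := congrFun hp x
    simp only [partialDeriv] at h4 ⊢
    simp only [map_mul, MvPolynomial.eval_X]
    change fderiv ℝ ((fun x => MvPolynomial.eval x p) * fun x : Fin d → ℝ => x j) x _ = _
    rw [h3]
    simp [h4, Derivation.leibniz, MvPolynomial.pderiv_X, Pi.single_apply, apply_ite, eq_comm]

/-- A ball in the maximum norm is a product of intervals, and a polynomial vanishing on a product of
infinite sets is zero. -/
theorem MvPolynomial.eq_zero_of_eval_eq_zero_on_open {d : ℕ} {U : Set (Fin d → ℝ)}
    (hU : IsOpen U) (hne : U.Nonempty) {p : MvPolynomial (Fin d) ℝ}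
    (h : ∀ x ∈ U, MvPolynomial.eval x p = 0) : p = 0 := by
  obtain ⟨c, hc⟩ := hne
  obtain ⟨ε, hε, hball⟩ := Metric.isOpen_iff.mp hU c hc
  refine MvPolynomial.funext_set (s := fun i => Metric.ball (c i) ε) (fun i => ?_) ?_
  · rw [Real.ball_eq_Ioo]
    exact Set.Ioo_infinite (by linarith)
  · intro x hx
    rw [map_zero]
    refine h x (hball ?_)
    rw [ball_pi _ hε]
    exact hx

/-- A sequence of polynomials of bounded degree that is bounded at almost every point of an open
set has a convergent subsequence. -/
theorem exists_subseq_tendsto_of_ae_bounded {d k : ℕ} {U : Set (Fin d → ℝ)} (hU : IsOpen U)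
    (hne : U.Nonempty) {q : ℕ → MvPolynomial (Fin d) ℝ} (hq : ∀ n, q n ∈ QPoly d k)
    (hb : ∀ᵐ x ∂volume.restrict U, ∃ M : ℝ, ∀ n, |MvPolynomial.eval x (q n)| ≤ M) :
    ∃ p ∈ QPoly d k, ∃ φ : ℕ → ℕ, StrictMono φ ∧
      ∀ l : MvPolynomial (Fin d) ℝ →ₗ[ℝ] ℝ,
        Filter.Tendsto (fun n => l (q (φ n))) Filter.atTop (nhds (l p)) := by
  let Q : ℕ → QPoly d k := fun n => ⟨q n, hq n⟩
  let ev : (Fin d → ℝ) → (QPoly d k →ₗ[ℝ] ℝ) := fun x =>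
    (MvPolynomial.aeval x).toLinearMap ∘ₗ (QPoly d k).subtype
  have hev : ∀ x (z : QPoly d k), ev x z = MvPolynomial.eval x (z : MvPolynomial (Fin d) ℝ) :=
    fun x z => by simp [ev, MvPolynomial.aeval_eq_eval]
  let s : Set (QPoly d k →ₗ[ℝ] ℝ) := {f | ∃ M : ℝ, ∀ n, |f (Q n)| ≤ M}
  -- The functionals that are bounded along the sequence include evaluation at almost every point of
  -- `U`. These separate polynomials, so by finite dimension they span the dual, and every
  -- coordinate is bounded.
  have hspan : Submodule.span ℝ s = ⊤ := by
    refine Submodule.span_eq_top_of_ne_zero fun z hz => ?_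
    by_contra hcon
    push Not at hcon
    apply hz
    have hae : (fun x => MvPolynomial.eval x (z : MvPolynomial (Fin d) ℝ))
        =ᵐ[volume.restrict U] fun _ => 0 := by
      filter_upwards [hb] with x hx
      rw [← hev]
      exact hcon (ev x) (by simpa only [s, Set.mem_ofPred_eq, hev] using hx)
    have := Measure.eqOn_open_of_ae_eq hae hU
      (MvPolynomial.continuous_eval_real _).continuousOn continuousOn_const
    exact Subtype.ext (MvPolynomial.eq_zero_of_eval_eq_zero_on_open hU hne this)
  have hbdd : ∀ f : QPoly d k →ₗ[ℝ] ℝ, ∃ M : ℝ, ∀ n, |f (Q n)| ≤ M := by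
    intro f
    have hf : f ∈ Submodule.span ℝ s := hspan ▸ Submodule.mem_top
    induction hf using Submodule.span_induction with
    | mem f hf => exact hf
    | zero => exact ⟨0, fun n => by simp⟩
    | add f g _ _ hf hg =>
      obtain ⟨M, hM⟩ := hf
      obtain ⟨M', hM'⟩ := hg
      exact ⟨M + M', fun n => (abs_add_le _ _).trans (add_le_add (hM n) (hM' n))⟩
    | smul c f _ hf =>
      obtain ⟨M, hM⟩ := hf
      refine ⟨|c| * M, fun n => ?_⟩
      rw [LinearMap.smul_apply, smul_eq_mul, abs_mul]
      exact mul_le_mul_of_nonneg_left (hM n) (abs_nonneg c)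
  let b := Module.finBasis ℝ (QPoly d k)
  choose M hM using fun i => hbdd (b.coord i)
  have hmem : ∀ n, b.equivFun (Q n) ∈ Metric.closedBall (0 : Fin _ → ℝ) (∑ i, |M i|) := by
    intro n
    rw [mem_closedBall_zero_iff, pi_norm_le_iff_of_nonneg (Finset.sum_nonneg fun _ _ => abs_nonneg _)]
    intro i
    refine ((hM i n).trans (le_abs_self _)).trans ?_
    exact Finset.single_le_sum (f := fun i => |M i|) (fun _ _ => abs_nonneg _) (Finset.mem_univ i)
  obtain ⟨c, -, φ, hφ, hlim⟩ := tendsto_subseq_of_bounded Metric.isBounded_closedBall hmem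
  refine ⟨(b.equivFun.symm c : QPoly d k), (b.equivFun.symm c).2, φ, hφ, fun l => ?_⟩
  have hcont : Continuous (l ∘ₗ (QPoly d k).subtype ∘ₗ b.equivFun.symm.toLinearMap) :=
    LinearMap.continuous_of_finiteDimensional _
  have := (hcont.tendsto c).comp hlim
  refine this.congr fun n => ?_
  simp [Q]

/-! ### Polynomial approximation in Sobolev spaces -/

theorem eLpNorm_two_sq {X : Type*} [MeasurableSpace X] (μ : Measure X) (f : X → ℝ) :
    eLpNorm f 2 μ ^ 2 = ∫⁻ x, ‖f x‖ₑ ^ 2 ∂μ := by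
  rw [eLpNorm_eq_lintegral_rpow_enorm_toReal (by norm_num) (by norm_num), ← ENNReal.rpow_natCast,
    ← ENNReal.rpow_mul]
  norm_num

theorem sobolevSeminorm_sq {d : ℕ} (U : Set (Fin d → ℝ)) (n : ℕ) (u : (Fin d → ℝ) → ℝ) :
    sobolevSeminorm U n u ^ 2 = ∑ α ∈ Finset.piAntidiag (Finset.univ : Finset (Fin d)) n,
      ∫⁻ x in U, ‖weakDeriv U α u x‖ₑ ^ 2 := by
  simp only [sobolevSeminorm, eLpNorm_two_sq]
  rw [← ENNReal.rpow_natCast, ← ENNReal.rpow_mul]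
  norm_num

/-- Number of multi-indices of order `n`. -/
def multiCard (d n : ℕ) : ℕ := (Finset.piAntidiag (Finset.univ : Finset (Fin d)) n).card

theorem sq_ofReal_derivSum_le {d n : ℕ} (c : ℝ) (hc : 0 ≤ c) (v : (Fin d → ℝ) → ℝ)
    (z : Fin d → ℝ) :
    ENNReal.ofReal (c * derivSum n v z) ^ 2 ≤ ENNReal.ofReal c ^ 2 * multiCard d n *
      ∑ α ∈ Finset.piAntidiag (Finset.univ : Finset (Fin d)) n, ‖multiDeriv α v z‖ₑ ^ 2 := by
  rw [ENNReal.ofReal_mul hc, mul_pow, mul_assoc]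
  gcongr
  rw [← ENNReal.ofReal_pow (derivSum_nonneg n v z)]
  have h1 : derivSum n v z ^ 2 ≤ multiCard d n *
      ∑ α ∈ Finset.piAntidiag (Finset.univ : Finset (Fin d)) n, |multiDeriv α v z| ^ 2 :=
    sq_sum_le_card_mul_sum_sq
  refine (ENNReal.ofReal_le_ofReal h1).trans_eq ?_
  rw [ENNReal.ofReal_mul (by positivity), ENNReal.ofReal_natCast,
    ENNReal.ofReal_sum_of_nonneg fun _ _ => by positivity]
  congr 1
  refine Finset.sum_congr rfl fun α _ => ?_
  rw [ENNReal.ofReal_pow (abs_nonneg _), Real.enorm_eq_ofReal_abs]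

/-- On `B` differentiation passes through the mollification to the weak derivative, and mollifying
does not increase the `L²` norm. The factor `multiCard d n` is the price of squaring a sum. -/
theorem lintegral_sq_derivSum_mollify_le {d n : ℕ} {U B : Set (Fin d → ℝ)} (hU : IsOpen U)
    (hB : MeasurableSet B) {u : (Fin d → ℝ) → ℝ} (hu : MemSobolev U n u)
    (hui : LocallyIntegrable (U.indicator u)) {ρ : (Fin d → ℝ) → ℝ} (hρ : ContDiff ℝ ∞ ρ)
    (hc : HasCompactSupport ρ) (hρ0 : ∀ x, 0 ≤ ρ x) (hρ1 : ∫⁻ x, ENNReal.ofReal (ρ x) ≤ 1)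
    (hx : ∀ x ∈ B, ∀ t, x - t ∈ tsupport ρ → t ∈ U) (c : ℝ) (hc0 : 0 ≤ c) :
    ∫⁻ z in B, ENNReal.ofReal (c * derivSum n (mollify ρ (U.indicator u)) z) ^ 2 ≤
      ENNReal.ofReal c ^ 2 * multiCard d n * sobolevSeminorm U n u ^ 2 := by
  have hv := contDiff_mollify hρ hc hui
  refine (lintegral_mono fun z => sq_ofReal_derivSum_le c hc0 _ z).trans ?_
  rw [lintegral_const_mul' _ _ (ENNReal.mul_ne_top (ENNReal.pow_ne_top ENNReal.ofReal_ne_top)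
    (ENNReal.natCast_ne_top _)), sobolevSeminorm_sq]
  refine mul_le_mul' le_rfl ?_
  rw [lintegral_finsetSum]
  · refine Finset.sum_le_sum fun α hα => ?_
    have hα' : ∑ i, α i ≤ n := by
      simp only [Finset.mem_piAntidiag] at hα
      exact hα.1.le
    have hw := hu.hasWeakDeriv hα'
    have hm := (hu.memLp_weakDeriv hU hα').1
    calc ∫⁻ z in B, ‖multiDeriv α (mollify ρ (U.indicator u)) z‖ₑ ^ 2
        = ∫⁻ z in B, ‖mollify ρ (U.indicator (weakDeriv U α u)) z‖ₑ ^ 2 := by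
          refine setLIntegral_congr_fun hB fun z hz => ?_
          simp only [multiDeriv_mollify_indicator hU hw hui hρ hc (hx z hz)]
      _ ≤ ∫⁻ z, ‖mollify ρ (U.indicator (weakDeriv U α u)) z‖ₑ ^ 2 := setLIntegral_le_lintegral _ _
      _ ≤ ∫⁻ z, ‖U.indicator (weakDeriv U α u) z‖ₑ ^ 2 :=
          lintegral_sq_mollify_le hρ.continuous hρ0 hρ1
            ((aestronglyMeasurable_indicator_iff hU.measurableSet).mpr hm)
      _ = ∫⁻ z in U, ‖weakDeriv U α u z‖ₑ ^ 2 := by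
          rw [← lintegral_indicator hU.measurableSet]
          refine lintegral_congr fun z => ?_
          by_cases hz : z ∈ U <;> simp [hz]
  · intro α _
    exact ((hv.multiDeriv α).continuous.measurable.enorm).pow_const 2

end
noncomputable section

/-! ### Bramble–Hilbert lemma on boxes. -/

theorem MemSobolev.sobolevSeminorm_ne_top {d n : ℕ} {U : Set (Fin d → ℝ)} (hU : IsOpen U)
    {u : (Fin d → ℝ) → ℝ} (hu : MemSobolev U n u) : sobolevSeminorm U n u ≠ ⊤ := by
  have h : sobolevSeminorm U n u ^ 2 ≠ ⊤ := by
    rw [sobolevSeminorm_sq]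
    refine ENNReal.sum_ne_top.mpr fun α hα => ?_
    have hα' : ∑ i, α i ≤ n := by
      simp only [Finset.mem_piAntidiag] at hα
      exact hα.1.le
    rw [← eLpNorm_two_sq]
    exact ENNReal.pow_ne_top (hu.memLp_weakDeriv hU hα').2.ne
  intro h'
  rw [h'] at h
  simp at h

theorem exists_bump_sequence (d : ℕ) {δ : ℕ → ℝ} (hδ : ∀ n, 0 < δ n)
    (hlim : Filter.Tendsto δ Filter.atTop (nhds 0)) :
    ∃ ρ : ℕ → (Fin d → ℝ) → ℝ, (∀ n, ContDiff ℝ ∞ (ρ n)) ∧ (∀ n, HasCompactSupport (ρ n)) ∧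
      (∀ n x, 0 ≤ ρ n x) ∧ (∀ n, ∫⁻ x, ENNReal.ofReal (ρ n x) ≤ 1) ∧
      (∀ n, ∀ x ∈ tsupport (ρ n), ∀ i, |x i| < δ n) ∧
      ∀ f : (Fin d → ℝ) → ℝ, LocallyIntegrable f →
        ∀ᵐ x, Filter.Tendsto (fun n => mollify (ρ n) f x) Filter.atTop (nhds (f x)) := by
  -- The constant ratio 2 of the radii yields convergence at almost every point, by Lebesgue
  -- differentiation. The outer radius `δ n / 2` makes the support bound strict.
  let φ : ℕ → ContDiffBump (0 : Fin d → ℝ) := fun n =>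
    ⟨δ n / 4, δ n / 2, by linarith [hδ n], by linarith [hδ n]⟩
  refine ⟨fun n => (φ n).normed volume, fun n => (φ n).contDiff_normed,
    fun n => (φ n).hasCompactSupport_normed, fun n => (φ n).nonneg_normed, fun n => ?_,
    fun n x hx i => ?_, fun f hf => ?_⟩
  · rw [← ofReal_integral_eq_lintegral_ofReal (φ n).integrable_normed
      (.of_forall (φ n).nonneg_normed), (φ n).integral_normed, ENNReal.ofReal_one]
  · rw [(φ n).tsupport_normed_eq, mem_closedBall_zero_iff] at hx
    have h1 := (norm_le_pi_norm x i).trans hx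
    rw [Real.norm_eq_abs] at h1
    have h2 : (φ n).rOut = δ n / 2 := rfl
    linarith [hδ n]
  · have h := ContDiffBump.ae_convolution_tendsto_right_of_locallyIntegrable (μ := volume)
      (φ := φ) (l := Filter.atTop) (K := 2) (g := f) ?_ ?_ hf
    · filter_upwards [h] with x hx
      simpa only [mollify_eq_convolution_swap] using hx
    · simpa [φ] using hlim.div_const 2
    · exact .of_forall fun n => by simp only [φ]; linarith

theorem exists_pos_forall_mul_le {ι : Type*} [Finite ι] {f : ι → ℝ} (hf : ∀ i, 0 < f i) :
    ∃ δ > 0, ∀ i, 4 * δ ≤ f i := by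
  have h : ∀ᶠ δ in nhdsWithin (0 : ℝ) (Set.Ioi 0), ∀ i, 4 * δ ≤ f i := by
    rw [Filter.eventually_all]
    intro i
    have : Filter.Tendsto (fun δ : ℝ => 4 * δ) (nhdsWithin 0 (Set.Ioi 0)) (nhds (4 * 0)) :=
      ((continuous_const.mul continuous_id).tendsto 0).mono_left nhdsWithin_le_nhds
    rw [mul_zero] at this
    exact (this.eventually (gt_mem_nhds (hf i))).mono fun _ h => le_of_lt h
  obtain ⟨δ, h1, h2⟩ := (h.and self_mem_nhdsWithin).exists
  exact ⟨δ, h2, h1⟩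

/-- **Bramble–Hilbert lemma** on boxes, with error bounds in the maximum norm and in the
`H¹`-seminorm. -/
theorem MemSobolev.exists_polynomial_approx {d k : ℕ} (hdk : d ≤ 2 * (k + 1)) {a b : Fin d → ℝ}
    (hab : ∀ i, a i < b i) {L : ℝ} (hL : ∀ i, b i - a i ≤ L) (hL0 : 0 ≤ L)
    {U : Set (Fin d → ℝ)} (hUab : U = Set.univ.pi fun i => Set.Ioo (a i) (b i))
    {u : (Fin d → ℝ) → ℝ} (hu : MemSobolev U (k + 2) u) :
    ∃ q ∈ QPoly d (k + 1),
      (∀ᵐ x ∂volume.restrict U, ‖u x - MvPolynomial.eval x q‖ₑ ^ 2 ≤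
        2 ^ d * (volume U)⁻¹ * (ENNReal.ofReal ((d * L) ^ (k + 2)) ^ 2 * multiCard d (k + 2) *
          sobolevSeminorm U (k + 2) u ^ 2)) ∧
      ∀ i, ∫⁻ x in U, ‖weakDeriv U (Pi.single i 1) u x -
          MvPolynomial.eval x (MvPolynomial.pderiv i q)‖ₑ ^ 2 ≤
        2 ^ d * (ENNReal.ofReal ((d * L) ^ (k + 1)) ^ 2 * multiCard d (k + 2) *
          sobolevSeminorm U (k + 2) u ^ 2) := by
  have hU : IsOpen U := by
    rw [hUab]; exact isOpen_set_pi Set.finite_univ fun i _ => isOpen_Ioo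
  have hmemU : ∀ x, x ∈ U ↔ ∀ i, a i < x i ∧ x i < b i := fun x => by simp [hUab]
  have hUfin : volume U ≠ ⊤ := by
    rw [hUab, volume_pi_pi]
    simp [ENNReal.prod_ne_top]
  have hdL : 0 ≤ (d : ℝ) * L := by positivity
  have : IsFiniteMeasure (volume.restrict U) := ⟨by simpa using hUfin.lt_top⟩
  have hloc : ∀ {g : (Fin d → ℝ) → ℝ}, MemLp g 2 (volume.restrict U) →
      LocallyIntegrable (U.indicator g) := fun hg =>
    ((integrable_indicator_iff hU.measurableSet).mpr (hg.integrable (by norm_num))).locallyIntegrable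
  have hui := hloc (hu.memLp hU)
  obtain ⟨δ₀, hδ₀, hδab⟩ := exists_pos_forall_mul_le fun i => sub_pos.mpr (hab i)
  let δ : ℕ → ℝ := fun n => δ₀ / (n + 1)
  have hδ : ∀ n, 0 < δ n := fun n => by positivity
  have hδle : ∀ n, δ n ≤ δ₀ := fun n => div_le_self hδ₀.le (by linarith [n.cast_nonneg (α := ℝ)])
  have hδlim : Filter.Tendsto δ Filter.atTop (nhds 0) := by
    have := (tendsto_one_div_add_atTop_nhds_zero_nat (𝕜 := ℝ)).const_mul δ₀
    rw [mul_zero] at this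
    refine this.congr fun n => ?_
    simp only [δ]; ring
  obtain ⟨ρ, hρ, hρc, hρ0, hρ1, hρs, hρlim⟩ := exists_bump_sequence d hδ hδlim
  -- On these shrunken boxes the kernel `ρ n` does not reach the boundary of `U`, so the mollified
  -- function has the mollified weak derivatives.
  let B : ℕ → Set (Fin d → ℝ) := fun n => Set.Icc (fun i => a i + δ n) (fun i => b i - δ n)
  have hmemB : ∀ n x, x ∈ B n ↔ ∀ i, a i + δ n ≤ x i ∧ x i ≤ b i - δ n := fun n x => by
    simp only [B, Set.mem_Icc, Pi.le_def, forall_and]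
  have hBU : ∀ n, B n ⊆ U := fun n x hx => (hmemU x).mpr fun i => by
    have := (hmemB n x).mp hx i
    constructor <;> linarith [hδ n]
  have hBc : ∀ n, IsCompact (B n) := fun n => isCompact_Icc
  have hBconv : ∀ n, Convex ℝ (B n) := fun n => convex_Icc _ _
  have hvolU : volume U = ∏ i, ENNReal.ofReal (b i - a i) := by
    rw [hUab, volume_pi_pi]; simp
  -- Each side loses `2 * δ n`, at most half of its length because `4 * δ₀` is at most every side.
  -- Hence the constants do not deteriorate with `n`.
  have hvolB : ∀ n, volume U ≤ 2 ^ d * volume (B n) := by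
    intro n
    have hcard : (2 : ℝ≥0∞) ^ d = ∏ _i : Fin d, 2 := by simp
    rw [hvolU, Real.volume_Icc_pi, hcard, ← Finset.prod_mul_distrib]
    refine Finset.prod_le_prod' fun i _ => ?_
    have h2 : (2 : ℝ≥0∞) = ENNReal.ofReal 2 := by simp
    rw [h2, ← ENNReal.ofReal_mul two_pos.le]
    refine ENNReal.ofReal_le_ofReal ?_
    linarith [hδab i, hδle n]
  have hU0 : volume U ≠ 0 := by
    rw [hvolU, Finset.prod_ne_zero_iff]
    intro i _
    simpa using hab i
  have hB0 : ∀ n, volume (B n) ≠ 0 := fun n h0 => hU0 (by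
    have := hvolB n
    rw [h0, mul_zero] at this
    exact le_antisymm this zero_le)
  have hBinv : ∀ n, (volume (B n))⁻¹ ≤ 2 ^ d * (volume U)⁻¹ := by
    intro n
    rw [← div_eq_mul_inv, ENNReal.le_div_iff_mul_le (Or.inl hU0) (Or.inl hUfin), mul_comm,
      ← div_eq_mul_inv]
    exact ENNReal.div_le_of_le_mul (hvolB n)
  have hBL : ∀ n, ∀ x ∈ B n, ∀ y ∈ B n, ∀ i, |x i - y i| ≤ L := by
    intro n x hx y hy i
    have h1 := (hmemB n x).mp hx i
    have h2 := (hmemB n y).mp hy i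
    rw [abs_le]
    constructor <;> linarith [hδ n, hL i]
  have hBs : ∀ n, ∀ x ∈ B n, ∀ t, x - t ∈ tsupport (ρ n) → t ∈ U := by
    intro n x hx t ht
    refine (hmemU t).mpr fun i => ?_
    have h1 := hρs n _ ht i
    have h2 := (hmemB n x).mp hx i
    rw [Pi.sub_apply, abs_lt] at h1
    constructor <;> linarith
  let v : ℕ → (Fin d → ℝ) → ℝ := fun n => mollify (ρ n) (U.indicator u)
  have hv : ∀ n, ContDiff ℝ ∞ (v n) := fun n => contDiff_mollify (hρ n) (hρc n) hui
  choose q hqdeg hq hq' using fun n => exists_mvPolynomial_avgTaylor (hBc n) k (hv n)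
  have hsum : ∀ n (c : ℝ), 0 ≤ c →
      ∫⁻ z in B n, ENNReal.ofReal (c * derivSum (k + 2) (v n) z) ^ 2 ≤
        ENNReal.ofReal c ^ 2 * multiCard d (k + 2) * sobolevSeminorm U (k + 2) u ^ 2 :=
    fun n c hc => lintegral_sq_derivSum_mollify_le hU (hBc n).measurableSet hu hui (hρ n) (hρc n)
      (hρ0 n) (hρ1 n) (hBs n) c hc
  set E₀ := ENNReal.ofReal ((d * L) ^ (k + 2)) ^ 2 * multiCard d (k + 2) *
    sobolevSeminorm U (k + 2) u ^ 2 with hE₀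
  set E₁ := ENNReal.ofReal ((d * L) ^ (k + 1)) ^ 2 * multiCard d (k + 2) *
    sobolevSeminorm U (k + 2) u ^ 2 with hE₁
  have hsup : ∀ n, ∀ x ∈ B n,
      ‖v n x - MvPolynomial.eval x (q n)‖ₑ ^ 2 ≤ 2 ^ d * (volume U)⁻¹ * E₀ := by
    intro n x hx
    rw [hq]
    refine (sq_enorm_sub_avgTaylor_le hdk (hv n) (hBc n) (hBconv n) (hB0 n) (hBL n) hx).trans ?_
    exact mul_le_mul' (hBinv n) (hsum n _ (pow_nonneg hdL _))
  -- The derivative of `q n` is the averaged Taylor polynomial, of one degree less, of the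
  -- derivative of `v n`; its remainder again involves derivatives of `v n` of order `k + 2`.
  have hgrad : ∀ n i, ∫⁻ x in B n, ‖partialDeriv i (v n) x -
      MvPolynomial.eval x (MvPolynomial.pderiv i (q n))‖ₑ ^ 2 ≤ 2 ^ d * E₁ := by
    intro n i
    simp only [hq']
    refine (lintegral_sq_enorm_sub_avgTaylor_le k ((hv n).partialDeriv i) (hBc n) (hBconv n) (hB0 n)
      (hBL n)).trans (mul_le_mul' le_rfl ?_)
    refine (lintegral_mono fun z => ?_).trans (hsum n ((d * L) ^ (k + 1)) (pow_nonneg hdL _))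
    refine pow_le_pow_left' (ENNReal.ofReal_le_ofReal ?_) 2
    exact mul_le_mul_of_nonneg_left (derivSum_partialDeriv_le _ (hv n) i z) (pow_nonneg hdL _)
  have hM : 2 ^ d * (volume U)⁻¹ * E₀ ≠ ⊤ := by
    refine ENNReal.mul_ne_top (ENNReal.mul_ne_top (by simp) (ENNReal.inv_ne_top.mpr hU0)) ?_
    exact ENNReal.mul_ne_top (ENNReal.mul_ne_top (ENNReal.pow_ne_top ENNReal.ofReal_ne_top)
      (ENNReal.natCast_ne_top _)) (ENNReal.pow_ne_top (hu.sobolevSeminorm_ne_top hU))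
  have hvlim := hρlim _ hui
  have hBmono : ∀ n, B 0 ⊆ B n := by
    intro n x hx
    refine (hmemB n x).mpr fun i => ?_
    have h1 := (hmemB 0 x).mp hx i
    have h2 : δ 0 = δ₀ := by simp [δ]
    constructor <;> linarith [hδle n]
  -- At almost every point `v n x` converges and `q n` stays within a fixed distance of it, so the
  -- polynomials are bounded there. The added 1 below allows for errors smaller than 1, which their
  -- squares do not dominate.
  have hbdd : ∀ᵐ x ∂volume.restrict (interior (B 0)),
      ∃ M : ℝ, ∀ n, |MvPolynomial.eval x (q n)| ≤ M := by
    rw [ae_restrict_iff' isOpen_interior.measurableSet]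
    filter_upwards [hvlim] with x hx hxB
    obtain ⟨M, hMx⟩ := (Filter.Tendsto.bddAbove_range hx.abs)
    refine ⟨M + (2 ^ d * (volume U)⁻¹ * E₀ + 1).toReal, fun n => ?_⟩
    have h1 := hsup n x (hBmono n (interior_subset hxB))
    have h2 : |v n x| ≤ M := hMx ⟨n, rfl⟩
    have h3 : |v n x - MvPolynomial.eval x (q n)| ≤ (2 ^ d * (volume U)⁻¹ * E₀ + 1).toReal := by
      rw [← ENNReal.ofReal_le_iff_le_toReal (ENNReal.add_ne_top.mpr ⟨hM, ENNReal.one_ne_top⟩),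
        ← Real.enorm_eq_ofReal_abs]
      rcases le_total ‖v n x - MvPolynomial.eval x (q n)‖ₑ 1 with h | h
      · exact h.trans le_add_self
      · refine le_trans ?_ (h1.trans le_self_add)
        exact le_self_pow h two_ne_zero
    have h4 := abs_sub_abs_le_abs_sub (MvPolynomial.eval x (q n)) (v n x)
    rw [abs_sub_comm] at h4
    linarith
  have hne : (interior (B 0)).Nonempty := by
    refine ⟨fun i => (a i + b i) / 2, ?_⟩
    rw [mem_interior]
    refine ⟨Set.univ.pi fun i => Set.Ioo (a i + δ 0) (b i - δ 0), fun x hx => ?_,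
      isOpen_set_pi Set.finite_univ fun i _ => isOpen_Ioo, fun i _ => ?_⟩
    · exact (hmemB 0 x).mpr fun i => ⟨(hx i trivial).1.le, (hx i trivial).2.le⟩
    · have h2 : δ 0 = δ₀ := by simp [δ]
      constructor <;> linarith [hδab i]
  obtain ⟨p, hp, φ, hφ, hlim⟩ := exists_subseq_tendsto_of_ae_bounded isOpen_interior hne hqdeg hbdd
  have hevent : ∀ x ∈ U, ∀ᶠ n in Filter.atTop, x ∈ B (φ n) := by
    intro x hx
    simp only [hmemB]
    rw [Filter.eventually_all]
    intro i
    have hxi := (hmemU x).mp hx i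
    have h1 : ∀ᶠ n in Filter.atTop, δ (φ n) < min (x i - a i) (b i - x i) :=
      (hδlim.comp hφ.tendsto_atTop).eventually
        (gt_mem_nhds (lt_min (by linarith) (by linarith)))
    filter_upwards [h1] with n hn
    have := lt_min_iff.mp hn
    constructor <;> linarith
  refine ⟨p, hp, ?_, fun i => ?_⟩
  · rw [ae_restrict_iff' hU.measurableSet]
    filter_upwards [hvlim] with x hx hxU
    have h1 := hlim (MvPolynomial.aeval x).toLinearMap
    simp only [AlgHom.toLinearMap_apply, MvPolynomial.aeval_eq_eval] at h1
    have h2 := (hx.comp hφ.tendsto_atTop).sub h1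
    rw [Set.indicator_of_mem hxU] at h2
    have h3 := (ENNReal.continuous_pow 2).tendsto _ |>.comp h2.enorm
    refine le_of_tendsto h3 ?_
    filter_upwards [hevent x hxU] with n hn
    exact hsup (φ n) x hn
  · have hi : ∑ j, (Pi.single i 1 : Fin d → ℕ) j ≤ k + 2 := by simp
    have hw := hu.hasWeakDeriv hi
    have hglim := hρlim _ (hloc (hu.memLp_weakDeriv hU hi))
    -- The indicators put all integrands on the fixed domain `U`. They equal 1 eventually at each
    -- point, and Fatou's lemma then passes to the limit.
    let F : ℕ → (Fin d → ℝ) → ℝ≥0∞ := fun n => (B (φ n)).indicator fun x =>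
      ‖partialDeriv i (v (φ n)) x - MvPolynomial.eval x (MvPolynomial.pderiv i (q (φ n)))‖ₑ ^ 2
    have hFm : ∀ n, Measurable (F n) := fun n => by
      refine Measurable.indicator ?_ (hBc _).measurableSet
      exact (((hv _).partialDeriv i).continuous.sub
        (MvPolynomial.continuous_eval_real _)).measurable.enorm.pow_const 2
    have hFlim : ∀ᵐ x ∂volume.restrict U, Filter.Tendsto (fun n => F n x) Filter.atTop
        (nhds (‖weakDeriv U (Pi.single i 1) u x -
          MvPolynomial.eval x (MvPolynomial.pderiv i p)‖ₑ ^ 2)) := by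
      rw [ae_restrict_iff' hU.measurableSet]
      filter_upwards [hglim] with x hx hxU
      have h1 := hlim ((MvPolynomial.aeval x).toLinearMap ∘ₗ
        (MvPolynomial.pderiv i).toLinearMap)
      simp only [LinearMap.comp_apply, AlgHom.toLinearMap_apply, MvPolynomial.aeval_eq_eval,
        Derivation.coeFn_coe] at h1
      have h2 := (hx.comp hφ.tendsto_atTop).sub h1
      rw [Set.indicator_of_mem hxU] at h2
      have h3 := (ENNReal.continuous_pow 2).tendsto _ |>.comp h2.enorm
      refine h3.congr' ?_
      filter_upwards [hevent x hxU] with n hn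
      simp only [F, Set.indicator_of_mem hn, Function.comp_apply]
      rw [← multiDeriv_mollify_indicator hU hw hui (hρ _) (hρc _) (hBs _ x hn),
        multiDeriv_single (hv _)]
    calc ∫⁻ x in U, ‖weakDeriv U (Pi.single i 1) u x -
          MvPolynomial.eval x (MvPolynomial.pderiv i p)‖ₑ ^ 2
        = ∫⁻ x in U, Filter.liminf (fun n => F n x) Filter.atTop :=
          lintegral_congr_ae (hFlim.mono fun x hx => hx.liminf_eq.symm)
      _ ≤ Filter.liminf (fun n => ∫⁻ x in U, F n x) Filter.atTop := lintegral_liminf_le hFm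
      _ ≤ 2 ^ d * E₁ := by
          refine Filter.liminf_le_of_frequently_le' (Filter.Frequently.of_forall fun n => ?_)
          simp only [F]
          rw [setLIntegral_indicator (hBc _).measurableSet, Set.inter_eq_left.mpr (hBU _)]
          exact hgrad (φ n) i

end
noncomputable section

/-! ### Legendre moments on three adjacent intervals -/

theorem degree_legendrePoly (n : ℕ) : (legendrePoly n).degree = n := by
  have hb : ((1 : Polynomial ℝ) - Polynomial.X ^ 2).natDegree = 2 := by
    compute_degree!
  have hl : ((1 : Polynomial ℝ) - Polynomial.X ^ 2).leadingCoeff = -1 := by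
    rw [Polynomial.leadingCoeff, hb]
    simp [Polynomial.coeff_one]
  have hn : ((1 : Polynomial ℝ) - Polynomial.X ^ 2) ^ n ≠ 0 := by
    refine pow_ne_zero _ fun h => ?_
    rw [h] at hb
    simp at hb
  have hdeg : (((1 : Polynomial ℝ) - Polynomial.X ^ 2) ^ n).natDegree = 2 * n := by
    rw [Polynomial.natDegree_pow, hb, mul_comm]
  have hc : ((-1 : ℝ) ^ n / (2 ^ n * (n.factorial : ℝ))) ≠ 0 := by
    refine div_ne_zero (pow_ne_zero _ (by norm_num)) (by positivity)
  refine Polynomial.degree_eq_of_le_of_coeff_ne_zero ?_ ?_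
  · rw [legendrePoly, Polynomial.degree_C_mul hc]
    refine Polynomial.degree_le_natDegree.trans ?_
    have := Polynomial.natDegree_iterate_derivative (((1 : Polynomial ℝ) - Polynomial.X ^ 2) ^ n) n
    rw [hdeg] at this
    exact_mod_cast this.trans (by omega)
  · rw [legendrePoly, Polynomial.coeff_C_mul, Polynomial.coeff_iterate_derivative]
    have h1 : (((1 : Polynomial ℝ) - Polynomial.X ^ 2) ^ n).coeff (n + n) = (-1) ^ n := by
      have : n + n = (((1 : Polynomial ℝ) - Polynomial.X ^ 2) ^ n).natDegree := by rw [hdeg]; ring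
      rw [this, Polynomial.coeff_natDegree, Polynomial.leadingCoeff_pow, hl]
    rw [h1]
    refine mul_ne_zero hc ?_
    rw [nsmul_eq_mul]
    refine mul_ne_zero ?_ (pow_ne_zero _ (by norm_num))
    exact_mod_cast (Nat.descFactorial_pos.mpr (by omega)).ne'

/-- The Legendre polynomials as a sequence of polynomials of degrees `0, 1, 2, …`. -/
def legendreSequence : Polynomial.Sequence ℝ := ⟨legendrePoly, degree_legendrePoly⟩

theorem mem_span_legendrePoly {m : ℕ} {g : Polynomial ℝ} (hg : g.natDegree ≤ m) :
    g ∈ Submodule.span ℝ (legendrePoly '' Set.Iio (m + 1)) := by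
  have h := legendreSequence.span_degreeLT (m := m + 1) fun i _ =>
    (Polynomial.leadingCoeff_ne_zero.mpr (legendreSequence.ne_zero i)).isUnit
  change Submodule.span ℝ (legendrePoly '' Set.Iio (m + 1)) = _ at h
  rw [h, Polynomial.mem_degreeLT]
  refine Polynomial.degree_le_natDegree.trans_lt ?_
  exact_mod_cast Nat.lt_succ_of_le hg

theorem Polynomial.exists_antiderivative (P : Polynomial ℝ) (z : ℝ) :
    ∃ G : Polynomial ℝ, Polynomial.derivative G = P ∧ G.eval z = 0 ∧
      G.natDegree ≤ P.natDegree + 1 := by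
  let G₀ : Polynomial ℝ := ∑ n ∈ Finset.range (P.natDegree + 1),
    Polynomial.monomial (n + 1) (P.coeff n / (n + 1))
  have h0 : Polynomial.derivative G₀ = P := by
    conv_rhs => rw [P.as_sum_range]
    simp only [G₀, map_sum, Polynomial.derivative_monomial]
    refine Finset.sum_congr rfl fun n _ => ?_
    have : (n : ℝ) + 1 ≠ 0 := by positivity
    simp [div_mul_cancel₀ _ this]
  have hd : G₀.natDegree ≤ P.natDegree + 1 := by
    refine Polynomial.natDegree_sum_le_of_forall_le _ _ fun n hn => ?_
    refine (Polynomial.natDegree_monomial_le _).trans ?_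
    have := Finset.mem_range.mp hn
    omega
  refine ⟨G₀ - Polynomial.C (G₀.eval z), by simp [h0], by simp, ?_⟩
  rwa [Polynomial.natDegree_sub_C]

theorem Polynomial.exists_iterated_antiderivative (P : Polynomial ℝ) (z : ℝ) (n : ℕ) :
    ∃ G : Polynomial ℝ, (Polynomial.derivative)^[n] G = P ∧
      (∀ i < n, ((Polynomial.derivative)^[i] G).eval z = 0) ∧
      G.natDegree ≤ P.natDegree + n := by
  induction n with
  | zero => exact ⟨P, rfl, by simp, le_rfl⟩
  | succ n ih =>
    obtain ⟨G, h1, h2, h3⟩ := ih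
    obtain ⟨H, e1, e2, e3⟩ := G.exists_antiderivative z
    refine ⟨H, ?_, ?_, by omega⟩
    · rw [Function.iterate_succ_apply, e1, h1]
    · intro i hi
      rcases i with _ | i
      · exact e2
      · rw [Function.iterate_succ_apply, e1]
        exact h2 i (by omega)

/-- Repeated integration by parts: boundary terms vanish at `z` by hypothesis and at `z'` because of
the power of `x - z'`. Only the last integration leaves a value at `z'`. -/
theorem Polynomial.integral_sub_pow_mul_iterate_derivative (F : Polynomial ℝ) (z z' : ℝ) (j : ℕ)
    (hF : ∀ i ≤ j, ((Polynomial.derivative)^[i] F).eval z = 0) :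
    ∫ x in z..z', (x - z') ^ j * ((Polynomial.derivative)^[j + 1] F).eval x =
      (-1) ^ j * j.factorial * F.eval z' := by
  induction j with
  | zero =>
    simp only [pow_zero, one_mul, zero_add, Function.iterate_one, Nat.factorial_zero, Nat.cast_one]
    rw [intervalIntegral.integral_eq_sub_of_hasDerivAt (fun x _ => F.hasDerivAt x)
      ((Polynomial.continuous _).intervalIntegrable _ _)]
    have := hF 0 le_rfl
    simp only [Function.iterate_zero, id] at this
    rw [this, sub_zero]
  | succ j ih =>
    have h1 : ∀ x ∈ Set.uIcc z z', HasDerivAt (fun x : ℝ => (x - z') ^ (j + 1))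
        (((j : ℝ) + 1) * (x - z') ^ j) x := by
      intro x _
      have := ((hasDerivAt_id x).sub_const z').pow (j + 1)
      simpa using! this
    have h2 : ∀ x ∈ Set.uIcc z z',
        HasDerivAt (fun x => ((Polynomial.derivative)^[j + 1] F).eval x)
          (((Polynomial.derivative)^[j + 1 + 1] F).eval x) x := by
      intro x _
      rw [Function.iterate_succ_apply' _ (j + 1)]
      exact Polynomial.hasDerivAt _ x
    rw [intervalIntegral.integral_mul_deriv_eq_deriv_mul h1 h2
      (by apply Continuous.intervalIntegrable; fun_prop)
      ((Polynomial.continuous _).intervalIntegrable _ _)]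
    simp only [mul_assoc, intervalIntegral.integral_const_mul]
    rw [ih fun i hi => hF i (by omega), hF (j + 1) le_rfl, sub_self, Nat.factorial_succ]
    push_cast
    ring

/-- Let `Φ` be the `(m + 1)`-fold antiderivative of `P` vanishing to order `m + 1` at the first
node. Testing with powers of `x - z r.succ` carries this vanishing from each node to the next. Then
`Φ` has `4 * (m + 1)` zeros with multiplicity, while its degree is below `3 * (m + 1) + (m + 1)`. -/
theorem Polynomial.eq_zero_of_integral_mul_eq_zero {m : ℕ} {P : Polynomial ℝ}
    (hP : P.natDegree < 3 * (m + 1)) {z : Fin 4 → ℝ} (hz : StrictMono z)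
    (h : ∀ r : Fin 3, ∀ g : Polynomial ℝ, g.natDegree ≤ m →
      ∫ x in z r.castSucc..z r.succ, g.eval x * P.eval x = 0) : P = 0 := by
  obtain ⟨Φ, h1, h2, h3⟩ := P.exists_iterated_antiderivative (z 0) (m + 1)
  have hroot : ∀ r : Fin 4, ∀ i ≤ m, ((Polynomial.derivative)^[i] Φ).eval (z r) = 0 := by
    intro r
    induction r using Fin.induction with
    | zero => exact fun i hi => h2 i (by omega)
    | succ r ih =>
      intro i hi
      have key := Polynomial.integral_sub_pow_mul_iterate_derivative
        ((Polynomial.derivative)^[i] Φ) (z r.castSucc) (z r.succ) (m - i) (fun l hl => by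
          rw [← Function.iterate_add_apply]
          exact ih _ (by omega))
      rw [← Function.iterate_add_apply, show m - i + 1 + i = m + 1 by omega, h1] at key
      -- The exponent `m - i` isolates the `i`-th derivative of `Φ` at the right end point.
      have hg := h r ((Polynomial.X - Polynomial.C (z r.succ)) ^ (m - i)) (by
        rw [Polynomial.natDegree_pow, Polynomial.natDegree_X_sub_C]; omega)
      simp only [Polynomial.eval_pow, Polynomial.eval_sub, Polynomial.eval_X,
        Polynomial.eval_C] at hg
      rw [hg] at key
      have hne : (-1 : ℝ) ^ (m - i) * ((m - i).factorial : ℝ) ≠ 0 :=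
        mul_ne_zero (pow_ne_zero _ (by norm_num)) (by positivity)
      exact (mul_eq_zero.mp key.symm).resolve_left hne
  by_cases hΦ : Φ = 0
  · rw [← h1, hΦ, Polynomial.iterate_derivative_zero]
  exfalso
  have hdvd : ∏ r : Fin 4, (Polynomial.X - Polynomial.C (z r)) ^ (m + 1) ∣ Φ := by
    refine Finset.prod_dvd_of_coprime ?_ fun r _ => ?_
    · intro r _ s _ hrs
      exact (Polynomial.isCoprime_X_sub_C_of_isUnit_sub
        (sub_ne_zero.mpr (hz.injective.ne hrs)).isUnit).pow
    · rw [← Polynomial.le_rootMultiplicity_iff hΦ]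
      exact (Polynomial.lt_rootMultiplicity_iff_isRoot_iterate_derivative hΦ).mpr (hroot r)
  have hdeg := Polynomial.natDegree_le_of_dvd hdvd hΦ
  rw [Polynomial.natDegree_prod_of_monic _ _ fun r _ =>
    (Polynomial.monic_X_sub_C (z r)).pow (m + 1)] at hdeg
  simp only [Polynomial.natDegree_pow, Polynomial.natDegree_X_sub_C, mul_one, Finset.sum_const,
    Finset.card_univ, Fintype.card_fin, smul_eq_mul] at hdeg
  omega

/-! ### The moment matrix of three adjacent intervals and its uniformly bounded left inverse. -/

/-- The `n`-th Legendre moment of the monomial `x ^ b` on the interval with midpoint `ζ` and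
length `l`. -/
def monomialMoment (ζ l : ℝ) (n b : ℕ) : ℝ :=
  (2 * (n : ℝ) + 1) / 2 * ∫ t in (-1 : ℝ)..1, (legendrePoly n).eval t * (ζ + t * (l / 2)) ^ b

/-- Midpoint of the `r`-th of three adjacent intervals of lengths `a 0`, `a 1`, `a 2`, the first
of which starts at `0`. -/
def stencilCenter (a : Fin 3 → ℝ) (r : Fin 3) : ℝ := (∑ s ∈ Finset.Iio r, a s) + a r / 2

/-- End points of three adjacent intervals of lengths `a 0`, `a 1`, `a 2`, starting at `0`. -/
def stencilNode (a : Fin 3 → ℝ) (r : Fin 4) : ℝ := ∑ s with s.castSucc < r, a s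

theorem stencilNode_succ (a : Fin 3 → ℝ) (r : Fin 3) :
    stencilNode a r.succ = stencilNode a r.castSucc + a r := by
  unfold stencilNode
  fin_cases r <;> simp [Finset.sum_filter, Fin.sum_univ_three, Fin.lt_def]

theorem stencilCenter_eq (a : Fin 3 → ℝ) (r : Fin 3) :
    stencilCenter a r = stencilNode a r.castSucc + a r / 2 := by
  unfold stencilCenter stencilNode
  congr 2
  ext s
  simp

theorem continuous_monomialMoment (n b : ℕ) :
    Continuous fun p : ℝ × ℝ => monomialMoment p.1 p.2 n b := by
  unfold monomialMoment
  refine continuous_const.mul ?_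
  refine intervalIntegral.continuous_parametric_intervalIntegral_of_continuous'
    (f := fun (p : ℝ × ℝ) t => (legendrePoly n).eval t * (p.1 + t * (p.2 / 2)) ^ b) ?_ _ _
  simp only [Function.uncurry_def]
  exact ((Polynomial.continuous _).comp continuous_snd).mul (by fun_prop)

/-- The matrix of the Legendre moments of the monomials on three adjacent intervals. -/
def momentMatrix (m k : ℕ) (a : Fin 3 → ℝ) : Matrix (Fin 3 × Fin (m + 1)) (Fin (k + 1)) ℝ :=
  fun p b => monomialMoment (stencilCenter a p.1) (a p.1) p.2 b

/-- A coefficient vector in the kernel is a polynomial orthogonal, on each of the three intervals,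
to the Legendre polynomials up to degree `m`. These span all polynomials of degree at most `m`, so
the zero count applies. -/
theorem momentMatrix_mulVec_injective {m k : ℕ} (hkm : k + 1 ≤ 3 * (m + 1)) {a : Fin 3 → ℝ}
    (ha : ∀ r, 0 < a r) {c : Fin (k + 1) → ℝ} (hc : (momentMatrix m k a).mulVec c = 0) : c = 0 := by
  let P : Polynomial ℝ := ∑ b : Fin (k + 1), Polynomial.monomial b (c b)
  have hPeval : ∀ x, P.eval x = ∑ b : Fin (k + 1), c b * x ^ (b : ℕ) := fun x => by
    simp [P, Polynomial.eval_finsetSum]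
  have hdeg : P.natDegree < 3 * (m + 1) := by
    refine lt_of_le_of_lt (Polynomial.natDegree_sum_le_of_forall_le (n := k) _ _ fun b _ => ?_) hkm
    exact (Polynomial.natDegree_monomial_le _).trans (by omega)
  have hleg : ∀ (r : Fin 3) (n : ℕ), n < m + 1 →
      ∫ t in (-1 : ℝ)..1, (legendrePoly n).eval t * P.eval (stencilCenter a r + t * (a r / 2)) = 0 := by
    intro r n hn
    have h := congrFun hc (r, ⟨n, hn⟩)
    simp only [Matrix.mulVec, dotProduct, momentMatrix, monomialMoment, Pi.zero_apply] at h
    have hfac : (2 * (n : ℝ) + 1) / 2 * ∫ t in (-1 : ℝ)..1, (legendrePoly n).eval t *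
        P.eval (stencilCenter a r + t * (a r / 2)) = 0 := by
      rw [← h]
      simp only [hPeval, Finset.mul_sum]
      rw [intervalIntegral.integral_finsetSum, Finset.mul_sum]
      · refine Finset.sum_congr rfl fun b _ => ?_
        rw [mul_assoc, ← intervalIntegral.integral_mul_const]
        congr 2
        funext t
        ring
      · intro b _
        apply Continuous.intervalIntegrable
        exact (Polynomial.continuous _).mul (by fun_prop)
    exact (mul_eq_zero.mp hfac).resolve_left (by positivity)
  have hall : ∀ (r : Fin 3) (g : Polynomial ℝ), g.natDegree ≤ m →
      ∫ t in (-1 : ℝ)..1, g.eval t * P.eval (stencilCenter a r + t * (a r / 2)) = 0 := by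
    intro r g hg
    have hPc : Continuous fun t : ℝ => P.eval (stencilCenter a r + t * (a r / 2)) :=
      P.continuous.comp (by fun_prop)
    have hmem := mem_span_legendrePoly hg
    clear hg
    induction hmem using Submodule.span_induction with
    | mem g hg =>
      obtain ⟨n, hn, rfl⟩ := hg
      exact hleg r n hn
    | zero => simp
    | add f g _ _ hf hg =>
      simp only [Polynomial.eval_add, add_mul]
      have hint : ∀ g : Polynomial ℝ, IntervalIntegrable
          (fun t => g.eval t * P.eval (stencilCenter a r + t * (a r / 2))) volume (-1) 1 :=
        fun g => (g.continuous.mul hPc).intervalIntegrable _ _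
      rw [intervalIntegral.integral_add (hint f) (hint g), hf, hg, add_zero]
    | smul s f _ hf =>
      simp only [Polynomial.eval_smul, smul_eq_mul, mul_assoc]
      rw [intervalIntegral.integral_const_mul, hf, mul_zero]
  have hz : StrictMono (stencilNode a) := by
    refine Fin.strictMono_iff_lt_succ.mpr fun r => ?_
    rw [stencilNode_succ]
    linarith [ha r]
  have hP0 : P = 0 := by
    refine Polynomial.eq_zero_of_integral_mul_eq_zero hdeg hz fun r g hg => ?_
    have hne : a r / 2 ≠ 0 := by linarith [ha r] |> fun h : 0 < a r / 2 => h.ne'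
    have hsub := intervalIntegral.integral_comp_mul_add (a := -1) (b := 1)
      (fun x => g.eval x * P.eval x) hne (stencilCenter a r)
    have e1 : a r / 2 * (-1) + stencilCenter a r = stencilNode a r.castSucc := by
      rw [stencilCenter_eq]; ring
    have e2 : a r / 2 * 1 + stencilCenter a r = stencilNode a r.succ := by
      rw [stencilCenter_eq, stencilNode_succ]; ring
    rw [e1, e2] at hsub
    have hcomp := hall r (g.comp (Polynomial.C (stencilCenter a r) +
      Polynomial.X * Polynomial.C (a r / 2))) (by
        refine Polynomial.natDegree_comp_le.trans ?_
        have : (Polynomial.C (stencilCenter a r) +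
            Polynomial.X * Polynomial.C (a r / 2)).natDegree ≤ 1 := by compute_degree
        calc _ ≤ g.natDegree * 1 := Nat.mul_le_mul_left _ this
          _ ≤ m := by omega)
    have hfun : (fun t : ℝ => g.eval (a r / 2 * t + stencilCenter a r) *
        P.eval (a r / 2 * t + stencilCenter a r)) = fun t : ℝ =>
        (g.comp (Polynomial.C (stencilCenter a r) + Polynomial.X * Polynomial.C (a r / 2))).eval t *
          P.eval (stencilCenter a r + t * (a r / 2)) := by
      funext t
      simp only [Polynomial.eval_comp, Polynomial.eval_add, Polynomial.eval_C, Polynomial.eval_mul,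
        Polynomial.eval_X]
      rw [show a r / 2 * t + stencilCenter a r = stencilCenter a r + t * (a r / 2) by ring]
    rw [hfun, hcomp] at hsub
    exact (smul_eq_zero.mp hsub.symm).resolve_left (inv_ne_zero hne)
  funext b
  have := congrArg (fun Q : Polynomial ℝ => Q.coeff b) hP0
  simpa [P, Polynomial.finsetSum_coeff, Polynomial.coeff_monomial, Fin.val_inj] using this

/-- Uniformly bounded weights that recover the coefficients of a polynomial from its Legendre
moments on three adjacent intervals of comparable lengths. -/
theorem exists_bounded_moment_weights {m k : ℕ} (hkm : k + 1 ≤ 3 * (m + 1)) {γ : ℝ} (hγ : 0 < γ) :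
    ∃ C : ℝ, 0 < C ∧ ∀ a : Fin 3 → ℝ, (∀ r, γ⁻¹ ≤ a r ∧ a r ≤ 1) →
      ∃ W : Fin (k + 1) → Fin 3 × Fin (m + 1) → ℝ, (∀ β p, |W β p| ≤ C) ∧
        ∀ β b : Fin (k + 1), ∑ p, W β p *
          monomialMoment (stencilCenter a p.1) (a p.1) p.2 b = if β = b then 1 else 0 := by
  let K : Set (Fin 3 → ℝ) := Set.univ.pi fun _ => Set.Icc γ⁻¹ 1
  have hK : IsCompact K := isCompact_univ_pi fun _ => isCompact_Icc
  let M := momentMatrix m k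
  have hM : Continuous M := by
    refine continuous_matrix fun p b => ?_
    exact (continuous_monomialMoment p.2 b).comp
      ((by unfold stencilCenter; fun_prop : Continuous fun a : Fin 3 → ℝ =>
        stencilCenter a p.1).prodMk (continuous_apply p.1))
  -- The moment matrix may have more rows than columns, so its left inverse is formed as
  -- `(MᵀM)⁻¹Mᵀ`. Written with the adjugate, it is visibly continuous in the lengths wherever the
  -- determinant is nonzero, hence bounded on the compact set `K`.
  let G : (Fin 3 → ℝ) → Matrix (Fin (k + 1)) (Fin (k + 1)) ℝ := fun a => (M a).transpose * M a
  have hG : Continuous G := hM.matrix_transpose.matrix_mul hM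
  have hdet : ∀ a ∈ K, (G a).det ≠ 0 := by
    intro a ha h0
    obtain ⟨c, hc, hc0⟩ := Matrix.exists_mulVec_eq_zero_iff.mpr h0
    have h1 : (M a).mulVec c = 0 := by
      rw [← Matrix.conjTranspose_mul_self_mulVec_eq_zero, Matrix.conjTranspose_eq_transpose_of_trivial]
      exact hc0
    exact hc (momentMatrix_mulVec_injective hkm
      (fun r => (inv_pos.mpr hγ).trans_le (ha r trivial).1) h1)
  let W : (Fin 3 → ℝ) → Matrix (Fin (k + 1)) (Fin 3 × Fin (m + 1)) ℝ := fun a =>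
    (G a).det⁻¹ • ((G a).adjugate * (M a).transpose)
  have hWM : ∀ a ∈ K, W a * M a = 1 := by
    intro a ha
    simp only [W, Matrix.smul_mul, Matrix.mul_assoc]
    change (G a).det⁻¹ • ((G a).adjugate * G a) = 1
    rw [Matrix.adjugate_mul, smul_smul, inv_mul_cancel₀ (hdet a ha), one_smul]
  have hWc : ContinuousOn W K :=
    (hG.matrix_det.continuousOn.inv₀ hdet).smul
      (hG.matrix_adjugate.matrix_mul hM.matrix_transpose).continuousOn
  have hbound : ∀ β p, ∃ C : ℝ, ∀ a ∈ K, |W a β p| ≤ C := by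
    intro β p
    have hc : ContinuousOn (fun a => W a β p) K :=
      (continuous_apply_apply β p).comp_continuousOn hWc
    obtain ⟨C, hC⟩ := hK.exists_bound_of_continuousOn hc
    exact ⟨C, hC⟩
  choose C hC using hbound
  refine ⟨1 + ∑ β, ∑ p, |C β p|, by positivity, fun a ha => ?_⟩
  have haK : a ∈ K := fun r _ => ha r
  refine ⟨W a, fun β p => ?_, fun β b => ?_⟩
  · refine ((hC β p a haK).trans (le_abs_self _)).trans ?_
    have h1 : |C β p| ≤ ∑ p, |C β p| :=
      Finset.single_le_sum (f := fun p => |C β p|) (fun _ _ => abs_nonneg _) (Finset.mem_univ p)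
    have h2 : ∑ p, |C β p| ≤ ∑ β, ∑ p, |C β p| :=
      Finset.single_le_sum (f := fun β => ∑ p, |C β p|)
        (fun _ _ => Finset.sum_nonneg fun _ _ => abs_nonneg _) (Finset.mem_univ β)
    linarith
  · have := congrFun (congrFun (hWM a haK) β) b
    rw [Matrix.mul_apply, Matrix.one_apply] at this
    exact this

end
noncomputable section

/-! ### Geometry of meshes and stencils -/

namespace RectMesh

variable {d : ℕ} (T : RectMesh d)

theorem emod_toNat_lt (i : Fin d) (j : ℤ) : (j % (T.N i : ℤ)).toNat < T.N i := by
  have hN : (0 : ℤ) < (T.N i : ℤ) := by exact_mod_cast T.N_pos i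
  have h1 := Int.emod_nonneg j hN.ne'
  have h2 := Int.emod_lt_of_pos j hN
  omega

/-- Without the wrap-around: the right end of the last element of a period is the last node of that
period, which coincides with the first node of the next one. -/
theorem extNode_succ (i : Fin d) (j : ℤ) :
    T.extNode i (j + 1) = T.node i ⟨(j % (T.N i : ℤ)).toNat + 1, by
      have := T.emod_toNat_lt i j; omega⟩ +
      ((j / (T.N i : ℤ) : ℤ) : ℝ) * (T.node i (Fin.last (T.N i)) - T.node i 0) := by
  have hN : (0 : ℤ) < (T.N i : ℤ) := by exact_mod_cast T.N_pos i
  have h1 := Int.emod_nonneg j hN.ne'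
  have h2 := Int.emod_lt_of_pos j hN
  have h3 := Int.mul_ediv_add_emod j (T.N i)
  unfold extNode
  by_cases hlast : j % (T.N i : ℤ) + 1 = T.N i
  · have e : j + 1 = (j / (T.N i : ℤ) + 1) * (T.N i : ℤ) := by linear_combination -h3 + hlast
    have e1 : (j + 1) % (T.N i : ℤ) = 0 := by rw [e]; exact Int.mul_emod_left _ _
    have e2 : (j + 1) / (T.N i : ℤ) = j / (T.N i : ℤ) + 1 := by
      conv_lhs => rw [e]
      exact Int.mul_ediv_cancel _ hN.ne'
    simp only [e1, e2]
    have e3 : (⟨(j % (T.N i : ℤ)).toNat + 1, by have := T.emod_toNat_lt i j; omega⟩ :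
        Fin (T.N i + 1)) = Fin.last (T.N i) := by
      ext; simp; omega
    rw [e3]
    have e4 : (⟨Int.toNat 0, by simp⟩ : Fin (T.N i + 1)) = 0 := rfl
    rw [e4]
    push_cast
    ring
  · have e : j + 1 = (j % (T.N i : ℤ) + 1) + (T.N i : ℤ) * (j / (T.N i : ℤ)) := by
      linear_combination -h3
    have e1 : (j + 1) % (T.N i : ℤ) = j % (T.N i : ℤ) + 1 := by
      conv_lhs => rw [e]
      rw [Int.add_mul_emod_self_left]
      exact Int.emod_eq_of_lt (by omega) (by omega)
    have e2 : (j + 1) / (T.N i : ℤ) = j / (T.N i : ℤ) := by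
      conv_lhs => rw [e]
      rw [Int.add_mul_ediv_left _ _ hN.ne', Int.ediv_eq_zero_of_lt (by omega) (by omega), zero_add]
    have e3 : ((j + 1) % (T.N i : ℤ)).toNat = (j % (T.N i : ℤ)).toNat + 1 := by omega
    simp only [e2, e3]

theorem width_eq (i : Fin d) (j : ℤ) :
    T.width i j = T.node i ⟨(j % (T.N i : ℤ)).toNat + 1, by
      have := T.emod_toNat_lt i j; omega⟩ - T.node i ⟨(j % (T.N i : ℤ)).toNat, by
      have := T.emod_toNat_lt i j; omega⟩ := by
  rw [width, extNode_succ, extNode]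
  ring

theorem width_pos (i : Fin d) (j : ℤ) : 0 < T.width i j := by
  rw [width_eq, sub_pos]
  exact T.node_strictMono i (by simp [Fin.lt_def])

/-- Every element of the periodic extension has the length of an element of the mesh, so the size
bounds hold for all integer indices. -/
theorem width_emod (i : Fin d) (j : ℤ) :
    T.width i (((⟨(j % (T.N i : ℤ)).toNat, T.emod_toNat_lt i j⟩ : Fin (T.N i)) : ℕ) : ℤ) =
      T.width i j := by
  have hN : (0 : ℤ) < (T.N i : ℤ) := by exact_mod_cast T.N_pos i
  have h1 := Int.emod_nonneg j hN.ne'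
  have e : (((j % (T.N i : ℤ)).toNat : ℤ) % (T.N i : ℤ)).toNat = (j % (T.N i : ℤ)).toNat := by
    rw [Int.toNat_of_nonneg h1, Int.emod_emod]
  rw [width_eq, width_eq]
  simp only [e]

theorem width_le_maxSize (i : Fin d) (j : ℤ) : T.width i j ≤ T.maxSize := by
  rw [← width_emod]
  exact le_ciSup (f := fun p : (Σ i : Fin d, Fin (T.N i)) => T.width p.1 ((p.2 : ℕ) : ℤ))
    (Set.finite_range _).bddAbove ⟨i, ⟨_, T.emod_toNat_lt i j⟩⟩

theorem minSize_le_width (i : Fin d) (j : ℤ) : T.minSize ≤ T.width i j := by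
  rw [← width_emod]
  exact ciInf_le (f := fun p : (Σ i : Fin d, Fin (T.N i)) => T.width p.1 ((p.2 : ℕ) : ℤ))
    (Set.finite_range _).bddBelow ⟨i, ⟨_, T.emod_toNat_lt i j⟩⟩

theorem maxSize_pos (i : Fin d) : 0 < T.maxSize :=
  (T.width_pos i 0).trans_le (T.width_le_maxSize i 0)

theorem extNode_add_one (i : Fin d) (j : ℤ) : T.extNode i (j + 1) = T.extNode i j + T.width i j := by
  rw [width]; ring

theorem extNode_strictMono (i : Fin d) : StrictMono (T.extNode i) :=
  strictMono_int_of_lt_succ fun j => by linarith [T.extNode_add_one i j, T.width_pos i j]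

theorem center_eq (i : Fin d) (j : ℤ) : T.center i j = T.extNode i j + T.width i j / 2 := by
  rw [center, width]; ring

/-- The multi-index of the `r`-th element of a stencil that starts at `s`. -/
def stencilIndex (s : Fin d → ℤ) (r : Fin d → Fin 3) : Fin d → ℤ := fun i => s i + ((r i : ℕ) : ℤ)

/-- Centred or biased, a stencil consists of three consecutive integers, one of which is `j`. From
here on only its starting index `s` matters and the boundary kinds play no role. -/
theorem exists_stencil1_start (i : Fin d) (j : Fin (T.N i)) :
    ∃ s : ℤ, (∀ n, n ∈ T.stencil1 i j ↔ ∃ r : Fin 3, n = s + ((r : ℕ) : ℤ)) ∧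
      ∃ r : Fin 3, ((j : ℕ) : ℤ) = s + ((r : ℕ) : ℤ) := by
  have h3 : ∀ s n : ℤ, (n = s ∨ n = s + 1 ∨ n = s + 2) ↔ ∃ r : Fin 3, n = s + ((r : ℕ) : ℤ) := by
    intro s n
    simp [Fin.exists_fin_succ]
  have hj := j.2
  unfold stencil1
  split
  · refine ⟨(j : ℕ) - 1, fun n => ?_, 1, by simp⟩
    rw [← h3]
    simp only [Finset.mem_insert, Finset.mem_singleton]
    omega
  · rename_i hkind
    have hN := T.three_le i hkind
    split_ifs with h0 h1
    · refine ⟨0, fun n => ?_, 0, by simp [h0]⟩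
      rw [← h3]
      simp
    · refine ⟨(T.N i : ℤ) - 3, fun n => ?_, 2, ?_⟩
      · rw [← h3]
        simp only [Finset.mem_insert, Finset.mem_singleton]
        omega
      · change ((j : ℕ) : ℤ) = (T.N i : ℤ) - 3 + ((2 : ℕ) : ℤ)
        omega
    · refine ⟨(j : ℕ) - 1, fun n => ?_, 1, by simp⟩
      rw [← h3]
      simp only [Finset.mem_insert, Finset.mem_singleton]
      omega

theorem exists_stencil_start (θ : T.Index) :
    ∃ s : Fin d → ℤ, (∀ η, η ∈ T.stencil θ ↔ ∃ r, η = stencilIndex s r) ∧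
      ∃ r, T.toInt θ = stencilIndex s r := by
  choose s hs r hr using fun i => T.exists_stencil1_start i (θ i)
  refine ⟨s, fun η => ?_, r, funext hr⟩
  rw [stencil, Fintype.mem_piFinset]
  simp only [hs]
  constructor
  · intro h
    choose r hr using h
    exact ⟨r, funext hr⟩
  · rintro ⟨r, rfl⟩ i
    exact ⟨r i, rfl⟩

theorem Icc_extNode_add_three (i : Fin d) (s : ℤ) :
    (⋃ r : Fin 3, Set.Icc (T.extNode i (s + ((r : ℕ) : ℤ))) (T.extNode i (s + ((r : ℕ) : ℤ) + 1))) =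
      Set.Icc (T.extNode i s) (T.extNode i (s + 3)) := by
  have hm := (T.extNode_strictMono i).monotone
  ext x
  simp only [Set.mem_iUnion, Set.mem_Icc]
  constructor
  · rintro ⟨r, h1, h2⟩
    have := r.2
    exact ⟨(hm (by omega)).trans h1, h2.trans (hm (by omega))⟩
  · rintro ⟨h1, h2⟩
    rcases le_total x (T.extNode i (s + 1)) with h | h
    · exact ⟨0, by simpa using ⟨h1, h⟩⟩
    rcases le_total x (T.extNode i (s + 2)) with h' | h'
    · refine ⟨1, by simpa using h, ?_⟩
      have e : s + (((1 : Fin 3) : ℕ) : ℤ) + 1 = s + 2 := by simp; ring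
      rw [e]; exact h'
    · refine ⟨2, by simpa using h', ?_⟩
      have e : s + (((2 : Fin 3) : ℕ) : ℤ) + 1 = s + 3 := by
        change s + ((2 : ℕ) : ℤ) + 1 = s + 3
        push_cast; ring
      rw [e]; exact h2

/-- The region is a single box, hence convex, as the averaged Taylor polynomials require. -/
theorem stencilRegion_eq {θ : T.Index} {s : Fin d → ℤ}
    (hs : ∀ η, η ∈ T.stencil θ ↔ ∃ r, η = stencilIndex s r) :
    T.stencilRegion θ = Set.univ.pi fun i =>
      Set.Icc (T.extNode i (s i)) (T.extNode i (s i + 3)) := by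
  simp only [← T.Icc_extNode_add_three]
  ext x
  simp only [stencilRegion, hs, cell, Set.mem_iUnion, Set.mem_univ_pi, exists_prop]
  constructor
  · rintro ⟨η, ⟨r, rfl⟩, h⟩ i
    exact ⟨r i, h i⟩
  · intro h
    choose r hr using h
    exact ⟨_, ⟨r, rfl⟩, hr⟩

theorem cell_subset_stencilRegion {θ : T.Index} {η : Fin d → ℤ} (hη : η ∈ T.stencil θ) :
    T.cell η ⊆ T.stencilRegion θ := by
  intro x hx
  simp only [stencilRegion, Set.mem_iUnion, exists_prop]
  exact ⟨η, hη, hx⟩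

theorem isCompact_cell (η : Fin d → ℤ) : IsCompact (T.cell η) :=
  isCompact_univ_pi fun _ => isCompact_Icc

theorem volume_cell (η : Fin d → ℤ) : volume (T.cell η) = ∏ i, ENNReal.ofReal (T.width i (η i)) := by
  rw [cell, volume_pi_pi]
  simp [width]

theorem interior_pi_Icc (a b : Fin d → ℝ) :
    interior (Set.univ.pi fun i => Set.Icc (a i) (b i)) =
      Set.univ.pi fun i => Set.Ioo (a i) (b i) := by
  rw [interior_pi_set Set.finite_univ]
  simp only [interior_Icc]

theorem interior_pi_Icc_ae_eq (a b : Fin d → ℝ) :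
    interior (Set.univ.pi fun i => Set.Icc (a i) (b i)) =ᵐ[volume]
      Set.univ.pi fun i => Set.Icc (a i) (b i) := by
  rw [interior_pi_Icc, Set.pi_univ_Icc]
  exact Measure.univ_pi_Ioo_ae_eq_Icc

/-! ### Legendre moments -/

theorem continuous_legendreBasis (η : Fin d → ℤ) (α : Fin d → ℕ) :
    Continuous (T.legendreBasis η α) :=
  continuous_finsetProd _ fun i _ => (Polynomial.continuous _).comp (by fun_prop)

theorem integrableOn_legendreBasis_mul (η : Fin d → ℤ) (α : Fin d → ℕ) {f : (Fin d → ℝ) → ℝ}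
    (hf : IntegrableOn f (T.cell η)) :
    IntegrableOn (fun x => T.legendreBasis η α x * f x) (T.cell η) :=
  hf.continuousOn_mul (T.continuous_legendreBasis η α).continuousOn (T.isCompact_cell η)

theorem moment_sub {η : Fin d → ℤ} (α : Fin d → ℕ) {f g : (Fin d → ℝ) → ℝ}
    (hf : IntegrableOn f (T.cell η)) (hg : IntegrableOn g (T.cell η)) :
    T.moment η α (fun x => f x - g x) = T.moment η α f - T.moment η α g := by
  unfold moment
  simp only [mul_sub]
  rw [integral_sub (T.integrableOn_legendreBasis_mul η α hf)
    (T.integrableOn_legendreBasis_mul η α hg), mul_sub]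

theorem moment_sum {ι : Type*} (s : Finset ι) {η : Fin d → ℤ} (α : Fin d → ℕ)
    {f : ι → (Fin d → ℝ) → ℝ} (hf : ∀ j ∈ s, IntegrableOn (f j) (T.cell η)) :
    T.moment η α (fun x => ∑ j ∈ s, f j x) = ∑ j ∈ s, T.moment η α (f j) := by
  unfold moment
  simp only [Finset.mul_sum]
  rw [integral_finsetSum _ fun j hj => T.integrableOn_legendreBasis_mul η α (hf j hj),
    Finset.mul_sum]

theorem moment_const_mul (η : Fin d → ℤ) (α : Fin d → ℕ) (c : ℝ) (f : (Fin d → ℝ) → ℝ) :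
    T.moment η α (fun x => c * f x) = c * T.moment η α f := by
  unfold moment
  have : ∀ x, T.legendreBasis η α x * (c * f x) = c * (T.legendreBasis η α x * f x) :=
    fun x => by ring
  simp only [this]
  rw [integral_const_mul]
  ring

theorem integrableOn_of_continuous {η : Fin d → ℤ} {f : (Fin d → ℝ) → ℝ} (hf : Continuous f) :
    IntegrableOn f (T.cell η) := hf.continuousOn.integrableOn_compact (T.isCompact_cell η)

theorem moment_prod (η : Fin d → ℤ) (α : Fin d → ℕ) (g : Fin d → ℝ → ℝ) :
    T.moment η α (fun x => ∏ i, g i (x i)) = ∏ i, ((2 * (α i : ℝ) + 1) / T.width i (η i) *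
      ∫ x in Set.Icc (T.extNode i (η i)) (T.extNode i (η i + 1)),
        (legendrePoly (α i)).eval (2 * (x - T.center i (η i)) / T.width i (η i)) * g i x) := by
  unfold moment legendreBasis cell
  simp only [← Finset.prod_mul_distrib]
  rw [Finset.prod_mul_distrib]
  congr 1
  rw [volume_pi, Measure.restrict_pi_pi]
  exact integral_fintype_prod_eq_prod (fun i x => (legendrePoly (α i)).eval
    (2 * (x - T.center i (η i)) / T.width i (η i)) * g i x)

/-- The substitution `x = center + t * width / 2` shows that the moment depends only on positions
and lengths measured in units of `h`. -/
theorem moment_scaledMonomial_one (i : Fin d) (j : ℤ) (n b : ℕ) (X : ℝ) {h : ℝ} (hh : h ≠ 0) :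
    (2 * (n : ℝ) + 1) / T.width i j * ∫ x in Set.Icc (T.extNode i j) (T.extNode i (j + 1)),
      (legendrePoly n).eval (2 * (x - T.center i j) / T.width i j) * ((x - X) / h) ^ b =
      monomialMoment ((T.center i j - X) / h) (T.width i j / h) n b := by
  have hw := T.width_pos i j
  have hle : T.extNode i j ≤ T.extNode i (j + 1) := (T.extNode_strictMono i).monotone (by omega)
  rw [integral_Icc_eq_integral_Ioc, ← intervalIntegral.integral_of_le hle]
  have hne : T.width i j / 2 ≠ 0 := by positivity
  have hsub := intervalIntegral.integral_comp_mul_add (a := -1) (b := 1)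
    (fun x => (legendrePoly n).eval (2 * (x - T.center i j) / T.width i j) * ((x - X) / h) ^ b)
    hne (T.center i j)
  have e1 : T.width i j / 2 * (-1) + T.center i j = T.extNode i j := by rw [center_eq]; ring
  have e2 : T.width i j / 2 * 1 + T.center i j = T.extNode i (j + 1) := by
    rw [center_eq, extNode_add_one]; ring
  rw [e1, e2] at hsub
  unfold monomialMoment
  have hfun : (fun t : ℝ => (legendrePoly n).eval t *
      ((T.center i j - X) / h + t * (T.width i j / h / 2)) ^ b) =
      fun t : ℝ => (legendrePoly n).eval
        (2 * (T.width i j / 2 * t + T.center i j - T.center i j) / T.width i j) *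
        ((T.width i j / 2 * t + T.center i j - X) / h) ^ b := by
    funext t
    have a1 : 2 * (T.width i j / 2 * t + T.center i j - T.center i j) / T.width i j = t := by
      field_simp; ring
    have a2 : (T.width i j / 2 * t + T.center i j - X) / h =
        (T.center i j - X) / h + t * (T.width i j / h / 2) := by
      field_simp; ring
    rw [a1, a2]
  rw [hfun, hsub, smul_eq_mul, ← mul_assoc]
  congr 1
  field_simp

theorem moment_scaledMonomial (η : Fin d → ℤ) (α b : Fin d → ℕ) (X : Fin d → ℝ) {h : ℝ}
    (hh : h ≠ 0) :
    T.moment η α (fun x => ∏ i, ((x i - X i) / h) ^ b i) =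
      ∏ i, monomialMoment ((T.center i (η i) - X i) / h) (T.width i (η i) / h) (α i) (b i) := by
  rw [T.moment_prod η α fun i x => ((x - X i) / h) ^ b i]
  exact Finset.prod_congr rfl fun i _ => T.moment_scaledMonomial_one i (η i) (α i) (b i) (X i) hh

end RectMesh

end
noncomputable section

/-! ### Polynomials of bounded degree in each variable -/

theorem finrank_QPoly (d k : ℕ) : Module.finrank ℝ (QPoly d k) = (k + 1) ^ d := by
  let b : Module.Basis {n : Fin d →₀ ℕ | ∀ i, n i ≤ k} ℝ (QPoly d k) :=
    MvPolynomial.basisRestrictSupport ℝ {n : Fin d →₀ ℕ | ∀ i, n i ≤ k}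
  let e : {n : Fin d →₀ ℕ | ∀ i, n i ≤ k} ≃ (Fin d → Fin (k + 1)) :=
    { toFun := fun n i => ⟨n.1 i, Nat.lt_succ_of_le (n.2 i)⟩
      invFun := fun f => ⟨Finsupp.equivFunOnFinite.symm fun i => (f i : ℕ),
        fun i => Nat.le_of_lt_succ (f i).2⟩
      left_inv := fun n => by ext i; simp
      right_inv := fun f => by ext i; simp }
  rw [Module.finrank_eq_nat_card_basis b, Nat.card_congr e]
  simp

theorem add_mul_pow_eq_sum {n k : ℕ} (hn : n ≤ k) (X h ξ : ℝ) :
    (X + h * ξ) ^ n = ∑ b : Fin (k + 1), (h ^ (b : ℕ) * X ^ (n - b) * n.choose b) * ξ ^ (b : ℕ) := by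
  rw [add_comm, add_pow, Fin.sum_univ_eq_sum_range
    (fun b : ℕ => (h ^ b * X ^ (n - b) * n.choose b) * ξ ^ b) (k + 1)]
  rw [← Finset.sum_subset (Finset.range_subset_range.mpr (Nat.succ_le_succ hn))]
  · refine Finset.sum_congr rfl fun b _ => ?_
    rw [mul_pow]; ring
  · intro b _ hb
    rw [Nat.choose_eq_zero_of_lt (by simpa using hb)]
    simp

/-- Expansion of a polynomial in shifted and scaled monomials. -/
theorem exists_scaledMonomial_expansion {d k : ℕ} {w : MvPolynomial (Fin d) ℝ} (hw : w ∈ QPoly d k)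
    (X : Fin d → ℝ) {h : ℝ} (hh : h ≠ 0) :
    ∃ c : (Fin d → Fin (k + 1)) → ℝ, ∀ x, MvPolynomial.eval x w =
      ∑ b, c b * ∏ i, ((x i - X i) / h) ^ (b i : ℕ) := by
  rw [QPoly, MvPolynomial.restrictDegree, MvPolynomial.restrictSupport_eq_span] at hw
  induction hw using Submodule.span_induction with
  | mem w hw =>
    obtain ⟨n, hn, rfl⟩ := hw
    refine ⟨fun b => ∏ i, (h ^ (b i : ℕ) * X i ^ (n i - b i) * (n i).choose (b i)), fun x => ?_⟩
    have h1 : MvPolynomial.eval x (MvPolynomial.monomial n (1 : ℝ)) = ∏ i, x i ^ n i := by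
      rw [MvPolynomial.eval_monomial, one_mul, Finsupp.prod_fintype _ _ (by simp)]
    rw [h1]
    have h2 : ∀ i, x i ^ n i = ∑ b : Fin (k + 1), (h ^ (b : ℕ) * X i ^ (n i - b) *
        (n i).choose b) * ((x i - X i) / h) ^ (b : ℕ) := by
      intro i
      rw [← add_mul_pow_eq_sum (hn i) (X i) h]
      congr 1
      field_simp
      ring
    simp only [h2, ← Finset.prod_mul_distrib]
    rw [Finset.prod_univ_sum, Fintype.piFinset_univ]
  | zero => exact ⟨0, fun x => by simp⟩
  | add w w' _ _ hw hw' =>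
    obtain ⟨c, hc⟩ := hw
    obtain ⟨c', hc'⟩ := hw'
    refine ⟨c + c', fun x => ?_⟩
    rw [map_add, hc, hc', ← Finset.sum_add_distrib]
    exact Finset.sum_congr rfl fun b _ => by rw [Pi.add_apply]; ring
  | smul r w _ hw =>
    obtain ⟨c, hc⟩ := hw
    refine ⟨r • c, fun x => ?_⟩
    rw [MvPolynomial.smul_eval, hc, Finset.mul_sum]
    exact Finset.sum_congr rfl fun b _ => by rw [Pi.smul_apply, smul_eq_mul]; ring

/-- The bound 3 is the width of a stencil in units of the maximal mesh size. -/
theorem abs_pow_le_three_pow {ξ : ℝ} (hξ : |ξ| ≤ 3) {n k : ℕ} (hn : n ≤ k) : |ξ ^ n| ≤ 3 ^ k := by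
  rw [abs_pow]
  exact (pow_le_pow_left₀ (abs_nonneg _) hξ n).trans (pow_le_pow_right₀ (by norm_num) hn)

theorem abs_scaledMonomial_le {d k : ℕ} (b : Fin d → Fin (k + 1)) {ξ : Fin d → ℝ}
    (hξ : ∀ i, |ξ i| ≤ 3) : |∏ i, ξ i ^ (b i : ℕ)| ≤ (3 ^ k) ^ d := by
  rw [Finset.abs_prod]
  calc ∏ i, |ξ i ^ (b i : ℕ)| ≤ ∏ _i : Fin d, (3 : ℝ) ^ k :=
        Finset.prod_le_prod (fun _ _ => abs_nonneg _) fun i _ =>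
          abs_pow_le_three_pow (hξ i) (Nat.le_of_lt_succ (b i).2)
    _ = (3 ^ k) ^ d := by simp

theorem abs_partialDeriv_scaledMonomial_le {d k : ℕ} (b : Fin d → Fin (k + 1)) (X : Fin d → ℝ)
    {h : ℝ} (hh : 0 < h) {x : Fin d → ℝ} (hξ : ∀ i, |(x i - X i) / h| ≤ 3) (i : Fin d) :
    |partialDeriv i (fun x => ∏ j, ((x j - X j) / h) ^ (b j : ℕ)) x| ≤ k * (3 ^ k) ^ d / h := by
  have hder : ∀ j : Fin d, HasFDerivAt (fun x : Fin d → ℝ => ((x j - X j) / h) ^ (b j : ℕ))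
      ((((b j : ℕ) : ℝ) * ((x j - X j) / h) ^ ((b j : ℕ) - 1) / h) •
        ContinuousLinearMap.proj (R := ℝ) (φ := fun _ : Fin d => ℝ) j) x := by
    intro j
    have h1 : HasFDerivAt (fun x : Fin d → ℝ => x j)
        (ContinuousLinearMap.proj (R := ℝ) (φ := fun _ : Fin d => ℝ) j) x :=
      (ContinuousLinearMap.proj (R := ℝ) (φ := fun _ : Fin d => ℝ) j).hasFDerivAt
    have h2 : HasDerivAt (fun t : ℝ => ((t - X j) / h) ^ (b j : ℕ))
        (((b j : ℕ) : ℝ) * ((x j - X j) / h) ^ ((b j : ℕ) - 1) / h) (x j) := by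
      have := (((hasDerivAt_id (x j)).sub_const (X j)).div_const h).pow (b j : ℕ)
      refine this.congr_deriv ?_
      simp only [id]
      ring
    exact HasDerivAt.comp_hasFDerivAt (f := fun x : Fin d → ℝ => x j) x h2 h1
  have hprod := HasFDerivAt.finsetProd (u := Finset.univ) fun j _ => hder j
  have hval : partialDeriv i (fun x => ∏ j, ((x j - X j) / h) ^ (b j : ℕ)) x =
      (∏ j ∈ Finset.univ.erase i, ((x j - X j) / h) ^ (b j : ℕ)) *
        (((b i : ℕ) : ℝ) * ((x i - X i) / h) ^ ((b i : ℕ) - 1) / h) := by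
    rw [partialDeriv, hprod.fderiv]
    simp only [sum_apply, smul_apply,
      ContinuousLinearMap.proj_apply, smul_eq_mul, Pi.single_apply]
    rw [Finset.sum_eq_single i]
    · simp
    · intro j _ hj
      simp [hj]
    · simp
  rw [hval, abs_mul, Finset.abs_prod, abs_div, abs_mul, abs_of_pos hh, Nat.abs_cast]
  have h1 : ∏ j ∈ Finset.univ.erase i, |((x j - X j) / h) ^ (b j : ℕ)| ≤ (3 ^ k) ^ (d - 1) := by
    calc _ ≤ ∏ _j ∈ Finset.univ.erase i, (3 : ℝ) ^ k :=
          Finset.prod_le_prod (fun _ _ => abs_nonneg _) fun j _ =>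
            abs_pow_le_three_pow (hξ j) (Nat.le_of_lt_succ (b j).2)
      _ = (3 ^ k) ^ (d - 1) := by simp
  have h2 : |((x i - X i) / h) ^ ((b i : ℕ) - 1)| ≤ 3 ^ k :=
    abs_pow_le_three_pow (hξ i) (by have := (b i).2; omega)
  have h3 : ((b i : ℕ) : ℝ) ≤ k := by exact_mod_cast Nat.le_of_lt_succ (b i).2
  have hd : d - 1 + 1 = d := by have := i.2; omega
  calc _ ≤ (3 ^ k) ^ (d - 1) * (k * 3 ^ k / h) := by gcongr
    _ = k * (3 ^ k) ^ d / h := by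
        have h4 : ((3 : ℝ) ^ k) ^ d = (3 ^ k) ^ (d - 1) * 3 ^ k := by rw [← pow_succ, hd]
        rw [h4]
        ring

/-! ### Stability of the moment system -/

theorem exists_legendrePoly_bound (m : ℕ) : ∃ M : ℝ, 1 ≤ M ∧
    ∀ n ≤ m, ∀ t ∈ Set.Icc (-1 : ℝ) 1, |(legendrePoly n).eval t| ≤ M := by
  choose M hM using fun n => (isCompact_Icc (a := (-1 : ℝ)) (b := 1)).exists_bound_of_continuousOn
    (legendrePoly n).continuous.continuousOn
  refine ⟨1 + ∑ n ∈ Finset.range (m + 1), |M n|, ?_, fun n hn t ht => ?_⟩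
  · have : 0 ≤ ∑ n ∈ Finset.range (m + 1), |M n| := Finset.sum_nonneg fun _ _ => abs_nonneg _
    linarith
  · have h1 : |(legendrePoly n).eval t| ≤ M n := hM n t ht
    have h2 := Finset.single_le_sum (f := fun n => |M n|) (fun _ _ => abs_nonneg _)
      (Finset.mem_range.mpr (Nat.lt_succ_of_le hn))
    linarith [le_abs_self (M n)]

namespace RectMesh

variable {d : ℕ} (T : RectMesh d)

/-- The factor `1 / width` in each direction cancels the volume of the cell, so the constant does
not see the mesh. -/
theorem abs_moment_le {m : ℕ} {M : ℝ} (hM1 : 1 ≤ M)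
    (hM : ∀ n ≤ m, ∀ t ∈ Set.Icc (-1 : ℝ) 1, |(legendrePoly n).eval t| ≤ M)
    (η : Fin d → ℤ) {α : Fin d → ℕ} (hα : ∀ i, α i ≤ m) {f : (Fin d → ℝ) → ℝ} {ε : ℝ}
    (hf : ∀ᵐ x ∂volume.restrict (T.cell η), |f x| ≤ ε) :
    |T.moment η α f| ≤ ((2 * (m : ℝ) + 1) * M) ^ d * ε := by
  have hM0 : 0 ≤ M := zero_le_one.trans hM1
  have hcell := T.volume_cell η
  have hfin : volume (T.cell η) < ⊤ := (T.isCompact_cell η).measure_lt_top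
  have hleg : ∀ x ∈ T.cell η, |T.legendreBasis η α x| ≤ M ^ d := by
    intro x hx
    rw [legendreBasis, Finset.abs_prod]
    calc _ ≤ ∏ _i : Fin d, M := by
          refine Finset.prod_le_prod (fun _ _ => abs_nonneg _) fun i _ => hM _ (hα i) _ ?_
          have hxi : x i ∈ Set.Icc (T.extNode i (η i)) (T.extNode i (η i + 1)) := hx i trivial
          have hw := T.width_pos i (η i)
          rw [T.extNode_add_one] at hxi
          rw [T.center_eq, Set.mem_Icc, le_div_iff₀ hw, div_le_iff₀ hw]
          constructor <;> linarith [hxi.1, hxi.2]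
      _ = M ^ d := by simp
  have hbound : ‖∫ x in T.cell η, T.legendreBasis η α x * f x‖ ≤
      M ^ d * ε * volume.real (T.cell η) := by
    refine norm_setIntegral_le_of_norm_le_const_ae hfin ?_
    filter_upwards [hf, ae_restrict_mem (T.isCompact_cell η).measurableSet] with x hx hxc
    rw [Real.norm_eq_abs, abs_mul]
    exact mul_le_mul (hleg x hxc) hx (abs_nonneg _) (by positivity)
  have hvol : volume.real (T.cell η) = ∏ i, T.width i (η i) := by
    rw [Measure.real, hcell, ENNReal.toReal_prod]
    exact Finset.prod_congr rfl fun i _ => ENNReal.toReal_ofReal (T.width_pos i (η i)).le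
  have hpos : 0 < ∏ i, T.width i (η i) := Finset.prod_pos fun i _ => T.width_pos i (η i)
  -- The cell has positive volume, so the a.e. bound holds at some point, and `ε` dominates an
  -- absolute value there.
  have hε : 0 ≤ ε := by
    have hne : volume.restrict (T.cell η) ≠ 0 := by
      intro h0
      rw [Measure.restrict_eq_zero] at h0
      rw [Measure.real, h0] at hvol
      simp only [ENNReal.toReal_zero] at hvol
      linarith
    have : (ae (volume.restrict (T.cell η))).NeBot := ae_neBot.mpr hne
    obtain ⟨x, hx⟩ := hf.exists
    exact (abs_nonneg _).trans hx
  have hcoef : ∏ i, (2 * (α i : ℝ) + 1) ≤ (2 * (m : ℝ) + 1) ^ d := by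
    calc _ ≤ ∏ _i : Fin d, (2 * (m : ℝ) + 1) := by
          refine Finset.prod_le_prod (fun _ _ => by positivity) fun i _ => ?_
          have : (α i : ℝ) ≤ m := by exact_mod_cast hα i
          linarith
      _ = _ := by simp
  unfold moment
  rw [Finset.prod_div_distrib, abs_mul, abs_of_nonneg (div_nonneg
    (Finset.prod_nonneg fun _ _ => by positivity) hpos.le)]
  rw [hvol, Real.norm_eq_abs] at hbound
  calc _ ≤ (∏ i, (2 * (α i : ℝ) + 1)) / (∏ i, T.width i (η i)) *
        (M ^ d * ε * ∏ i, T.width i (η i)) :=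
        mul_le_mul_of_nonneg_left hbound (div_nonneg
          (Finset.prod_nonneg fun _ _ => by positivity) hpos.le)
    _ = (∏ i, (2 * (α i : ℝ) + 1)) * (M ^ d * ε) := by field_simp
    _ ≤ (2 * (m : ℝ) + 1) ^ d * (M ^ d * ε) := by gcongr
    _ = _ := by rw [mul_pow]; ring

theorem extNode_eq_stencilNode (i : Fin d) (s : ℤ) {h : ℝ} (r : Fin 4) :
    (T.extNode i (s + ((r : ℕ) : ℤ)) - T.extNode i s) / h =
      stencilNode (fun r : Fin 3 => T.width i (s + ((r : ℕ) : ℤ)) / h) r := by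
  induction r using Fin.induction with
  | zero => simp [stencilNode]
  | succ r ih =>
    rw [stencilNode_succ, ← ih]
    have e : s + ((r.succ : ℕ) : ℤ) = s + ((r.castSucc : ℕ) : ℤ) + 1 := by
      simp; ring
    rw [e, extNode_add_one]
    simp only [Fin.val_castSucc]
    ring

theorem center_eq_stencilCenter (i : Fin d) (s : ℤ) {h : ℝ} (r : Fin 3) :
    (T.center i (s + ((r : ℕ) : ℤ)) - T.extNode i s) / h =
      stencilCenter (fun r : Fin 3 => T.width i (s + ((r : ℕ) : ℤ)) / h) r := by
  rw [stencilCenter_eq, ← extNode_eq_stencilNode, center_eq]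
  simp only [Fin.val_castSucc]
  ring

/-- The coefficients of a polynomial are controlled by its moments, uniformly over all regular
meshes. -/
theorem exists_coefficient_bound (d : ℕ) (hd : 0 < d) {m k : ℕ} (hkm : k + 1 ≤ 3 * (m + 1)) {γ : ℝ}
    (hγ : 0 < γ) : ∃ C : ℝ, 0 < C ∧ ∀ T : RectMesh d, T.IsRegular γ → ∀ (s : Fin d → ℤ)
      (c : (Fin d → Fin (k + 1)) → ℝ) (ε : ℝ),
      (∀ r : Fin d → Fin 3, ∀ α : Fin d → ℕ, (∀ i, α i ≤ m) →
        |T.moment (stencilIndex s r) α (fun x =>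
          ∑ b, c b * ∏ i, ((x i - T.extNode i (s i)) / T.maxSize) ^ (b i : ℕ))| ≤ ε) →
      ∀ β, |c β| ≤ C * ε := by
  obtain ⟨C, hC0, hC⟩ := exists_bounded_moment_weights hkm hγ
  refine ⟨C ^ d * Fintype.card (Fin d → Fin 3 × Fin (m + 1)), by positivity, ?_⟩
  intro T hT s c ε hε β
  set h := T.maxSize with hh
  have hwidth : ∀ (i : Fin d) (r : Fin 3), γ⁻¹ ≤ T.width i (s i + ((r : ℕ) : ℤ)) / h ∧
      T.width i (s i + ((r : ℕ) : ℤ)) / h ≤ 1 := by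
    intro i r
    have hp : 0 < h := T.maxSize_pos i
    rw [div_le_one hp, le_div_iff₀ hp]
    refine ⟨?_, T.width_le_maxSize _ _⟩
    rw [inv_mul_le_iff₀ hγ]
    exact hT.trans (mul_le_mul_of_nonneg_left (T.minSize_le_width _ _) hγ.le)
  choose W hW hWδ using fun i => hC _ (hwidth i)
  have hmom : ∀ p : Fin d → Fin 3 × Fin (m + 1),
      T.moment (stencilIndex s fun i => (p i).1) (fun i => ((p i).2 : ℕ)) (fun x =>
        ∑ b, c b * ∏ i, ((x i - T.extNode i (s i)) / h) ^ (b i : ℕ)) =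
      ∑ b, c b * ∏ i, monomialMoment
        (stencilCenter (fun r : Fin 3 => T.width i (s i + ((r : ℕ) : ℤ)) / h) (p i).1)
        (T.width i (s i + (((p i).1 : ℕ) : ℤ)) / h) (p i).2 (b i) := by
    intro p
    rw [T.moment_sum _ _ fun b _ => T.integrableOn_of_continuous (by fun_prop)]
    refine Finset.sum_congr rfl fun b _ => ?_
    rw [moment_const_mul]
    congr 1
    have hp : h ≠ 0 := (T.maxSize_pos ⟨0, hd⟩).ne'
    rw [T.moment_scaledMonomial _ _ _ _ hp]
    refine Finset.prod_congr rfl fun i _ => ?_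
    rw [← center_eq_stencilCenter]
    rfl
  -- Moments of product monomials factor, so products of the one-dimensional weights form a left
  -- inverse of the tensor-product moment matrix.
  have hrec : c β = ∑ p : Fin d → Fin 3 × Fin (m + 1), (∏ i, W i (β i) (p i)) *
      T.moment (stencilIndex s fun i => (p i).1) (fun i => ((p i).2 : ℕ)) (fun x =>
        ∑ b, c b * ∏ i, ((x i - T.extNode i (s i)) / h) ^ (b i : ℕ)) := by
    simp only [hmom, Finset.mul_sum]
    rw [Finset.sum_comm]
    have hinner : ∀ b : Fin d → Fin (k + 1), ∑ p : Fin d → Fin 3 × Fin (m + 1),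
        (∏ i, W i (β i) (p i)) * (c b * ∏ i, monomialMoment
          (stencilCenter (fun r : Fin 3 => T.width i (s i + ((r : ℕ) : ℤ)) / h) (p i).1)
          (T.width i (s i + (((p i).1 : ℕ) : ℤ)) / h) (p i).2 (b i)) =
        if β = b then c b else 0 := by
      intro b
      have h1 : ∏ i, ∑ q : Fin 3 × Fin (m + 1), W i (β i) q * monomialMoment
          (stencilCenter (fun r : Fin 3 => T.width i (s i + ((r : ℕ) : ℤ)) / h) q.1)
          (T.width i (s i + ((q.1 : ℕ) : ℤ)) / h) q.2 (b i) = if β = b then 1 else 0 := by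
        have h2 : ∀ i, ∑ q : Fin 3 × Fin (m + 1), W i (β i) q * monomialMoment
            (stencilCenter (fun r : Fin 3 => T.width i (s i + ((r : ℕ) : ℤ)) / h) q.1)
            (T.width i (s i + ((q.1 : ℕ) : ℤ)) / h) q.2 (b i) = if β i = b i then 1 else 0 :=
          fun i => hWδ i (β i) (b i)
        simp only [h2]
        by_cases hβ : β = b
        · subst hβ; simp
        · rw [if_neg hβ]
          obtain ⟨i, hi⟩ := Function.ne_iff.mp hβ
          exact Finset.prod_eq_zero (Finset.mem_univ i) (if_neg hi)
      rw [Finset.prod_univ_sum, Fintype.piFinset_univ] at h1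
      simp only [Finset.prod_mul_distrib] at h1
      calc _ = c b * ∑ p : Fin d → Fin 3 × Fin (m + 1), (∏ i, W i (β i) (p i)) *
            ∏ i, monomialMoment
            (stencilCenter (fun r : Fin 3 => T.width i (s i + ((r : ℕ) : ℤ)) / h) (p i).1)
            (T.width i (s i + (((p i).1 : ℕ) : ℤ)) / h) (p i).2 (b i) := by
            rw [Finset.mul_sum]
            exact Finset.sum_congr rfl fun p _ => by ring
        _ = _ := by
            rw [h1]
            split_ifs <;> simp
    simp only [hinner]
    simp
  rw [hrec]
  refine (Finset.abs_sum_le_sum_abs _ _).trans ?_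
  have hterm : ∀ p : Fin d → Fin 3 × Fin (m + 1), |(∏ i, W i (β i) (p i)) *
      T.moment (stencilIndex s fun i => (p i).1) (fun i => ((p i).2 : ℕ)) (fun x =>
        ∑ b, c b * ∏ i, ((x i - T.extNode i (s i)) / h) ^ (b i : ℕ))| ≤ C ^ d * ε := by
    intro p
    rw [abs_mul, Finset.abs_prod]
    refine mul_le_mul ?_ (hε _ _ fun i => Nat.le_of_lt_succ (p i).2.2) (abs_nonneg _) (by positivity)
    calc _ ≤ ∏ _i : Fin d, C := Finset.prod_le_prod (fun _ _ => abs_nonneg _) fun i _ => hW i _ _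
      _ = C ^ d := by simp
  refine (Finset.sum_le_sum fun p _ => hterm p).trans_eq ?_
  rw [Finset.sum_const, Finset.card_univ, nsmul_eq_mul]
  ring

/-! ### Well-posedness -/

/-- The moments of a polynomial on all elements of a stencil. -/
def momentMap (m k : ℕ) (s : Fin d → ℤ) :
    QPoly d k →ₗ[ℝ] ((Fin d → Fin 3 × Fin (m + 1)) → ℝ) where
  toFun w p := T.moment (stencilIndex s fun i => (p i).1) (fun i => ((p i).2 : ℕ))
    fun x => MvPolynomial.eval x (w : MvPolynomial (Fin d) ℝ)
  map_add' v w := by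
    funext p
    have h := T.moment_sub (η := stencilIndex s fun i => (p i).1) (fun i => ((p i).2 : ℕ))
      (f := fun x => MvPolynomial.eval x (v : MvPolynomial (Fin d) ℝ) +
        MvPolynomial.eval x (w : MvPolynomial (Fin d) ℝ))
      (g := fun x => MvPolynomial.eval x (w : MvPolynomial (Fin d) ℝ))
      (T.integrableOn_of_continuous ((MvPolynomial.continuous_eval_real (v : MvPolynomial (Fin d) ℝ)).add
        (MvPolynomial.continuous_eval_real (w : MvPolynomial (Fin d) ℝ))))
      (T.integrableOn_of_continuous (MvPolynomial.continuous_eval_real (w : MvPolynomial (Fin d) ℝ)))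
    simp only [add_sub_cancel_right] at h
    simp only [Pi.add_apply, Submodule.coe_add, map_add]
    linarith
  map_smul' r w := by
    funext p
    simp only [Submodule.coe_smul, MvPolynomial.smul_eval, RingHom.id_apply, Pi.smul_apply,
      smul_eq_mul, moment_const_mul]

variable {T}

/-- Converts conditions over stencil elements and moment orders into conditions over the index type
of `momentMap`. -/
theorem forall_stencil_iff {m : ℕ} {θ : T.Index} {s : Fin d → ℤ}
    (hs : ∀ η, η ∈ T.stencil θ ↔ ∃ r, η = stencilIndex s r) {P : (Fin d → ℤ) → (Fin d → ℕ) → Prop} :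
    (∀ η ∈ T.stencil θ, ∀ α : Fin d → ℕ, (∀ i, α i ≤ m) → P η α) ↔
      ∀ p : Fin d → Fin 3 × Fin (m + 1),
        P (stencilIndex s fun i => (p i).1) (fun i => ((p i).2 : ℕ)) := by
  constructor
  · intro h p
    exact h _ ((hs _).mpr ⟨_, rfl⟩) _ fun i => Nat.le_of_lt_succ (p i).2.2
  · intro h η hη α hα
    obtain ⟨r, rfl⟩ := (hs η).mp hη
    exact h fun i => (r i, ⟨α i, Nat.lt_succ_of_le (hα i)⟩)

theorem nonempty_interior_stencilRegion (θ : T.Index) : (interior (T.stencilRegion θ)).Nonempty := by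
  obtain ⟨s, hs, -⟩ := T.exists_stencil_start θ
  rw [T.stencilRegion_eq hs, interior_pi_Icc, Set.univ_pi_nonempty_iff]
  intro i
  exact Set.nonempty_Ioo.mpr (T.extNode_strictMono i (by omega))

theorem Unisolvent.momentMap_injective {m k : ℕ} (hT : T.Unisolvent m k) {θ : T.Index}
    {s : Fin d → ℤ} (hs : ∀ η, η ∈ T.stencil θ ↔ ∃ r, η = stencilIndex s r) :
    Function.Injective (T.momentMap m k s) := by
  rw [← LinearMap.ker_eq_bot, LinearMap.ker_eq_bot']
  intro w hw
  have h1 := hT θ w w.2 ((forall_stencil_iff hs).mpr fun p => congrFun hw p)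
  exact Subtype.ext (MvPolynomial.eq_zero_of_eval_eq_zero_on_open isOpen_interior
    (nonempty_interior_stencilRegion θ) fun x hx => h1 x (interior_subset hx))

theorem card_stencilMoments (d m : ℕ) :
    Fintype.card (Fin d → Fin 3 × Fin (m + 1)) = (3 * (m + 1)) ^ d := by simp

/-- Injectivity forces `(k + 1) ^ d ≤ (3 * (m + 1)) ^ d`, and for `d ≠ 0` the exponent can be
dropped. This feeds the one-dimensional zero count. -/
theorem Unisolvent.le {m k : ℕ} (hT : T.Unisolvent m k) (hd : d ≠ 0) (θ : T.Index) :
    k + 1 ≤ 3 * (m + 1) := by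
  obtain ⟨s, hs, -⟩ := T.exists_stencil_start θ
  have h := LinearMap.finrank_le_finrank_of_injective (hT.momentMap_injective hs)
  rw [finrank_QPoly, Module.finrank_fintype_fun_eq_card, card_stencilMoments] at h
  exact (Nat.pow_le_pow_iff_left hd).mp h

theorem IsReconstruction.unique {m k : ℕ} (hT : T.Unisolvent m k) {θ : T.Index}
    {u : (Fin d → ℝ) → ℝ} {p q : MvPolynomial (Fin d) ℝ} (hp : T.IsReconstruction m k θ u p)
    (hq : T.IsReconstruction m k θ u q) : p = q := by
  obtain ⟨s, hs, -⟩ := T.exists_stencil_start θ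
  have h := hT.momentMap_injective hs (a₁ := ⟨p, hp.1⟩) (a₂ := ⟨q, hq.1⟩) (funext fun l => ?_)
  · exact congrArg Subtype.val h
  · exact ((forall_stencil_iff hs).mp hp.2 l).trans ((forall_stencil_iff hs).mp hq.2 l).symm

/-- In the square case the dimensions agree, so injectivity of the moment map gives surjectivity. -/
theorem Unisolvent.existsUnique_isReconstruction {m k : ℕ} (hT : T.Unisolvent m k)
    (hkm : k + 1 = 3 * (m + 1)) (θ : T.Index) (u : (Fin d → ℝ) → ℝ) :
    ∃! p, T.IsReconstruction m k θ u p := by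
  obtain ⟨s, hs, -⟩ := T.exists_stencil_start θ
  have hsurj : Function.Surjective (T.momentMap m k s) := by
    rw [← LinearMap.injective_iff_surjective_of_finrank_eq_finrank]
    · exact hT.momentMap_injective hs
    · rw [finrank_QPoly, Module.finrank_fintype_fun_eq_card, card_stencilMoments, hkm]
  obtain ⟨w, hw⟩ := hsurj fun p =>
    T.moment (stencilIndex s fun i => (p i).1) (fun i => ((p i).2 : ℕ)) u
  have hrec : T.IsReconstruction m k θ u w :=
    ⟨w.2, (forall_stencil_iff hs).mpr fun p => congrFun hw p⟩
  exact ⟨w, hrec, fun q hq => hq.unique hT hrec⟩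

theorem isReconstruction_reconstruct {m k : ℕ} {θ : T.Index} {u : (Fin d → ℝ) → ℝ}
    (h : ∃ p, T.IsReconstruction m k θ u p) :
    T.IsReconstruction m k θ u (T.reconstruct m k θ u) := by
  rw [reconstruct, dif_pos h]
  exact h.choose_spec

theorem Unisolvent.reconstruct_eval {m k : ℕ} (hT : T.Unisolvent m k) (θ : T.Index)
    {w : MvPolynomial (Fin d) ℝ} (hw : w ∈ QPoly d k) :
    T.reconstruct m k θ (fun x => MvPolynomial.eval x w) = w := by
  have h : T.IsReconstruction m k θ (fun x => MvPolynomial.eval x w) w := ⟨hw, fun _ _ _ _ => rfl⟩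
  exact (isReconstruction_reconstruct ⟨w, h⟩).unique hT h

end RectMesh

end
noncomputable section

/-! ### Error estimates -/

/-- The exponent loses `d / 2` because the pointwise bound carries the inverse volume of the stencil
under a square root. -/
theorem sq_rpow_sub_half {h : ℝ} (hh : 0 < h) (n d : ℕ) :
    (h ^ ((n : ℝ) - (d : ℝ) / 2)) ^ 2 = (h ^ n) ^ 2 * (h ^ d)⁻¹ := by
  rw [← Real.rpow_natCast, ← Real.rpow_mul hh.le]
  have : ((n : ℝ) - (d : ℝ) / 2) * ((2 : ℕ) : ℝ) = (n : ℝ) * ((2 : ℕ) : ℝ) - d := by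
    push_cast; ring
  rw [this, Real.rpow_sub hh, Real.rpow_mul hh.le, Real.rpow_natCast, Real.rpow_natCast,
    Real.rpow_natCast, div_eq_mul_inv]

theorem rpow_sub_half_mul {h : ℝ} (hh : 0 < h) (n d : ℕ) :
    h ^ ((n : ℝ) - (d : ℝ) / 2) * h ^ ((d : ℝ) / 2) = h ^ n := by
  rw [← Real.rpow_add hh, sub_add_cancel, Real.rpow_natCast]

theorem eq_single_of_sum_eq_one {d : ℕ} {α : Fin d → ℕ} (h : ∑ i, α i = 1) :
    ∃ i, α = Pi.single i 1 := by
  obtain ⟨i, hi⟩ : ∃ i, α i ≠ 0 := by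
    by_contra hcon
    push Not at hcon
    simp [hcon] at h
  refine ⟨i, funext fun j => ?_⟩
  have h1 := Finset.add_sum_erase Finset.univ α (Finset.mem_univ i)
  rw [h] at h1
  by_cases hj : j = i
  · subst hj
    simp only [Pi.single_eq_same]
    omega
  · rw [Pi.single_eq_of_ne hj]
    have h2 := Finset.single_le_sum (f := α) (fun _ _ => Nat.zero_le _)
      (Finset.mem_erase.mpr ⟨hj, Finset.mem_univ j⟩)
    omega

theorem HasWeakDeriv.memSobolev_one {d : ℕ} {V : Set (Fin d → ℝ)} {f : (Fin d → ℝ) → ℝ}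
    {g : Fin d → (Fin d → ℝ) → ℝ} (hf : MemLp f 2 (volume.restrict V))
    (hloc : LocallyIntegrableOn f V)
    (hg : ∀ i, HasWeakDeriv V (Pi.single i 1) f (g i))
    (hg2 : ∀ i, MemLp (g i) 2 (volume.restrict V)) : MemSobolev V 1 f := by
  intro α hα
  rcases Nat.le_one_iff_eq_zero_or_eq_one.mp hα with h | h
  · have : α = 0 := funext fun i => (Finset.sum_eq_zero_iff.mp h) i (Finset.mem_univ i)
    subst this
    exact ⟨f, hasWeakDeriv_zero hloc, hf⟩
  · obtain ⟨i, rfl⟩ := eq_single_of_sum_eq_one h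
    exact ⟨g i, hg i, hg2 i⟩

theorem HasWeakDeriv.sobolevSeminorm_one_le {d : ℕ} {V : Set (Fin d → ℝ)} (hV : IsOpen V)
    {f : (Fin d → ℝ) → ℝ} {g : Fin d → (Fin d → ℝ) → ℝ}
    (hg : ∀ i, HasWeakDeriv V (Pi.single i 1) f (g i)) {M : ℝ≥0∞}
    (hM : ∀ i, eLpNorm (g i) 2 (volume.restrict V) ≤ M) :
    sobolevSeminorm V 1 f ≤ multiCard d 1 * M := by
  have h1 : sobolevSeminorm V 1 f ^ 2 ≤ (multiCard d 1 * M) ^ 2 := by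
    rw [sobolevSeminorm_sq]
    calc _ ≤ ∑ _α ∈ Finset.piAntidiag (Finset.univ : Finset (Fin d)) 1, M ^ 2 := by
          refine Finset.sum_le_sum fun α hα => ?_
          simp only [Finset.mem_piAntidiag] at hα
          obtain ⟨i, rfl⟩ := eq_single_of_sum_eq_one hα.1
          rw [← eLpNorm_two_sq, eLpNorm_congr_ae ((hg i).weakDeriv_ae_eq hV)]
          exact pow_le_pow_left' (hM i) 2
      _ = multiCard d 1 * M ^ 2 := by rw [Finset.sum_const, nsmul_eq_mul, multiCard]
      _ ≤ (multiCard d 1 * M) ^ 2 := by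
          rw [mul_pow]
          gcongr
          exact_mod_cast Nat.le_self_pow two_ne_zero _
  exact (ENNReal.pow_le_pow_left_iff two_ne_zero).mp h1

/-! ### Estimates on the stencils of regular meshes. -/

namespace RectMesh

variable {d : ℕ} {T : RectMesh d}

/-- Local polynomial approximation on the stencils of regular meshes. -/
theorem exists_stencil_approx (d k : ℕ) (hd : 0 < d) (hdk : d ≤ 2 * (k + 1)) {γ : ℝ} (hγ : 0 < γ) :
    ∃ C : ℝ, 0 < C ∧ ∀ T : RectMesh d, T.IsRegular γ → ∀ (θ : T.Index) (u : (Fin d → ℝ) → ℝ),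
      MemSobolev (interior (T.stencilRegion θ)) (k + 2) u →
      ∃ q ∈ QPoly d (k + 1),
        (∀ᵐ x ∂volume.restrict (interior (T.stencilRegion θ)), |u x - MvPolynomial.eval x q| ≤
          C * T.maxSize ^ (((k + 2 : ℕ) : ℝ) - (d : ℝ) / 2) *
            (sobolevSeminorm (interior (T.stencilRegion θ)) (k + 2) u).toReal) ∧
        ∀ i, eLpNorm (fun x => weakDeriv (interior (T.stencilRegion θ)) (Pi.single i 1) u x -
            MvPolynomial.eval x (MvPolynomial.pderiv i q)) 2
            (volume.restrict (interior (T.stencilRegion θ))) ≤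
          ENNReal.ofReal (C * T.maxSize ^ (k + 1)) *
            sobolevSeminorm (interior (T.stencilRegion θ)) (k + 2) u := by
  set N : ℝ := ((multiCard d (k + 2) : ℕ) : ℝ) with hN
  have hN0 : 0 ≤ N := Nat.cast_nonneg _
  -- Square roots of the Bramble–Hilbert constants with box size `L = 3 * h`; `γ ^ d` comes from the
  -- inverse volume of the stencil.
  set C₀ : ℝ := Real.sqrt (2 ^ d * γ ^ d * N) * (3 * d) ^ (k + 2) with hC₀
  set C₁ : ℝ := Real.sqrt (2 ^ d * N) * (3 * d) ^ (k + 1) with hC₁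
  have hC₀0 : 0 ≤ C₀ := by positivity
  have hC₁0 : 0 ≤ C₁ := by positivity
  refine ⟨1 + C₀ + C₁, by positivity, fun T hT θ u hu => ?_⟩
  obtain ⟨s, hs, -⟩ := T.exists_stencil_start θ
  set U := interior (T.stencilRegion θ) with hU
  have hUo : IsOpen U := isOpen_interior
  have hUeq : U = Set.univ.pi fun i => Set.Ioo (T.extNode i (s i)) (T.extNode i (s i + 3)) := by
    rw [hU, T.stencilRegion_eq hs, interior_pi_Icc]
  set h := T.maxSize with hh
  have hpos : 0 < h := T.maxSize_pos ⟨0, hd⟩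
  have hside : ∀ i, T.extNode i (s i + 3) - T.extNode i (s i) =
      T.width i (s i) + T.width i (s i + 1) + T.width i (s i + 2) := by
    intro i
    have e1 := T.extNode_add_one i (s i)
    have e2 := T.extNode_add_one i (s i + 1)
    have e3 := T.extNode_add_one i (s i + 2)
    rw [show s i + 1 + 1 = s i + 2 by ring] at e2
    rw [show s i + 2 + 1 = s i + 3 by ring] at e3
    linarith
  have hSfin := hu.sobolevSeminorm_ne_top hUo
  set S := sobolevSeminorm U (k + 2) u with hS
  obtain ⟨q, hq, hsup, hgrad⟩ := hu.exists_polynomial_approx hdk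
    (a := fun i => T.extNode i (s i)) (b := fun i => T.extNode i (s i + 3))
    (fun i => T.extNode_strictMono i (by omega)) (L := 3 * h)
    (fun i => by
      rw [hside]
      linarith [T.width_le_maxSize i (s i), T.width_le_maxSize i (s i + 1),
        T.width_le_maxSize i (s i + 2)]) (by positivity) hUeq
  have hS2 : S ^ 2 = ENNReal.ofReal (S.toReal ^ 2) := by
    rw [ENNReal.ofReal_pow ENNReal.toReal_nonneg, ENNReal.ofReal_toReal hSfin]
  have hNe : (multiCard d (k + 2) : ℝ≥0∞) = ENNReal.ofReal N := by
    rw [hN, ENNReal.ofReal_natCast]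
  -- By regularity, already one of the three elements in each direction has length at least `h / γ`.
  have hvol : (volume U)⁻¹ ≤ ENNReal.ofReal (γ ^ d * (h ^ d)⁻¹) := by
    have h1 : ENNReal.ofReal ((h / γ) ^ d) ≤ volume U := by
      rw [hUeq, volume_pi_pi]
      simp only [Real.volume_Ioo]
      rw [ENNReal.ofReal_pow (by positivity)]
      calc _ = ∏ _i : Fin d, ENNReal.ofReal (h / γ) := by simp
        _ ≤ _ := by
          refine Finset.prod_le_prod' fun i _ => ENNReal.ofReal_le_ofReal ?_
          rw [hside]
          have h2 : h / γ ≤ T.width i (s i) := by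
            rw [div_le_iff₀ hγ, mul_comm]
            exact hT.trans (mul_le_mul_of_nonneg_left (T.minSize_le_width _ _) hγ.le)
          linarith [T.width_pos i (s i + 1), T.width_pos i (s i + 2)]
    refine (ENNReal.inv_le_inv.mpr h1).trans_eq ?_
    rw [← ENNReal.ofReal_inv_of_pos (by positivity)]
    congr 1
    rw [div_pow, inv_div, div_eq_mul_inv]
  refine ⟨q, hq, ?_, fun i => ?_⟩
  · filter_upwards [hsup] with x hx
    have hA := sq_rpow_sub_half hpos (k + 2) d
    set A := h ^ (((k + 2 : ℕ) : ℝ) - (d : ℝ) / 2) with hAdef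
    have hA0 : 0 ≤ A := Real.rpow_nonneg hpos.le _
    have h1 : ‖u x - MvPolynomial.eval x q‖ₑ ^ 2 ≤
        ENNReal.ofReal ((C₀ * A * S.toReal) ^ 2) := by
      refine hx.trans ?_
      have h2 : (2 : ℝ≥0∞) ^ d = ENNReal.ofReal (2 ^ d) := by
        rw [ENNReal.ofReal_pow (by norm_num)]; norm_num
      calc _ ≤ ENNReal.ofReal (2 ^ d) * ENNReal.ofReal (γ ^ d * (h ^ d)⁻¹) *
            (ENNReal.ofReal ((d * (3 * h)) ^ (k + 2)) ^ 2 * ENNReal.ofReal N *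
              ENNReal.ofReal (S.toReal ^ 2)) := by
            rw [h2, hNe, hS2]
            gcongr
        _ = ENNReal.ofReal (2 ^ d * (γ ^ d * (h ^ d)⁻¹) *
            (((d * (3 * h)) ^ (k + 2)) ^ 2 * N * S.toReal ^ 2)) := by
            rw [ENNReal.ofReal_mul (p := 2 ^ d * (γ ^ d * (h ^ d)⁻¹)) (by positivity),
              ENNReal.ofReal_mul (p := 2 ^ d) (by positivity),
              ENNReal.ofReal_mul (p := ((d * (3 * h)) ^ (k + 2)) ^ 2 * N) (by positivity),
              ENNReal.ofReal_mul (p := ((d * (3 * h)) ^ (k + 2)) ^ 2) (by positivity),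
              ENNReal.ofReal_pow (p := (d * (3 * h)) ^ (k + 2)) (by positivity)]
        _ = ENNReal.ofReal ((C₀ * A * S.toReal) ^ 2) := by
            congr 1
            rw [mul_pow (C₀ * A), mul_pow C₀, hA, hC₀, mul_pow √_, Real.sq_sqrt (by positivity)]
            ring
    have h3 : |u x - MvPolynomial.eval x q| ≤ C₀ * A * S.toReal := by
      rw [Real.enorm_eq_ofReal_abs, ← ENNReal.ofReal_pow (abs_nonneg _),
        ENNReal.ofReal_le_ofReal_iff (by positivity)] at h1
      exact (pow_le_pow_iff_left₀ (abs_nonneg _) (by positivity) two_ne_zero).mp h1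
    refine h3.trans ?_
    gcongr
    linarith
  · have h1 : eLpNorm (fun x => weakDeriv U (Pi.single i 1) u x -
        MvPolynomial.eval x (MvPolynomial.pderiv i q)) 2 (volume.restrict U) ^ 2 ≤
        (ENNReal.ofReal (C₁ * h ^ (k + 1)) * S) ^ 2 := by
      rw [eLpNorm_two_sq]
      refine (hgrad i).trans_eq ?_
      have h2 : (2 : ℝ≥0∞) ^ d = ENNReal.ofReal (2 ^ d) := by
        rw [ENNReal.ofReal_pow (by norm_num)]; norm_num
      rw [h2, hNe, mul_pow (ENNReal.ofReal (C₁ * h ^ (k + 1))), ← mul_assoc]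
      congr 1
      rw [← ENNReal.ofReal_pow (by positivity), ← ENNReal.ofReal_mul (by positivity),
        ← ENNReal.ofReal_mul (by positivity), ← ENNReal.ofReal_pow (by positivity)]
      congr 1
      rw [mul_pow C₁, hC₁, mul_pow √_, Real.sq_sqrt (by positivity)]
      ring
    refine ((ENNReal.pow_le_pow_left_iff two_ne_zero).mp h1).trans ?_
    gcongr
    linarith

/-- On the stencil, a polynomial and its gradient are controlled by its moments, uniformly over
all regular meshes. -/
theorem exists_polynomial_bound (d : ℕ) (hd : 0 < d) {m k : ℕ} (hkm : k + 1 ≤ 3 * (m + 1)) {γ : ℝ}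
    (hγ : 0 < γ) : ∃ C : ℝ, 0 < C ∧ ∀ T : RectMesh d, T.IsRegular γ → ∀ (θ : T.Index)
      (w : MvPolynomial (Fin d) ℝ) (ε : ℝ), w ∈ QPoly d k →
      (∀ η ∈ T.stencil θ, ∀ α : Fin d → ℕ, (∀ i, α i ≤ m) →
        |T.moment η α (fun x => MvPolynomial.eval x w)| ≤ ε) →
      ∀ x ∈ T.stencilRegion θ, |MvPolynomial.eval x w| ≤ C * ε ∧
        ∀ i, |MvPolynomial.eval x (MvPolynomial.pderiv i w)| ≤ C * ε / T.maxSize := by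
  obtain ⟨C, hC0, hC⟩ := exists_coefficient_bound d hd hkm hγ
  set n : ℝ := (Fintype.card (Fin d → Fin (k + 1)) : ℝ) with hn
  -- Number of monomials, times the coefficient bound, times a bound on a scaled monomial and on
  -- `maxSize` times its gradient; `k + 1` covers both.
  refine ⟨n * C * ((k + 1) * (3 ^ k) ^ d), by positivity, fun T hT θ w ε hw hε x hx => ?_⟩
  obtain ⟨s, hs, -⟩ := T.exists_stencil_start θ
  have hpos : 0 < T.maxSize := T.maxSize_pos ⟨0, hd⟩
  obtain ⟨c, hc⟩ := exists_scaledMonomial_expansion hw (fun i => T.extNode i (s i)) hpos.ne'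
  have hfun := funext hc
  have hcb : ∀ β, |c β| ≤ C * ε := by
    refine hC T hT s c ε fun r α hα => ?_
    have := hε _ ((hs _).mpr ⟨r, rfl⟩) α hα
    rwa [hfun] at this
  have hε0 : 0 ≤ C * ε := (abs_nonneg _).trans (hcb fun _ => 0)
  have hξ : ∀ i, |(x i - T.extNode i (s i)) / T.maxSize| ≤ 3 := by
    intro i
    rw [T.stencilRegion_eq hs] at hx
    have hxi : x i ∈ Set.Icc (T.extNode i (s i)) (T.extNode i (s i + 3)) := hx i trivial
    have e1 := T.extNode_add_one i (s i)
    have e2 := T.extNode_add_one i (s i + 1)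
    have e3 := T.extNode_add_one i (s i + 2)
    rw [show s i + 1 + 1 = s i + 2 by ring] at e2
    rw [show s i + 2 + 1 = s i + 3 by ring] at e3
    rw [abs_of_nonneg (div_nonneg (by linarith [hxi.1]) hpos.le), div_le_iff₀ hpos]
    linarith [hxi.2, T.width_le_maxSize i (s i), T.width_le_maxSize i (s i + 1),
        T.width_le_maxSize i (s i + 2)]
  have hmon : (3 ^ k : ℝ) ^ d ≤ (k + 1) * (3 ^ k) ^ d :=
    le_mul_of_one_le_left (by positivity) (by linarith [k.cast_nonneg (α := ℝ)])
  constructor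
  · rw [hc]
    calc _ ≤ ∑ b, |c b * ∏ i, ((x i - T.extNode i (s i)) / T.maxSize) ^ (b i : ℕ)| :=
          Finset.abs_sum_le_sum_abs _ _
      _ ≤ ∑ _b : Fin d → Fin (k + 1), C * ε * ((k + 1) * (3 ^ k) ^ d) := by
          refine Finset.sum_le_sum fun b _ => ?_
          rw [abs_mul]
          exact mul_le_mul (hcb b) ((abs_scaledMonomial_le b hξ).trans hmon) (abs_nonneg _) hε0
      _ = _ := by
          rw [Finset.sum_const, Finset.card_univ, nsmul_eq_mul]
          ring
  · intro i
    rw [← congrFun (partialDeriv_mvPolynomial_eval w i) x, hfun]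
    have hsm : ∀ b : Fin d → Fin (k + 1), ContDiff ℝ ∞ fun x : Fin d → ℝ =>
        ∏ i, ((x i - T.extNode i (s i)) / T.maxSize) ^ (b i : ℕ) := fun b =>
      contDiff_prod fun i _ => (((contDiff_apply ℝ ℝ i).sub contDiff_const).div_const _).pow _
    rw [partialDeriv_sum _ fun b => contDiff_const.mul (hsm b)]
    simp only [partialDeriv_const_mul (hsm _)]
    calc _ ≤ ∑ b, |c b * partialDeriv i (fun x : Fin d → ℝ =>
          ∏ i, ((x i - T.extNode i (s i)) / T.maxSize) ^ (b i : ℕ)) x| :=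
          Finset.abs_sum_le_sum_abs _ _
      _ ≤ ∑ _b : Fin d → Fin (k + 1), C * ε * ((k + 1) * (3 ^ k) ^ d / T.maxSize) := by
          refine Finset.sum_le_sum fun b _ => ?_
          rw [abs_mul]
          refine mul_le_mul (hcb b) ((abs_partialDeriv_scaledMonomial_le b _ hpos hξ i).trans ?_)
            (abs_nonneg _) hε0
          gcongr
          linarith
      _ = _ := by
          rw [Finset.sum_const, Finset.card_univ, nsmul_eq_mul]
          ring

theorem rpow_volume_cell_le (T : RectMesh d) (η : Fin d → ℤ) :
    volume (T.cell η) ^ (1 / 2 : ℝ) ≤ ENNReal.ofReal (T.maxSize ^ ((d : ℝ) / 2)) := by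
  rcases Nat.eq_zero_or_pos d with hd | hd
  · subst hd
    rw [volume_cell]
    simp
  have hpos : 0 < T.maxSize := T.maxSize_pos ⟨0, hd⟩
  have h1 : volume (T.cell η) ≤ ENNReal.ofReal (T.maxSize ^ (d : ℝ)) := by
    rw [volume_cell, Real.rpow_natCast, ENNReal.ofReal_pow hpos.le]
    calc _ ≤ ∏ _i : Fin d, ENNReal.ofReal T.maxSize :=
          Finset.prod_le_prod' fun i _ => ENNReal.ofReal_le_ofReal (T.width_le_maxSize _ _)
      _ = _ := by simp
  refine (ENNReal.rpow_le_rpow h1 (by norm_num)).trans_eq ?_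
  rw [ENNReal.ofReal_rpow_of_nonneg (Real.rpow_nonneg hpos.le _) (by norm_num),
    ← Real.rpow_mul hpos.le]
  congr 2
  ring

/-- Error estimates for the reconstruction, with a constant that is uniform over all regular
meshes. -/
theorem exists_error_bound (d k m : ℕ) (hd : 0 < d) (hdk : d ≤ 2 * (k + 1))
    (hkm : k + 2 ≤ 3 * (m + 1)) {γ : ℝ} (hγ : 0 < γ) :
    ∃ C : ℝ, 0 < C ∧ ∀ T : RectMesh d, T.IsRegular γ →
      ∀ (θ : T.Index) (u : (Fin d → ℝ) → ℝ) (p : MvPolynomial (Fin d) ℝ),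
        MemSobolev (interior (T.stencilRegion θ)) (k + 2) u →
        T.IsReconstruction m (k + 1) θ u p →
        eLpNorm (fun x => u x - MvPolynomial.eval x p) ⊤ (volume.restrict (T.cell (T.toInt θ)))
          ≤ ENNReal.ofReal (C * T.maxSize ^ (((k + 2 : ℕ) : ℝ) - (d : ℝ) / 2)) *
            sobolevSeminorm (interior (T.stencilRegion θ)) (k + 2) u ∧
        eLpNorm (fun x => u x - MvPolynomial.eval x p) 2 (volume.restrict (T.cell (T.toInt θ)))
          ≤ ENNReal.ofReal (C * T.maxSize ^ (k + 2)) *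
            sobolevSeminorm (interior (T.stencilRegion θ)) (k + 2) u ∧
        MemSobolev (interior (T.cell (T.toInt θ))) 1 (fun x => u x - MvPolynomial.eval x p) ∧
        sobolevSeminorm (interior (T.cell (T.toInt θ))) 1 (fun x => u x - MvPolynomial.eval x p)
          ≤ ENNReal.ofReal (C * T.maxSize ^ (k + 1)) *
            sobolevSeminorm (interior (T.stencilRegion θ)) (k + 2) u := by
  obtain ⟨C₁, hC₁, happrox⟩ := exists_stencil_approx d k hd hdk hγ
  obtain ⟨C₂, hC₂, hpoly⟩ := exists_polynomial_bound d hd hkm hγ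
  obtain ⟨M, hM1, hM⟩ := exists_legendrePoly_bound m
  set Λ : ℝ := ((2 * (m : ℝ) + 1) * M) ^ d with hΛ
  have hΛ0 : 0 ≤ Λ := by positivity
  -- The summand 1 accounts for `u - q`, and `C₂ * Λ` for `p - q` by way of its moments.
  set C₃ : ℝ := C₁ * (1 + C₂ * Λ) with hC₃
  have hC₃0 : 0 < C₃ := by positivity
  set N : ℝ := ((multiCard d 1 : ℕ) : ℝ) with hN
  have hN0 : 0 ≤ N := Nat.cast_nonneg _
  -- The second summand is for the `H¹` seminorm, which collects one derivative per unit
  -- multi-index.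
  refine ⟨C₃ + N * C₃, by positivity, fun T hT θ u p hu hp => ?_⟩
  have hpos : 0 < T.maxSize := T.maxSize_pos ⟨0, hd⟩
  set h := T.maxSize with hh
  obtain ⟨s, hs, r₀, hr₀⟩ := T.exists_stencil_start θ
  have hθ : T.toInt θ ∈ T.stencil θ := (hs _).mpr ⟨r₀, hr₀⟩
  set K := T.cell (T.toInt θ) with hK
  set U := interior (T.stencilRegion θ) with hU
  have hUo : IsOpen U := isOpen_interior
  have hSfin := hu.sobolevSeminorm_ne_top hUo
  obtain ⟨q, hq, hsup, hgrad⟩ := happrox T hT θ u hu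
  have hu2 := hu.memLp hUo
  set S := sobolevSeminorm U (k + 2) u with hS
  have hUae : volume.restrict U = volume.restrict (T.stencilRegion θ) := by
    refine Measure.restrict_congr_set ?_
    rw [hU, T.stencilRegion_eq hs]
    exact interior_pi_Icc_ae_eq _ _
  -- The boundary of the stencil is a null set, so a.e. statements on its interior hold a.e. on each
  -- closed cell.
  have hcellac : ∀ η ∈ T.stencil θ, volume.restrict (T.cell η) ≤ volume.restrict U := by
    intro η hη
    rw [hUae]
    exact Measure.restrict_mono (T.cell_subset_stencilRegion hη) le_rfl
  have hUfin : IsFiniteMeasure (volume.restrict U) := by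
    rw [hUae, T.stencilRegion_eq hs]
    exact ⟨by
      rw [Measure.restrict_apply_univ]
      exact (isCompact_univ_pi fun _ => isCompact_Icc).measure_lt_top⟩
  have huint : Integrable u (volume.restrict U) := hu2.integrable (by norm_num)
  have hcellint : ∀ η ∈ T.stencil θ, IntegrableOn u (T.cell η) := fun η hη =>
    huint.mono_measure (hcellac η hη)
  set A := h ^ (((k + 2 : ℕ) : ℝ) - (d : ℝ) / 2) with hA
  have hA0 : 0 ≤ A := Real.rpow_nonneg hpos.le _
  set ε := C₁ * A * S.toReal with hε
  have hε0 : 0 ≤ ε := by positivity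
  have hmom : ∀ η ∈ T.stencil θ, ∀ α : Fin d → ℕ, (∀ i, α i ≤ m) →
      |T.moment η α (fun x => MvPolynomial.eval x (p - q))| ≤ Λ * ε := by
    intro η hη α hα
    have hqi := T.integrableOn_of_continuous (η := η) (MvPolynomial.continuous_eval_real q)
    have hpi := T.integrableOn_of_continuous (η := η) (MvPolynomial.continuous_eval_real p)
    simp only [map_sub]
    rw [T.moment_sub α hpi hqi, hp.2 η hη α hα, ← T.moment_sub α (hcellint η hη) hqi]
    exact T.abs_moment_le hM1 hM η hα ((Measure.absolutelyContinuous_of_le (hcellac η hη)).ae_le hsup)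
  have hw := hpoly T hT θ (p - q) (Λ * ε) (Submodule.sub_mem _ hp.1 hq) hmom
  have hbound : ∀ᵐ x ∂volume.restrict K, ‖u x - MvPolynomial.eval x p‖ ≤ C₃ * A * S.toReal := by
    filter_upwards [(Measure.absolutelyContinuous_of_le (hcellac _ hθ)).ae_le hsup,
      ae_restrict_mem (T.isCompact_cell (T.toInt θ)).measurableSet] with x hx hxK
    have h1 := (hw x (T.cell_subset_stencilRegion hθ hxK)).1
    rw [map_sub] at h1
    rw [Real.norm_eq_abs]
    have h2 : u x - MvPolynomial.eval x p = (u x - MvPolynomial.eval x q) -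
        (MvPolynomial.eval x p - MvPolynomial.eval x q) := by ring
    rw [h2]
    refine (abs_sub _ _).trans ?_
    have h3 : C₃ * A * S.toReal = ε + C₂ * (Λ * ε) := by rw [hC₃, hε]; ring
    rw [h3]
    exact add_le_add hx h1
  have hofS : ∀ a : ℝ, 0 ≤ a → ENNReal.ofReal (a * S.toReal) = ENNReal.ofReal a * S := by
    intro a ha
    rw [ENNReal.ofReal_mul ha, ENNReal.ofReal_toReal hSfin]
  have hKV := rpow_volume_cell_le T (T.toInt θ)
  -- Passing from a pointwise to an `L²` bound gains the square root of the cell volume, at most `h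
  -- ^ (d / 2)`, which restores the full power of `h`.
  have hL2 : ∀ (f : (Fin d → ℝ) → ℝ) (a : ℝ), 0 ≤ a →
      (∀ᵐ x ∂volume.restrict K, ‖f x‖ ≤ a * A * S.toReal) →
      eLpNorm f 2 (volume.restrict K) ≤ ENNReal.ofReal (a * h ^ (k + 2)) * S := by
    intro f a ha hf
    refine (eLpNorm_le_of_ae_bound hf).trans ?_
    rw [Measure.restrict_apply_univ, hofS _ (by positivity), ← mul_assoc]
    gcongr
    have h1 : volume K ^ (ENNReal.toReal 2)⁻¹ ≤ ENNReal.ofReal (h ^ ((d : ℝ) / 2)) := by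
      have : (ENNReal.toReal 2)⁻¹ = (1 / 2 : ℝ) := by norm_num
      rw [this]
      exact hKV
    refine (mul_le_mul' h1 le_rfl).trans_eq ?_
    rw [← ENNReal.ofReal_mul (by positivity)]
    congr 1
    rw [← rpow_sub_half_mul hpos (k + 2) d]
    ring
  set V := interior K with hV
  have hVo : IsOpen V := isOpen_interior
  have hVU : V ⊆ U := interior_mono (T.cell_subset_stencilRegion hθ)
  have hVK : volume.restrict V ≤ volume.restrict K := Measure.restrict_mono interior_subset le_rfl
  have hVU' : volume.restrict V ≤ volume.restrict U := Measure.restrict_mono hVU le_rfl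
  have hVfin : IsFiniteMeasure (volume.restrict K) := ⟨by
    rw [Measure.restrict_apply_univ]
    exact (T.isCompact_cell _).measure_lt_top⟩
  have hcontLp : ∀ {f : (Fin d → ℝ) → ℝ}, Continuous f → MemLp f 2 (volume.restrict V) := by
    intro f hf
    obtain ⟨B, hB⟩ := (T.isCompact_cell (T.toInt θ)).exists_bound_of_continuousOn hf.continuousOn
    refine MemLp.mono_measure hVK (MemLp.of_bound hf.aestronglyMeasurable B ?_)
    filter_upwards [ae_restrict_mem (T.isCompact_cell (T.toInt θ)).measurableSet] with x hx
    exact hB x hx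
  let g : Fin d → (Fin d → ℝ) → ℝ := fun i x =>
    weakDeriv U (Pi.single i 1) u x - MvPolynomial.eval x (MvPolynomial.pderiv i p)
  have hi : ∀ i : Fin d, ∑ j, (Pi.single i 1 : Fin d → ℕ) j ≤ k + 2 := fun i => by simp
  have hgw : ∀ i, HasWeakDeriv V (Pi.single i 1) (fun x => u x - MvPolynomial.eval x p) (g i) := by
    intro i
    have h1 := hasWeakDeriv_of_contDiff (U := V) (contDiff_mvPolynomial_eval p) i
    rw [partialDeriv_mvPolynomial_eval] at h1
    exact ((hu.hasWeakDeriv (hi i)).mono hVU).sub h1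
  have hg2 : ∀ i, MemLp (g i) 2 (volume.restrict V) := fun i =>
    ((hu.memLp_weakDeriv hUo (hi i)).mono_measure hVU').sub
      (hcontLp (MvPolynomial.continuous_eval_real _))
  have hgn : ∀ i, eLpNorm (g i) 2 (volume.restrict V) ≤ ENNReal.ofReal (C₃ * h ^ (k + 1)) * S := by
    intro i
    have hsplit : g i = (fun x => weakDeriv U (Pi.single i 1) u x -
        MvPolynomial.eval x (MvPolynomial.pderiv i q)) -
        fun x => MvPolynomial.eval x (MvPolynomial.pderiv i (p - q)) := by
      funext x
      simp only [g, Pi.sub_apply, map_sub]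
      ring
    have hm1 : AEStronglyMeasurable (fun x => weakDeriv U (Pi.single i 1) u x -
        MvPolynomial.eval x (MvPolynomial.pderiv i q)) (volume.restrict V) :=
      (((hu.memLp_weakDeriv hUo (hi i)).mono_measure hVU').sub
        (hcontLp (MvPolynomial.continuous_eval_real _))).1
    rw [hsplit]
    refine (eLpNorm_sub_le hm1
      (MvPolynomial.continuous_eval_real _).aestronglyMeasurable (by norm_num)).trans ?_
    have e1 := (eLpNorm_mono_measure (p := 2) (fun x => weakDeriv U (Pi.single i 1) u x -
        MvPolynomial.eval x (MvPolynomial.pderiv i q)) hVU').trans (hgrad i)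
    have e2 : eLpNorm (fun x => MvPolynomial.eval x (MvPolynomial.pderiv i (p - q))) 2
        (volume.restrict V) ≤ ENNReal.ofReal (C₁ * (C₂ * Λ) * h ^ (k + 1)) * S := by
      refine (eLpNorm_mono_measure _ hVK).trans ?_
      -- The inverse estimate for the polynomial `p - q` costs one power of `h`, carried here in the
      -- constant.
      have e3 := hL2 (fun x => MvPolynomial.eval x (MvPolynomial.pderiv i (p - q)))
        (C₁ * (C₂ * Λ) / h) (by positivity) (by
          filter_upwards [ae_restrict_mem (T.isCompact_cell (T.toInt θ)).measurableSet] with x hxK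
          have h1 := (hw x (T.cell_subset_stencilRegion hθ hxK)).2 i
          rw [Real.norm_eq_abs]
          refine h1.trans_eq ?_
          rw [hε]
          ring)
      refine e3.trans_eq ?_
      congr 2
      rw [pow_succ h (k + 1)]
      field_simp
    refine (add_le_add e1 e2).trans_eq ?_
    rw [← add_mul, ← ENNReal.ofReal_add (by positivity) (by positivity)]
    congr 2
    rw [hC₃]
    ring
  refine ⟨?_, ?_, ?_, ?_⟩
  · rw [eLpNorm_exponent_top]
    refine (eLpNormEssSup_le_of_ae_bound hbound).trans ?_
    rw [hofS _ (by positivity)]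
    gcongr
    linarith [mul_nonneg hN0 hC₃0.le]
  · refine (hL2 _ C₃ hC₃0.le hbound).trans ?_
    gcongr
    linarith [mul_nonneg hN0 hC₃0.le]
  · refine HasWeakDeriv.memSobolev_one ?_ (hgw ⟨0, hd⟩).1 hgw hg2
    exact (hu2.mono_measure hVU').sub (hcontLp (MvPolynomial.continuous_eval_real p))
  · refine (HasWeakDeriv.sobolevSeminorm_one_le hVo hgw hgn).trans ?_
    rw [← ENNReal.ofReal_natCast, ← mul_assoc, ← ENNReal.ofReal_mul (Nat.cast_nonneg _), ← hN, ← mul_assoc]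
    gcongr
    linarith

end RectMesh

end

/-! ### Conclusion. -/

theorem theorem1 (d : ℕ) (hd : d = 1 ∨ d = 2) (k m : ℕ) (hmk : m < k) :
    -- well-posedness and exactness on every mesh with a unisolvent moment system
    (∀ T : RectMesh d, T.Unisolvent m k → ∀ θ : T.Index,
      (k + 1 = 3 * (m + 1) → ∀ u : (Fin d → ℝ) → ℝ, IntegrableOn u (T.stencilRegion θ) →
        ∃! p, T.IsReconstruction m k θ u p) ∧
      (∀ w ∈ QPoly d k, T.reconstruct m k θ (fun x => MvPolynomial.eval x w) = w)) ∧
    -- error estimates, with a constant that depends on `d`, `k`, `m` and `γ` only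
    (∀ γ : ℝ, 0 < γ → ∃ C : ℝ, 0 < C ∧
      ∀ T : RectMesh d, T.IsRegular γ → T.Unisolvent m k →
      ∀ (θ : T.Index) (u : (Fin d → ℝ) → ℝ),
        MemSobolev (interior (T.stencilRegion θ)) (k + 1) u →
        (∃ p, T.IsReconstruction m k θ u p) →
        eLpNorm (fun x => u x - MvPolynomial.eval x (T.reconstruct m k θ u)) ∞
            (volume.restrict (T.cell (T.toInt θ)))
          ≤ ENNReal.ofReal (C * T.maxSize ^ ((k : ℝ) + 1 - (d : ℝ) / 2)) *
            sobolevSeminorm (interior (T.stencilRegion θ)) (k + 1) u ∧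
        eLpNorm (fun x => u x - MvPolynomial.eval x (T.reconstruct m k θ u)) 2
            (volume.restrict (T.cell (T.toInt θ)))
          ≤ ENNReal.ofReal (C * T.maxSize ^ (k + 1)) *
            sobolevSeminorm (interior (T.stencilRegion θ)) (k + 1) u ∧
        MemSobolev (interior (T.cell (T.toInt θ))) 1
          (fun x => u x - MvPolynomial.eval x (T.reconstruct m k θ u)) ∧
        sobolevSeminorm (interior (T.cell (T.toInt θ))) 1
            (fun x => u x - MvPolynomial.eval x (T.reconstruct m k θ u))
          ≤ ENNReal.ofReal (C * T.maxSize ^ k) *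
            sobolevSeminorm (interior (T.stencilRegion θ)) (k + 1) u) := by
  have hd0 : 0 < d := by omega
  refine ⟨fun T hT θ => ⟨fun hkm u _ => hT.existsUnique_isReconstruction hkm θ u,
    fun w hw => hT.reconstruct_eval θ hw⟩, fun γ hγ => ?_⟩
  -- Possible since `m < k`. The preceding estimates use polynomial degree `l + 1`, and `d ≤ 2`
  -- ensures `d ≤ 2 * (l + 1)`.
  obtain ⟨l, rfl⟩ : ∃ l, k = l + 1 := ⟨k - 1, by omega⟩
  by_cases hkm : l + 2 ≤ 3 * (m + 1)
  · obtain ⟨C, hC, h⟩ := RectMesh.exists_error_bound d l m hd0 (by omega) hkm hγ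
    refine ⟨C, hC, fun T hT _ θ u hu hex => ?_⟩
    have := h T hT θ u _ hu (RectMesh.isReconstruction_reconstruct hex)
    have e : (((l + 2 : ℕ) : ℝ) - (d : ℝ) / 2) = ((l + 1 : ℕ) : ℝ) + 1 - (d : ℝ) / 2 := by
      push_cast; ring
    rwa [e] at this
  -- With more unknowns than moments no mesh can be unisolvent, so any constant will do.
  · exact ⟨1, one_pos, fun T _ hT θ => absurd (hT.le hd0.ne' θ) hkm⟩
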